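/- **Setting.** Let $R$ be a commutative principal ideal domain, $p\in R$ a prime element and assume that $R/(p)$ is finite (e.g. $R=\mathbb Z$ and $p$ a prime number). A $p$-module is an $R$-module of finite length annihilated by a power of $p$ (for $R=\mathbb Z$: a finite abelian $p$-group). For a partition $\mu$ let $M(\mu)=\bigoplus_i R/(p^{\mu_i})$; a $p$-module $M$ has type $\mu=\operatorname{type}(M)$ if $M\cong M(\mu)$. Let $\mathcal S$ be the category of short exact sequences $E:0\to A\to B\to C\to 0$ of $p$-modules, with commutative diagrams as morphisms. The value $g^{\beta}_{\alpha,\gamma}$ of the classical Hall polynomial (written $g^\beta_{\alpha,\gamma}(p)$ for $R=\mathbb Z$) is the number of submodules $U\subset M(\beta)$ such that $U$ has type $\alpha$ and $M(\beta)/U$ has type $\gamma$. **Klein tableaux.** Draw a partition as the diagram whose column lengths are its parts. An LR-sequence is a weakly increasing sequence of partitions $[\gamma^0,\dots,\gamma^e]$ such that $\gamma^\ell_i-\gamma^{\ell-1}_i\le 1$ for all $i$ and $1\le\ell\le e$, and $\sum_{i\ge k}(\gamma^\ell_i-\gamma^{\ell-1}_i)\le\sum_{i\ge k}(\gamma^{\ell-1}_i-\gamma^{\ell-2}_i)$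 for all $k$ and $2\le \ell\le e$. It has type $(\alpha,\beta,\gamma)$ if $\gamma^0=\gamma$, $\gamma^e=\beta$ and $\alpha'_\ell=|\gamma^\ell\setminus\gamma^{\ell-1}|$ for all $\ell\geq 1$, where $\alpha'$ is the conjugate of $\alpha$. A Klein tableau $\Pi=[\gamma^0,\dots,\gamma^e;\varphi^2,\dots,\varphi^e]$ consists of an LR-sequence and maps $\varphi^\ell:\gamma^\ell\setminus\gamma^{\ell-1}\to\mathbb N$ such that (i) $\varphi^\ell$ is weakly increasing along each row; (ii) $\varphi^\ell(b)<m$ for $b$ in row $m$; (iii) $\varphi^\ell(b)=m-1$ if $b$ is in row $m$ and the box above $b$ lies in $\gamma^{\ell-1}\setminus\gamma^{\ell-2}$; (iv) for each $r$, $\#(\varphi^\ell)^{-1}(r)$ is at most the number of boxes in row $r$ of $\gamma^{\ell-1}\setminus\gamma^{\ell-2}$. Its type is the type of the LR-sequence. Sequences are identified if they differ only by repetition of the last partition $\gamma^e$ (so $\gamma^{\ell}=\gamma^e$ for $\ell>e$). The entries of $\Pi$ are at most $2$ if $\gamma^\ell=\gamma^2$ for all $\ell\ge2$. For $u\le\ell$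 put $\Pi|^\ell_u=[\gamma^{\ell-u},\dots,\gamma^\ell;\varphi^{\ell-u+2},\dots,\varphi^\ell]$. A sequence $E:0\to A\to B\to C\to 0$ in $\mathcal S$ (with $A$ identified with its image in $B$) has Klein tableau $\Pi$ if $\gamma^\ell=\operatorname{type}(B/p^\ell A)$ for all $\ell\ge 0$, and if for all $\ell\ge2$, $r\ge1$ one has $\varphi^\ell(b)=r$ for each box $b\in\gamma^{\ell,r}\setminus\gamma^{\ell,r-1}$, where $\gamma^{\ell,r}=\operatorname{type}\bigl(B/(p^\ell A+p(p^{\ell-2}A\cap p^rB))\bigr)$. **Theorem.** Each Klein tableau $\Pi$ with entries at most $2$ is the Klein tableau of a sequence $E(\Pi;p)$ in $\mathcal S$, which is unique up to isomorphism. For all partitions $\alpha,\beta,\gamma$ there are only finitely many Klein tableaux of type $(\alpha,\beta,\gamma)$, and $$g^{\beta}_{\alpha,\gamma}\;=\;\sum_{\Pi}\;\prod_{\ell=2}^{e+1}\frac{\#\operatorname{Aut}_{\mathcal S}E(\Pi|_1^\ell;p)}{\#\operatorname{Aut}_{\mathcal S}E(\Pi|_2^\ell;p)},$$ where the sum is over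 all Klein tableaux $\Pi$ of type $(\alpha,\beta,\gamma)$ and $e=\alpha_1$ (the largest part of $\alpha$, with $e=0$ if $\alpha$ is empty). -/

import Mathlib

open CategoryTheory
open scoped Pointwise

universe u

/-! ### Partitions and skew diagrams

A partition `β = (β₁ ≥ β₂ ≥ ⋯)` is given by the Young diagram whose *columns* have lengths
`β₁, β₂, …`; thus `μ.colLen j` is the part `μ_{j+1}`, `μ.rowLen i` is the part `μ'_{i+1}` of the
conjugate partition, and `(i, j) ∈ μ` is the box in row `i + 1` and column `j + 1`. -/

/-- The skew diagram `γ^ℓ \ γ^{ℓ-1}` of a sequence of partitions (for `1 ≤ ℓ`). -/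
def strip (γ : ℕ → YoungDiagram) (ℓ : ℕ) : Finset (ℕ × ℕ) :=
  (γ ℓ).cells \ (γ (ℓ - 1)).cells

/-- A finite sequence `[γ^0, …, γ^e]` is written as an infinite sequence which is constant from
`γ^e` on.  It is a Littlewood-Richardson sequence if it is weakly increasing, the skew diagrams
`γ^ℓ \ γ^{ℓ-1}` are horizontal stripes, and the lattice permutation property holds. -/
structure IsLRSequence (γ : ℕ → YoungDiagram) : Prop where
  monotone : Monotone γ
  eventually_const : ∃ e, ∀ ℓ, e ≤ ℓ → γ ℓ = γ e
  horizontal : ∀ ℓ, 1 ≤ ℓ → ∀ j, (γ ℓ).colLen j ≤ (γ (ℓ - 1)).colLen j + 1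
  lattice : ∀ ℓ, 2 ≤ ℓ → ∀ k,
    ((strip γ ℓ).filter fun b => k ≤ b.2).card ≤
      ((strip γ (ℓ - 1)).filter fun b => k ≤ b.2).card

/-- `φ` is an `ℓ`-subscript function for the sequence `γ` (where `2 ≤ ℓ`).  Only its values on
the boxes of `γ^ℓ \ γ^{ℓ-1}` matter.  The box `b` lies in the `(b.1 + 1)`-st row. -/
structure IsSubscriptFunction (γ : ℕ → YoungDiagram) (ℓ : ℕ) (φ : ℕ × ℕ → ℕ) : Prop where
  row_mono : ∀ b ∈ strip γ ℓ, ∀ c ∈ strip γ ℓ, b.1 = c.1 → b.2 ≤ c.2 → φ b ≤ φ c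
  lt_row : ∀ b ∈ strip γ ℓ, φ b < b.1 + 1
  below : ∀ i j, (i + 1, j) ∈ strip γ ℓ → (i, j) ∈ strip γ (ℓ - 1) → φ (i + 1, j) = i + 1
  card_le : ∀ r, ((strip γ ℓ).filter fun b => φ b = r).card ≤
    ((strip γ (ℓ - 1)).filter fun b => b.1 + 1 = r).card

/-- A Klein tableau `Π = [γ^0, …, γ^e; φ^2, …, φ^e]`.  Outside of the boxes in
`γ^ℓ \ γ^{ℓ-1}` with `2 ≤ ℓ` the subscripts are set to zero, so that equality of
Klein tableaux means equality of the data `γ^ℓ` and `φ^ℓ`. -/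
@[ext]
structure KleinTableau where
  /-- the partitions `γ^ℓ` -/
  shape : ℕ → YoungDiagram
  /-- the subscript functions `φ^ℓ` -/
  subscript : ℕ → ℕ × ℕ → ℕ
  isLR : IsLRSequence shape
  isSubscript : ∀ ℓ, 2 ≤ ℓ → IsSubscriptFunction shape ℓ (subscript ℓ)
  subscript_off : ∀ ℓ b, ¬ (2 ≤ ℓ ∧ b ∈ strip shape ℓ) → subscript ℓ b = 0

/-- The partition sequence `[γ^{ℓ-u}, …, γ^ℓ]`. -/
def restrictShape (γ : ℕ → YoungDiagram) (u ℓ : ℕ) (i : ℕ) : YoungDiagram :=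
  γ (min (ℓ - u + i) ℓ)

theorem strip_restrictShape_of_le (γ : ℕ → YoungDiagram) {u ℓ i : ℕ} (hi : 1 ≤ i)
    (h : ℓ - u + i ≤ ℓ) : strip (restrictShape γ u ℓ) i = strip γ (ℓ - u + i) := by
  unfold strip restrictShape
  rw [min_eq_left h, min_eq_left (by omega), Nat.add_sub_assoc hi]

theorem strip_restrictShape_of_lt (γ : ℕ → YoungDiagram) {u ℓ i : ℕ}
    (h : ℓ < ℓ - u + i) : strip (restrictShape γ u ℓ) i = ∅ := by
  unfold strip restrictShape
  rw [min_eq_right h.le, min_eq_right (by omega), Finset.sdiff_self]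

namespace KleinTableau

/-- All entries of the tableau are at most `n`. -/
def EntriesAtMost (T : KleinTableau) (n : ℕ) : Prop :=
  ∀ ℓ, n ≤ ℓ → T.shape ℓ = T.shape n

/-- The Klein tableau has type `(α, β, γ)`: `γ^0 = γ`, `γ^e = β` where `e = α₁`, and
`α'_ℓ` is the number of boxes in `γ^ℓ \ γ^{ℓ-1}`, for each `ℓ ≥ 1`. -/
structure IsOfType (T : KleinTableau) (α β γ : YoungDiagram) : Prop where
  card_strip : ∀ ℓ, 1 ≤ ℓ → α.rowLen (ℓ - 1) = (strip T.shape ℓ).card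
  last : T.shape (α.colLen 0) = β
  first : T.shape 0 = γ

/-- The restriction `Π|_u^ℓ = [γ^{ℓ-u}, …, γ^ℓ; φ^{ℓ-u+2}, …, φ^ℓ]` (where `u ≤ ℓ`). -/
def restrict (T : KleinTableau) (u ℓ : ℕ) : KleinTableau where
  shape := restrictShape T.shape u ℓ
  subscript i b := if 2 ≤ i ∧ ℓ - u + i ≤ ℓ then T.subscript (ℓ - u + i) b else 0
  isLR :=
    { monotone := fun i j hij => T.isLR.monotone (by omega)
      eventually_const := ⟨ℓ, fun i hi => by
        unfold restrictShape
        rw [min_eq_right (by omega), min_eq_right (by omega)]⟩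
      horizontal := fun i hi j => by
        unfold restrictShape
        rcases le_or_gt (ℓ - u + i) ℓ with h | h
        · rw [min_eq_left h, min_eq_left (by omega), ← Nat.add_sub_assoc hi]
          exact T.isLR.horizontal _ (by omega) j
        · rw [min_eq_right h.le, min_eq_right (by omega)]
          exact Nat.le_succ _
      lattice := fun i hi k => by
        rcases le_or_gt (ℓ - u + i) ℓ with h | h
        · rw [strip_restrictShape_of_le _ (by omega) h,
            strip_restrictShape_of_le _ (by omega) (by omega),
            ← Nat.add_sub_assoc (by omega : 1 ≤ i)]
          exact T.isLR.lattice _ (by omega) k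
        · rw [strip_restrictShape_of_lt _ h]
          simp }
  isSubscript i hi := by
    rcases le_or_gt (ℓ - u + i) ℓ with h | h
    · have hT := T.isSubscript (ℓ - u + i) (by omega)
      have h1 := strip_restrictShape_of_le T.shape (by omega : 1 ≤ i) h
      have h2 : strip (restrictShape T.shape u ℓ) (i - 1) = strip T.shape (ℓ - u + i - 1) := by
        rw [strip_restrictShape_of_le _ (by omega) (by omega), Nat.add_sub_assoc (by omega)]
      simp only [hi, h, and_self, if_true]
      refine ⟨?_, ?_, ?_, ?_⟩
      · rw [h1]; exact hT.row_mono
      · rw [h1]; exact hT.lt_row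
      · rw [h1, h2]; exact hT.below
      · rw [h1, h2]; exact hT.card_le
    · have h1 := strip_restrictShape_of_lt T.shape h
      refine ⟨?_, ?_, ?_, ?_⟩ <;> simp [h1]
  subscript_off i b hb := by
    split_ifs with h
    · apply T.subscript_off
      rintro ⟨-, h'⟩
      exact hb ⟨h.1, by rwa [strip_restrictShape_of_le _ (by omega) h.2]⟩
    · rfl

end KleinTableau

section Modules

variable {R : Type u} [CommRing R]

/-- The module `M(μ) = ⨁_j R/(p^{μ_j})`. -/
abbrev StdModule (p : R) (μ : YoungDiagram) : Type u :=
  (j : Fin (μ.rowLen 0)) → R ⧸ Ideal.span {p ^ μ.colLen (j : ℕ)}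

/-- The module `M` has type `μ`, that is, `M ≅ M(μ)`. -/
def HasType (p : R) (M : Type u) [AddCommGroup M] [Module R M] (μ : YoungDiagram) : Prop :=
  Nonempty (M ≃ₗ[R] StdModule p μ)

/-- A `p`-module is a module of finite length which is annihilated by some power of `p`. -/
def IsPModule (p : R) (M : Type u) [AddCommGroup M] [Module R M] : Prop :=
  IsFiniteLength R M ∧ ∃ n : ℕ, ∀ x : M, p ^ n • x = 0

/-- The value of the Hall polynomial `g_{α,γ}^β`: the number of submodules `U` of `M(β)` such
that `U` has type `α` and `M(β)/U` has type `γ`. -/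
noncomputable def hallNumber (p : R) (α β γ : YoungDiagram) : ℕ :=
  Nat.card {U : Submodule R (StdModule p β) //
    HasType p U α ∧ HasType p (StdModule p β ⧸ U) γ}

/-- The property of being a short exact sequence `0 → A → B → C → 0` of `p`-modules. -/
def isPSequence (p : R) : ObjectProperty (ShortComplex (ModuleCat.{u} R)) := fun E =>
  E.ShortExact ∧ IsPModule p E.X₁ ∧ IsPModule p E.X₂ ∧ IsPModule p E.X₃

/-- The category `𝒮` of short exact sequences of `p`-modules, with commutative diagrams as
morphisms. -/
abbrev SeqCat (p : R) := (isPSequence p).FullSubcategory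

/-- The submodule `p^ℓ A + p (p^{ℓ-2} A ∩ p^r B)` of `B`, for `2 ≤ ℓ`. -/
def kleinSubmodule (p : R) {B : Type u} [AddCommGroup B] [Module R B] (A : Submodule R B)
    (ℓ r : ℕ) : Submodule R B :=
  p ^ ℓ • A ⊔ p • (p ^ (ℓ - 2) • A ⊓ p ^ r • (⊤ : Submodule R B))

/-- `Π(E) = T`: the Klein tableau of the sequence `E : 0 → A → B → C → 0` is `T`.  That is,
`γ^ℓ` is the type of `B / p^ℓ A`, and for `2 ≤ ℓ` and `1 ≤ r` the boxes in
`γ^{ℓ,r} \ γ^{ℓ,r-1}` carry the subscript `r`, where `γ^{ℓ,r}` is the type of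
`B / (p^ℓ A + p (p^{ℓ-2} A ∩ p^r B))`. -/
def HasKleinTableau (p : R) (E : SeqCat p) (T : KleinTableau) : Prop :=
  let A : Submodule R E.obj.X₂ := LinearMap.range E.obj.f.hom
  (∀ ℓ, HasType p (E.obj.X₂ ⧸ p ^ ℓ • A) (T.shape ℓ)) ∧
  ∃ g : ℕ → ℕ → YoungDiagram,
    (∀ ℓ r, 2 ≤ ℓ → HasType p (E.obj.X₂ ⧸ kleinSubmodule p A ℓ r) (g ℓ r)) ∧
    (∀ ℓ r, 2 ≤ ℓ → 1 ≤ r → ∀ b ∈ (g ℓ r).cells \ (g ℓ (r - 1)).cells, T.subscript ℓ b = r)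

end Modules

/-!
# Hall numbers and Klein tableaux

A submodule `U` of a finite `p`-module `B` has a unique Klein tableau, and the types of `U`, `B` and
`B / U` can be read off from it. Hence `g^β_{α,γ}` is the sum over all tableaux `T` of type
`(α, β, γ)` of the number of submodules `U ⊆ M(β)` with tableau `T`, and this number is computed by
peeling off the submodules `p^i U` one by one.

*Types by lengths.* All invariants are lengths of submodules: `B / X` has type `μ` if and only if
`len (p^i B + X) - len (p^(i+1) B + X)` is the length of the `i`-th row of `μ` for all `i`
(`hasType_quotient_iff`). The defining properties of a Klein tableau then come out of inequalities
between lengths of subquotients, most of them induced by multiplication by `p`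
(`len_subquotient_le`, `exists_isKleinTableauOf`).

*Embeddings with `p^2 A = 0`.* Filter `pA` by the submodules `W_r = p (A ∩ p^r B)` and by its
intersections with `p^a B`. Lifting bases of the graded pieces gives a basis of `B` that is adapted
to `A`: the embedding `A ⊆ B` is a direct sum of *pickets* `(p^k) ⊆ R/(p^m)` and *bipickets*, where
`A` is cyclic with the generator `(p^(m-2), p^(r-1))` in `R/(p^m) ⊕ R/(p^r)` (`exists_normalForm`).
The multiplicities of the summands are determined by the lengths of `p^a B`, `A ∩ p^a B` and
`W_r ∩ p^a B`, hence by the tableau; this gives the uniqueness of `E(T; p)`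
(`IsKleinTableauOf.exists_equiv`). Conversely, given a tableau with entries at most two, taking one
bipicket for each entry `2` in row `m` with subscript `r` (a picket if `r = m - 1`), and filling up
with pickets, realizes it (`exists_isKleinTableauOf_of_entriesAtMost`).

*Counting.* A morphism of short exact sequences is given by its middle component, so that `Aut E` is
the stabilizer of `A` in `Aut B` (`card_aut_eq`). Fix `D ⊆ C` with tableau `Π|_1^ℓ`. By the
uniqueness statement the stabilizer of `D` acts transitively on the set of all `A ⊆ C` with
tableau `Π|_2^ℓ` such that `pA = D`, and the point stabilizers are the groups `Aut E(Π|_2^ℓ)`.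
So there are `# Aut E(Π|_1^ℓ) / # Aut E(Π|_2^ℓ)` such submodules (`card_smul_eq_mul_card_aut`).
For each of them, the submodules `U` with `p^(ℓ-2) U = A` and tableau `[γ^0, …, γ^ℓ]` are in
bijection, via `U ↦ U / D`, with the submodules of `C / D` of the same kind for `A / D` and the
tableau `[γ^0, …, γ^(ℓ-1)]` (`card_hasSegment_quotient`). Induction on `ℓ` yields the product
formula (`card_hasSegment`); the case `D = 0`, `ℓ = e + 1` counts the submodules with tableau `Π`.
As this number is positive, each tableau of type `(α, β, γ)` is realized in the finite module `M(β)`,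
which shows that there are only finitely many of them.
-/

/-! ### Length of submodules -/

section Length

variable {R : Type u} [CommRing R] {M N : Type u} [AddCommGroup M] [Module R M]
  [AddCommGroup N] [Module R N]

/-- The length of a submodule as a natural number; it is only used for finite modules, where the
length is finite. -/
noncomputable def len (X : Submodule R M) : ℕ := (Module.length R X).toNat

theorem len_bot : len (⊥ : Submodule R M) = 0 := by
  simp [len]

theorem coe_len [Finite M] (X : Submodule R M) : (len X : ℕ∞) = Module.length R X :=
  ENat.natCast_toNat Module.length_ne_top

theorem len_map_add [Finite M] [Finite N] (f : M →ₗ[R] N) (X : Submodule R M) :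
    len (X.map f) + len (X ⊓ LinearMap.ker f) = len X := by
  have h := Module.length_eq_add_of_exact (LinearMap.ker (f.submoduleMap X)).subtype
    (f.submoduleMap X) (Submodule.subtype_injective _) (f.submoduleMap_surjective X)
    (LinearMap.exact_subtype_ker_map _)
  have e : (LinearMap.ker (f.submoduleMap X)) ≃ₗ[R] (X ⊓ LinearMap.ker f : Submodule R M) := by
    have : (LinearMap.ker (f.submoduleMap X)) = (X ⊓ LinearMap.ker f).comap X.subtype := by
      ext x
      simp [Subtype.ext_iff]
    rw [this]
    exact Submodule.comapSubtypeEquivOfLe inf_le_left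
  rw [e.length_eq, ← coe_len, ← coe_len, ← coe_len] at h
  have h' : len X = len (X ⊓ LinearMap.ker f) + len (X.map f) := by exact_mod_cast h
  omega

theorem len_map_of_injective [Finite M] [Finite N] {f : M →ₗ[R] N} (hf : Function.Injective f)
    (X : Submodule R M) : len (X.map f) = len X := by
  have := len_map_add f X
  rw [LinearMap.ker_eq_bot.mpr hf, inf_bot_eq, len_bot] at this
  simpa using this

theorem len_mono [Finite M] {X Y : Submodule R M} (h : X ≤ Y) : len X ≤ len Y := by
  have h1 : Module.length R X ≤ Module.length R Y :=
    Module.length_le_of_injective (Submodule.inclusion h) (Submodule.inclusion_injective h)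
  rw [← coe_len, ← coe_len] at h1
  exact_mod_cast h1

theorem len_lt [Finite M] {X Y : Submodule R M} (h : X < Y) : len X < len Y := by
  have h1 : Module.length R X < Module.length R Y := by
    rw [Module.length_submodule, Module.length_submodule]
    exact Submodule.height_strictMono h
  rw [← coe_len, ← coe_len] at h1
  exact_mod_cast h1

theorem eq_of_le_of_len_le [Finite M] {X Y : Submodule R M} (h : X ≤ Y) (hl : len Y ≤ len X) :
    X = Y := by
  by_contra hne
  have := len_lt (lt_of_le_of_ne h hne)
  omega

instance finite_quotient [Finite M] (X : Submodule R M) : Finite (M ⧸ X) :=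
  Finite.of_surjective _ X.mkQ_surjective

theorem len_map_mkQ [Finite M] (X Y : Submodule R M) :
    len (Y.map X.mkQ) + len X = len (Y ⊔ X) := by
  have := len_map_add X.mkQ (Y ⊔ X)
  rw [Submodule.ker_mkQ, inf_eq_right.mpr le_sup_right, Submodule.map_sup,
    Submodule.mkQ_map_self, sup_bot_eq] at this
  exact this

theorem len_sup_add_inf [Finite M] (X Y : Submodule R M) :
    len (X ⊔ Y) + len (X ⊓ Y) = len X + len Y := by
  have h1 := len_map_mkQ Y X
  have h2 := len_map_add Y.mkQ X
  rw [Submodule.ker_mkQ] at h2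
  omega

/-- If `f` maps `Y` onto `Y'` modulo `X'` and `X` into `X'`, then the subquotient `Y'/X'` is an
epimorphic image of `Y/X`, so it is not longer. -/
theorem len_subquotient_le [Finite M] [Finite N] (f : M →ₗ[R] N) {X Y : Submodule R M}
    {X' Y' : Submodule R N} (hX : X.map f ≤ X') (hXY : X ≤ Y) (hY : Y' ≤ Y.map f ⊔ X') :
    len Y' + len X ≤ len Y + len X' := by
  have h1 := len_map_add f Y
  have h2 := len_map_add f X
  have h3 := len_mono hY
  have h4 := len_sup_add_inf (Y.map f) X'
  have h5 : len (X.map f) ≤ len (Y.map f ⊓ X') := len_mono (le_inf (Submodule.map_mono hXY) hX)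
  have h6 : len (X ⊓ LinearMap.ker f) ≤ len (Y ⊓ LinearMap.ker f) :=
    len_mono (inf_le_inf_right _ hXY)
  omega

theorem len_map_equiv [Finite M] [Finite N] (e : M ≃ₗ[R] N) (X : Submodule R M) :
    len (X.map (e : M →ₗ[R] N)) = len X :=
  len_map_of_injective e.injective X

theorem len_pi {ι : Type} [Fintype ι] {Q : ι → Type u} [∀ i, AddCommGroup (Q i)]
    [∀ i, Module R (Q i)] [∀ i, Finite (Q i)] (X : ∀ i, Submodule R (Q i)) :
    len (Submodule.pi Set.univ X) = ∑ i, len (X i) := by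
  let e : (Submodule.pi Set.univ X : Submodule R (∀ i, Q i)) ≃ₗ[R] (∀ i, X i) :=
    { toFun := fun x i => ⟨x.1 i, x.2 i trivial⟩
      invFun := fun y => ⟨fun i => (y i).1, fun i _ => (y i).2⟩
      map_add' := fun _ _ => rfl
      map_smul' := fun _ _ => rfl
      left_inv := fun _ => rfl
      right_inv := fun _ => rfl }
  have h := e.length_eq
  rw [Module.length_pi_of_fintype, ← coe_len] at h
  simp_rw [← coe_len] at h
  exact_mod_cast h

section

variable [IsDomain R] [IsPrincipalIdealRing R] {p : R}

theorem len_span_singleton (hp : Prime p) {x : M} (hx : x ≠ 0) (hpx : p • x = 0) :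
    len (R ∙ x) = 1 := by
  have hmax : (Ideal.span {p}).IsMaximal := PrincipalIdealRing.isMaximal_of_irreducible hp.irreducible
  have hker : LinearMap.ker (LinearMap.toSpanSingleton R M x) = Ideal.span {p} := by
    symm
    apply hmax.eq_of_le
    · intro h
      apply hx
      have : (1 : R) ∈ LinearMap.ker (LinearMap.toSpanSingleton R M x) := h ▸ Submodule.mem_top
      simpa using this
    · rw [Ideal.span_singleton_le_iff_mem]
      simpa using hpx
  have hs : IsSimpleModule R (R ∙ x) := by
    rw [isSimpleModule_iff_quot_maximal]
    refine ⟨Ideal.span {p}, hmax, ⟨?_⟩⟩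
    rw [LinearMap.span_singleton_eq_range]
    exact ((Submodule.quotEquivOfEq _ _ hker.symm).trans
      (LinearMap.toSpanSingleton R M x).quotKerEquivRange).symm
  simp [len, Module.length_eq_one]

theorem len_sup_span_singleton [Finite M] (hp : Prime p) {X : Submodule R M} {x : M}
    (hx : x ∉ X) (hpx : p • x ∈ X) : len (X ⊔ R ∙ x) = len X + 1 := by
  have h := len_map_mkQ X (R ∙ x)
  rw [Submodule.map_span, Set.image_singleton, len_span_singleton hp, sup_comm] at h
  · omega
  · simpa using hx
  · rw [← map_smul, Submodule.mkQ_apply, Submodule.Quotient.mk_eq_zero]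
    exact hpx

/-- Elements of `R` prime to `p` act invertibly on modules annihilated by `p`. -/
theorem dvd_of_smul_mem (hp : Prime p) {X : Submodule R M} {x : M}
    (hpx : p • x ∈ X) (hx : x ∉ X) {c : R} (hc : c • x ∈ X) : p ∣ c := by
  by_contra h
  obtain ⟨a, b, hab⟩ := (hp.irreducible.coprime_iff_not_dvd.mpr h)
  apply hx
  rw [← one_smul R x, ← hab, add_smul, mul_smul, mul_smul]
  exact X.add_mem (X.smul_mem _ hpx) (X.smul_mem _ hc)

end

end Length

/-! ### The type of a `p`-module -/

namespace YoungDiagram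

theorem ext_rowLen {μ ν : YoungDiagram} (h : ∀ i, μ.rowLen i = ν.rowLen i) : μ = ν := by
  ext ⟨i, j⟩
  rw [mem_cells, mem_cells, mem_iff_lt_rowLen, mem_iff_lt_rowLen, h]

theorem le_iff_rowLen {μ ν : YoungDiagram} : μ ≤ ν ↔ ∀ i, μ.rowLen i ≤ ν.rowLen i := by
  constructor
  · intro h i
    by_contra! hlt
    exact absurd (h (mem_iff_lt_rowLen.mpr hlt)) (by simp [mem_iff_lt_rowLen])
  · rintro h ⟨i, j⟩ hij
    exact mem_iff_lt_rowLen.mpr ((mem_iff_lt_rowLen.mp hij).trans_le (h i))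

theorem exists_rowLen_eq (f : ℕ → ℕ) (hf : Antitone f) {n : ℕ} (hn : f n = 0) :
    ∃ μ : YoungDiagram, ∀ i, μ.rowLen i = f i := by
  have hbound : ∀ i j, j < f i → i < n ∧ j < f 0 := fun i j h => by
    refine ⟨?_, h.trans_le (hf (Nat.zero_le _))⟩
    by_contra! hni
    have := hf hni
    omega
  let μ : YoungDiagram :=
    { cells := ((Finset.range n) ×ˢ (Finset.range (f 0))).filter fun b => b.2 < f b.1
      isLowerSet := by
        rintro ⟨i, j⟩ ⟨i', j'⟩ ⟨hi, hj⟩ h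
        simp only [Finset.coe_filter, Finset.mem_product, Finset.mem_range, Set.mem_ofPred_eq]
          at h hi hj ⊢
        have h1 : j' < f i' := (hj.trans_lt h.2).trans_le (hf hi)
        exact ⟨hbound _ _ h1, h1⟩ }
  refine ⟨μ, fun i => eq_of_forall_lt_iff fun j => ?_⟩
  rw [← mem_iff_lt_rowLen, ← mem_cells]
  simp only [μ, Finset.mem_filter, Finset.mem_product, Finset.mem_range]
  exact ⟨fun h => h.2, fun h => ⟨hbound _ _ h, h⟩⟩

theorem card_filter_lt_colLen (μ : YoungDiagram) (i : ℕ) :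
    (Finset.univ.filter fun j : Fin (μ.rowLen 0) => i < μ.colLen j).card = μ.rowLen i := by
  rw [← Finset.card_map Fin.valEmbedding, ← Finset.card_range (μ.rowLen i)]
  congr 1
  ext j
  simp only [Finset.mem_map, Finset.mem_filter, Finset.mem_univ, true_and, Fin.valEmbedding_apply,
    Finset.mem_range, ← mem_iff_lt_colLen, mem_iff_lt_rowLen]
  constructor
  · rintro ⟨a, h, rfl⟩
    exact h
  · intro h
    exact ⟨⟨j, h.trans_le (μ.rowLen_anti 0 i (Nat.zero_le _))⟩, h, rfl⟩

end YoungDiagram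

section Types

variable {R : Type u} [CommRing R] {M N : Type u} [AddCommGroup M] [Module R M]
  [AddCommGroup N] [Module R N]

theorem mem_smul_top {p : R} {i : ℕ} {x : M} :
    x ∈ p ^ i • (⊤ : Submodule R M) ↔ ∃ y : M, p ^ i • y = x := by
  simp [Submodule.mem_smul_pointwise_iff_exists]

theorem map_smul_submodule (f : M →ₗ[R] N) (a : R) (X : Submodule R M) :
    (a • X).map f = a • X.map f := by
  ext y
  simp only [Submodule.mem_map, Submodule.mem_smul_pointwise_iff_exists]
  constructor
  · rintro ⟨_, ⟨x, hx, rfl⟩, rfl⟩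
    exact ⟨f x, ⟨x, hx, rfl⟩, by simp⟩
  · rintro ⟨_, ⟨x, hx, rfl⟩, rfl⟩
    exact ⟨a • x, ⟨x, hx, rfl⟩, by simp⟩

theorem smul_submodule_pi {ι : Type} {Q : ι → Type u} [∀ i, AddCommGroup (Q i)] [∀ i, Module R (Q i)]
    (a : R) (X : ∀ i, Submodule R (Q i)) :
    a • Submodule.pi Set.univ X = Submodule.pi Set.univ fun i => a • X i := by
  ext x
  simp only [Submodule.mem_smul_pointwise_iff_exists, Submodule.mem_pi, Set.mem_univ, true_imp_iff]
  constructor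
  · rintro ⟨y, hy, rfl⟩ i
    exact ⟨y i, hy i, rfl⟩
  · intro h
    choose y hy hxy using h
    exact ⟨y, hy, funext hxy⟩

theorem smul_top_pi {ι : Type} {Q : ι → Type u} [∀ i, AddCommGroup (Q i)] [∀ i, Module R (Q i)]
    (a : R) : a • (⊤ : Submodule R (∀ i, Q i)) =
      Submodule.pi Set.univ fun i => a • (⊤ : Submodule R (Q i)) := by
  rw [← smul_submodule_pi]
  congr 1
  ext
  simp

theorem len_smul_top_congr [Finite M] [Finite N] (e : M ≃ₗ[R] N) (a : R) :
    len (a • (⊤ : Submodule R M)) = len (a • (⊤ : Submodule R N)) := by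
  rw [← len_map_equiv e, map_smul_submodule, Submodule.map_top, LinearEquiv.range]

/-- Families of exponents with the same conjugate give isomorphic modules. -/
theorem nonempty_pi_equiv_of_card {p : R} {ι κ : Type} [Fintype ι] [Fintype κ] (k : ι → ℕ)
    (l : κ → ℕ) (h : ∀ i, (Finset.univ.filter fun t => i < k t).card =
      (Finset.univ.filter fun t => i < l t).card) :
    Nonempty ((∀ t, R ⧸ Ideal.span {p ^ k t}) ≃ₗ[R] (∀ t, R ⧸ Ideal.span {p ^ l t})) := by
  -- factors with exponent zero are trivial
  have hpos : ∀ {ι : Type} [Fintype ι] (k : ι → ℕ), Nonempty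
      ((∀ t, R ⧸ Ideal.span {p ^ k t}) ≃ₗ[R] (∀ t : {t // 0 < k t}, R ⧸ Ideal.span {p ^ k t})) := by
    intro ι _ k
    let f : (∀ t, R ⧸ Ideal.span {p ^ k t}) →ₗ[R] (∀ t : {t // 0 < k t}, R ⧸ Ideal.span {p ^ k t}) :=
      LinearMap.pi fun t => LinearMap.proj t.1
    have hsub : ∀ t, ¬ 0 < k t → Subsingleton (R ⧸ Ideal.span {p ^ k t}) := fun t ht => by
      rw [Ideal.Quotient.subsingleton_iff, Ideal.span_singleton_eq_top]
      simp [Nat.eq_zero_of_not_pos ht]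
    refine ⟨LinearEquiv.ofBijective f ⟨?_, ?_⟩⟩
    · intro x y hxy
      ext t
      by_cases ht : 0 < k t
      · exact congrFun hxy ⟨t, ht⟩
      · have := hsub t ht
        exact Subsingleton.elim _ _
    · intro y
      classical
      refine ⟨fun t => if ht : 0 < k t then y ⟨t, ht⟩ else 0, ?_⟩
      ext ⟨t, ht⟩
      simp [f, ht]
  have hfib : ∀ c : ℕ, Nonempty ({t : {t // 0 < k t} // k t = c} ≃ {t : {t // 0 < l t} // l t = c}) := by
    have hcount : ∀ {ι : Type} [Fintype ι] (k : ι → ℕ) (c : ℕ), 0 < c →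
        Fintype.card {t : {t // 0 < k t} // k t = c} +
          (Finset.univ.filter fun t => c < k t).card =
          (Finset.univ.filter fun t => c - 1 < k t).card := by
      intro ι _ k c hc
      classical
      have h1 : Fintype.card {t : {t // 0 < k t} // k t = c} =
          (Finset.univ.filter fun t => k t = c).card := by
        rw [← Fintype.card_subtype]
        exact Fintype.card_congr
          ⟨fun t => ⟨t.1.1, t.2⟩, fun t => ⟨⟨t.1, by have := t.2; omega⟩, t.2⟩,
            fun _ => rfl, fun _ => rfl⟩
      rw [h1, ← Finset.card_union_of_disjoint]
      · congr 1
        ext t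
        simp only [Finset.mem_union, Finset.mem_filter, Finset.mem_univ, true_and]
        omega
      · rw [Finset.disjoint_filter]
        intro t _ h
        omega
    intro c
    rcases Nat.eq_zero_or_pos c with rfl | hc
    · have h1 : IsEmpty {t : {t // 0 < k t} // k t = 0} := ⟨fun t => by
        have := t.1.2
        have := t.2
        omega⟩
      have h2 : IsEmpty {t : {t // 0 < l t} // l t = 0} := ⟨fun t => by
        have := t.1.2
        have := t.2
        omega⟩
      exact ⟨Equiv.equivOfIsEmpty _ _⟩
    · rw [← Fintype.card_eq]
      have h1 := hcount k c hc
      have h2 := hcount l c hc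
      have h3 := h c
      have h4 := h (c - 1)
      omega
  let σ : {t // 0 < k t} ≃ {t // 0 < l t} :=
    (Equiv.sigmaFiberEquiv fun t : {t // 0 < k t} => k t).symm.trans
      ((Equiv.sigmaCongrRight fun c => (hfib c).some).trans
        (Equiv.sigmaFiberEquiv fun t : {t // 0 < l t} => l t))
  have hσ : ∀ t, l (σ t) = k t := fun t => ((hfib (k t)).some ⟨t, rfl⟩).2
  obtain ⟨e1⟩ := hpos k
  obtain ⟨e2⟩ := hpos l
  let e3 : (∀ t : {t // 0 < k t}, R ⧸ Ideal.span {p ^ k t}) ≃ₗ[R]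
      (∀ t : {t // 0 < k t}, R ⧸ Ideal.span {p ^ l (σ t)}) :=
    LinearEquiv.piCongrRight fun t => Submodule.quotEquivOfEq _ _ (by rw [hσ])
  exact ⟨e1.trans (e3.trans ((LinearEquiv.piCongrLeft R
    (fun t : {t // 0 < l t} => R ⧸ Ideal.span {p ^ l t}) σ).trans e2.symm))⟩

theorem HasType.congr {p : R} {μ : YoungDiagram} (h : HasType p M μ) (e : M ≃ₗ[R] N) : HasType p N μ :=
  ⟨e.symm.trans h.some⟩

theorem HasType.pow_smul_eq_zero {p : R} {μ : YoungDiagram} (h : HasType p M μ) (x : M) :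
    p ^ μ.colLen 0 • x = 0 := by
  obtain ⟨e⟩ := h
  refine e.injective ?_
  rw [map_smul, map_zero]
  ext j
  obtain ⟨y, hy⟩ := Ideal.Quotient.mk_surjective (e x j)
  rw [Pi.smul_apply, ← hy, ← Ideal.Quotient.mk_eq_mk, ← Submodule.Quotient.mk_smul, Pi.zero_apply,
    Submodule.Quotient.mk_eq_zero, smul_eq_mul]
  exact Ideal.mul_mem_right _ _ (Ideal.mem_span_singleton.mpr
    (pow_dvd_pow _ (μ.colLen_anti 0 j (Nat.zero_le _))))

theorem len_pow_smul_top_quotient [Finite M] (X : Submodule R M) (a : R) :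
    len (a • (⊤ : Submodule R (M ⧸ X))) + len X = len (a • (⊤ : Submodule R M) ⊔ X) := by
  rw [← len_map_mkQ, map_smul_submodule, Submodule.map_top, Submodule.range_mkQ]

theorem exists_pow_smul_quotient {p : R} (hM : ∃ n : ℕ, ∀ x : M, p ^ n • x = 0)
    (X : Submodule R M) : ∃ n : ℕ, ∀ x : M ⧸ X, p ^ n • x = 0 := by
  obtain ⟨n, hn⟩ := hM
  refine ⟨n, fun x => ?_⟩
  obtain ⟨y, rfl⟩ := X.mkQ_surjective x
  rw [← map_smul, hn, map_zero]

section

variable [IsDomain R] [IsPrincipalIdealRing R] {p : R}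

theorem finite_quotient_pow [Finite (R ⧸ Ideal.span {p})] (n : ℕ) :
    Finite (R ⧸ Ideal.span {p ^ n}) := by
  rw [← Ideal.span_singleton_pow]
  exact Ideal.finite_quotient_pow (IsNoetherian.noetherian _) n

theorem finite_stdModule [Finite (R ⧸ Ideal.span {p})] (μ : YoungDiagram) :
    Finite (StdModule p μ) :=
  have := fun n => finite_quotient_pow (p := p) n
  inferInstance

theorem len_pow_smul_top_cyclic [Finite (R ⧸ Ideal.span {p})] (hp : Prime p) (c i : ℕ) :
    len (p ^ i • (⊤ : Submodule R (R ⧸ Ideal.span {p ^ c}))) =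
      len (p ^ (i + 1) • (⊤ : Submodule R (R ⧸ Ideal.span {p ^ c}))) + if i < c then 1 else 0 := by
  have := finite_quotient_pow (p := p) c
  have h1 : p ^ i • (⊤ : Submodule R (R ⧸ Ideal.span {p ^ c})) =
      p ^ (i + 1) • ⊤ ⊔ R ∙ (Ideal.Quotient.mk (Ideal.span {p ^ c}) (p ^ i)) := by
    apply le_antisymm
    · intro x hx
      obtain ⟨y, rfl⟩ := mem_smul_top.mp hx
      obtain ⟨y, rfl⟩ := Ideal.Quotient.mk_surjective y
      refine Submodule.mem_sup_right (Submodule.mem_span_singleton.mpr ⟨y, ?_⟩)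
      rw [← Ideal.Quotient.mk_eq_mk, ← Ideal.Quotient.mk_eq_mk, ← Submodule.Quotient.mk_smul,
        ← Submodule.Quotient.mk_smul, smul_eq_mul, smul_eq_mul, mul_comm]
    · refine sup_le ?_ ?_
      · intro x hx
        obtain ⟨y, rfl⟩ := mem_smul_top.mp hx
        exact mem_smul_top.mpr ⟨p • y, by rw [smul_smul, pow_succ]⟩
      · rw [Submodule.span_singleton_le_iff_mem]
        refine mem_smul_top.mpr ⟨Ideal.Quotient.mk _ 1, ?_⟩
        rw [← Ideal.Quotient.mk_eq_mk, ← Ideal.Quotient.mk_eq_mk, ← Submodule.Quotient.mk_smul,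
          smul_eq_mul, mul_one]
  split_ifs with hic
  · rw [h1]
    apply len_sup_span_singleton hp
    · intro hmem
      obtain ⟨y, hy⟩ := mem_smul_top.mp hmem
      obtain ⟨y, rfl⟩ := Ideal.Quotient.mk_surjective y
      rw [← Ideal.Quotient.mk_eq_mk, ← Ideal.Quotient.mk_eq_mk, ← Submodule.Quotient.mk_smul,
        Submodule.Quotient.eq, Ideal.mem_span_singleton, smul_eq_mul] at hy
      have h2 : p ^ (i + 1) ∣ p ^ i := by
        have := (pow_dvd_pow p hic).trans hy
        exact (dvd_sub_right (dvd_mul_right _ _)).mp this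
      have := (pow_dvd_pow_iff hp.ne_zero hp.not_isUnit).mp h2
      omega
    · refine mem_smul_top.mpr ⟨Ideal.Quotient.mk _ 1, ?_⟩
      rw [← Ideal.Quotient.mk_eq_mk, ← Ideal.Quotient.mk_eq_mk, ← Submodule.Quotient.mk_smul,
        ← Submodule.Quotient.mk_smul, smul_eq_mul, smul_eq_mul, mul_one, pow_succ']
  · rw [h1, add_zero]
    congr 1
    refine sup_eq_left.mpr ?_
    have : Ideal.Quotient.mk (Ideal.span {p ^ c}) (p ^ i) = 0 := by
      rw [Ideal.Quotient.eq_zero_iff_dvd]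
      exact pow_dvd_pow _ (by omega)
    rw [this]
    simp

theorem len_pow_smul_top_pi [Finite (R ⧸ Ideal.span {p})] (hp : Prime p) {ι : Type} [Fintype ι]
    (k : ι → ℕ) (i : ℕ) :
    len (p ^ i • (⊤ : Submodule R (∀ t, R ⧸ Ideal.span {p ^ k t}))) =
      len (p ^ (i + 1) • (⊤ : Submodule R (∀ t, R ⧸ Ideal.span {p ^ k t}))) +
        (Finset.univ.filter fun t => i < k t).card := by
  have := fun n => finite_quotient_pow (p := p) n
  rw [smul_top_pi, smul_top_pi, len_pi, len_pi, Finset.card_filter, ← Finset.sum_add_distrib]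
  exact Finset.sum_congr rfl fun t _ => len_pow_smul_top_cyclic hp _ _

theorem HasType.len_pow_smul_top [Finite (R ⧸ Ideal.span {p})] (hp : Prime p) [Finite M]
    {μ : YoungDiagram} (h : HasType p M μ) (i : ℕ) :
    len (p ^ i • (⊤ : Submodule R M)) = len (p ^ (i + 1) • (⊤ : Submodule R M)) + μ.rowLen i := by
  obtain ⟨e⟩ := h
  have := finite_stdModule (p := p) μ
  rw [len_smul_top_congr e, len_smul_top_congr e, len_pow_smul_top_pi hp,
    μ.card_filter_lt_colLen]

theorem HasType.finite [Finite (R ⧸ Ideal.span {p})] {μ : YoungDiagram} (h : HasType p M μ) :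
    Finite M :=
  have := finite_stdModule (p := p) μ
  Finite.of_equiv _ h.some.symm.toEquiv

theorem HasType.unique [Finite (R ⧸ Ideal.span {p})] (hp : Prime p) {μ ν : YoungDiagram}
    (h : HasType p M μ) (h' : HasType p M ν) : μ = ν := by
  have := h.finite
  refine YoungDiagram.ext_rowLen fun i => ?_
  have h1 := h.len_pow_smul_top hp i
  have h2 := h'.len_pow_smul_top hp i
  omega

theorem exists_hasType (hp : Prime p) [Finite M]
    (hM : ∃ n : ℕ, ∀ x : M, p ^ n • x = 0) : ∃ μ, HasType p M μ := by
  obtain ⟨n, hn⟩ := hM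
  obtain ⟨d, k, ⟨e⟩⟩ := Module.torsion_by_prime_power_decomposition (R := R) (M := M) hp.irreducible
    (fun {x} => ⟨⟨p ^ n, n, rfl⟩, hn x⟩)
  have e := e.trans (DirectSum.linearEquivFunOnFintype R (Fin d) _)
  obtain ⟨μ, hμ⟩ := YoungDiagram.exists_rowLen_eq
    (fun i => (Finset.univ.filter fun t => i < k t).card)
    (fun i j hij => Finset.card_le_card (Finset.monotone_filter_right _
      (fun t _ ht => by omega)))
    (n := ∑ t, k t) (by
      rw [Finset.card_eq_zero, Finset.filter_eq_empty_iff]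
      intro t _
      have := Finset.single_le_sum (f := k) (fun _ _ => Nat.zero_le _) (Finset.mem_univ t)
      omega)
  obtain ⟨e'⟩ := nonempty_pi_equiv_of_card (p := p) k (fun j : Fin (μ.rowLen 0) => μ.colLen j)
    (fun i => by rw [μ.card_filter_lt_colLen, hμ])
  exact ⟨μ, ⟨e.trans e'⟩⟩

/-- The type is detected by the lengths of the submodules `p^i M`. -/
theorem hasType_iff [Finite (R ⧸ Ideal.span {p})] (hp : Prime p) [Finite M]
    (hM : ∃ n : ℕ, ∀ x : M, p ^ n • x = 0) {μ : YoungDiagram} :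
    HasType p M μ ↔ ∀ i, len (p ^ i • (⊤ : Submodule R M)) =
      len (p ^ (i + 1) • (⊤ : Submodule R M)) + μ.rowLen i := by
  refine ⟨fun h => h.len_pow_smul_top hp, fun h => ?_⟩
  obtain ⟨ν, hν⟩ := exists_hasType hp hM
  have : μ = ν := YoungDiagram.ext_rowLen fun i => by
    have h1 := h i
    have h2 := hν.len_pow_smul_top hp i
    omega
  rwa [this]

theorem hasType_quotient_iff [Finite (R ⧸ Ideal.span {p})] (hp : Prime p) [Finite M]
    (hM : ∃ n : ℕ, ∀ x : M, p ^ n • x = 0) {X : Submodule R M} {μ : YoungDiagram} :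
    HasType p (M ⧸ X) μ ↔ ∀ i, len (p ^ i • (⊤ : Submodule R M) ⊔ X) =
      len (p ^ (i + 1) • (⊤ : Submodule R M) ⊔ X) + μ.rowLen i := by
  rw [hasType_iff hp (exists_pow_smul_quotient hM X)]
  simp_rw [← len_pow_smul_top_quotient]
  exact forall_congr' fun i => by omega

end

end Types

/-! ### Combinatorics of Klein tableaux -/

theorem card_filter_row_sdiff {μ ν : YoungDiagram} (h : μ ≤ ν) (i : ℕ) :
    ((ν.cells \ μ.cells).filter fun b => b.1 = i).card + μ.rowLen i = ν.rowLen i := by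
  rw [YoungDiagram.rowLen_eq_card, YoungDiagram.rowLen_eq_card,
    ← Finset.card_union_of_disjoint]
  · congr 1
    ext b
    simp only [YoungDiagram.row, Finset.mem_union, Finset.mem_filter, Finset.mem_sdiff]
    have : b ∈ μ.cells → b ∈ ν.cells := fun hb => YoungDiagram.cells_subset_iff.mpr h hb
    tauto
  · rw [Finset.disjoint_left]
    intro b
    simp only [YoungDiagram.row, Finset.mem_filter, Finset.mem_sdiff]
    tauto

theorem card_eq_sum_rowLen (μ : YoungDiagram) {n : ℕ} (hn : μ.rowLen n = 0) :
    μ.cells.card = ∑ i ∈ Finset.range n, μ.rowLen i := by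
  rw [Finset.card_eq_sum_card_fiberwise (f := Prod.fst) (t := Finset.range n)]
  · simp_rw [YoungDiagram.rowLen_eq_card]
    rfl
  · rintro ⟨i, j⟩ hb
    have h1 : j < μ.rowLen i := YoungDiagram.mem_iff_lt_rowLen.mp hb
    simp only [Finset.coe_range, Set.mem_Iio]
    by_contra! h2
    have := μ.rowLen_anti _ _ h2
    omega

theorem colLen_le_of_rowLen {μ ν : YoungDiagram} (h : ∀ i, ν.rowLen (i + 1) ≤ μ.rowLen i) (j : ℕ) :
    ν.colLen j ≤ μ.colLen j + 1 := by
  by_contra! hlt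
  have h1 : (μ.colLen j + 1, j) ∈ ν := YoungDiagram.mem_iff_lt_colLen.mpr hlt
  have h2 : (μ.colLen j, j) ∈ μ := YoungDiagram.mem_iff_lt_rowLen.mpr
    ((YoungDiagram.mem_iff_lt_rowLen.mp h1).trans_le (h _))
  exact absurd (YoungDiagram.mem_iff_lt_colLen.mp h2) (lt_irrefl _)

theorem mem_of_mem_of_colLen {μ ν : YoungDiagram} {i j : ℕ} (h : ν.colLen j ≤ μ.colLen j + 1)
    (hν : (i + 1, j) ∈ ν) : (i, j) ∈ μ := by
  rw [YoungDiagram.mem_iff_lt_colLen] at hν ⊢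
  omega

/-- The lattice permutation property follows from the conditions on the subscripts: compare the
boxes of subscript `r` with the boxes of the previous stripe in row `r`. -/
theorem lattice_of_isSubscriptFunction {γ : ℕ → YoungDiagram} {ℓ : ℕ} {φ : ℕ × ℕ → ℕ}
    (hφ : IsSubscriptFunction γ ℓ φ)
    (h1 : ∀ j, (γ ℓ).colLen j ≤ (γ (ℓ - 1)).colLen j + 1)
    (h2 : ∀ j, (γ (ℓ - 1)).colLen j ≤ (γ (ℓ - 1 - 1)).colLen j + 1) (k : ℕ) :
    ((strip γ ℓ).filter fun b => k ≤ b.2).card ≤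
      ((strip γ (ℓ - 1)).filter fun b => k ≤ b.2).card := by
  set S := (strip γ ℓ).filter fun b => k ≤ b.2 with hS
  set T := (strip γ (ℓ - 1)).filter fun b => k ≤ b.2 with hT
  rw [Finset.card_eq_sum_card_fiberwise (f := φ) (s := S)
      (t := S.image φ ∪ T.image fun c => c.1 + 1)
      (fun b hb => Finset.mem_coe.mpr (Finset.mem_union_left _ (Finset.mem_image_of_mem _ hb))),
    Finset.card_eq_sum_card_fiberwise (f := fun c => c.1 + 1) (s := T)
      (t := S.image φ ∪ T.image fun c => c.1 + 1)
      (fun b hb => Finset.mem_coe.mpr (Finset.mem_union_right _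
        (Finset.mem_image_of_mem (fun c : ℕ × ℕ => c.1 + 1) hb)))]
  refine Finset.sum_le_sum fun r _ => ?_
  by_cases hc : ∃ c ∈ strip γ (ℓ - 1), c.1 + 1 = r ∧ c.2 < k
  · -- the boxes counted on the left lie in row `r + 1`, below boxes counted on the right
    obtain ⟨⟨i, j⟩, hc, rfl, hj⟩ := hc
    have key : ∀ b ∈ S.filter (fun b => φ b = i + 1), b.1 = i + 1 ∧ (i, b.2) ∈ T := by
      rintro ⟨m, n⟩ hb
      simp only [hS, hT, strip, Finset.mem_filter, Finset.mem_sdiff, YoungDiagram.mem_cells] at hb hc ⊢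
      simp only at hj
      obtain ⟨⟨hb, hkn⟩, hr⟩ := hb
      have hm : i + 1 < m + 1 := by
        rw [← hr]
        exact hφ.lt_row _ (by simpa [strip] using hb)
      obtain ⟨m, rfl⟩ : ∃ m', m = m' + 1 := ⟨m - 1, by omega⟩
      have hmem := mem_of_mem_of_colLen (h1 n) hb.1
      have hmi : m = i := by
        by_contra hne
        have h3 : (i + 1, n) ∈ γ (ℓ - 1) := (γ (ℓ - 1)).up_left_mem (by omega) le_rfl hmem
        have h4 := mem_of_mem_of_colLen (h2 n) h3
        exact hc.2 ((γ (ℓ - 1 - 1)).up_left_mem le_rfl (by omega) h4)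
      subst hmi
      refine ⟨rfl, ⟨hmem, fun h4 => hc.2 ((γ (ℓ - 1 - 1)).up_left_mem le_rfl (by omega) h4)⟩, hkn⟩
    refine Finset.card_le_card_of_injOn (fun b => (i, b.2)) ?_ ?_
    · intro b hb
      simp only [Finset.coe_filter, Set.mem_ofPred_eq]
      exact ⟨(key b hb).2, trivial⟩
    · rintro b hb c hc hbc
      have h3 := (key b hb).1
      have h4 := (key c hc).1
      simp only [Prod.mk.injEq, true_and] at hbc
      exact Prod.ext (h3.trans h4.symm) hbc
  · push Not at hc
    calc _ ≤ ((strip γ ℓ).filter fun b => φ b = r).card := by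
          refine Finset.card_le_card fun b => ?_
          simp only [hS, Finset.mem_filter]
          tauto
      _ ≤ ((strip γ (ℓ - 1)).filter fun b => b.1 + 1 = r).card := hφ.card_le r
      _ ≤ _ := by
          refine Finset.card_le_card fun c => ?_
          simp only [hT, Finset.mem_filter]
          intro h
          exact ⟨⟨h.1, hc c h.1 h.2⟩, h.2⟩

/-- If `φ` records in which step of a chain of diagrams from `μ` to `ν` a box is added, then `φ`
determines the chain. -/
theorem mem_chain_iff {μ ν : YoungDiagram} {g : ℕ → YoungDiagram} {φ : ℕ × ℕ → ℕ}
    (hg : Monotone g) (h0 : g 0 = μ) (hn : ∃ n, g n = ν)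
    (hφ : ∀ r, 1 ≤ r → ∀ b ∈ (g r).cells \ (g (r - 1)).cells, φ b = r)
    {b : ℕ × ℕ} (hb : b ∈ ν.cells \ μ.cells) (r : ℕ) : b ∈ g r ↔ φ b ≤ r := by
  classical
  rw [Finset.mem_sdiff, YoungDiagram.mem_cells, YoungDiagram.mem_cells] at hb
  have hex : ∃ n, b ∈ g n := by
    obtain ⟨n, rfl⟩ := hn
    exact ⟨n, hb.1⟩
  have hpos : 1 ≤ Nat.find hex := by
    rw [Nat.one_le_iff_ne_zero]
    intro h
    have := Nat.find_spec hex
    rw [h, h0] at this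
    exact hb.2 this
  have : φ b = Nat.find hex := hφ _ hpos b (by
    rw [Finset.mem_sdiff, YoungDiagram.mem_cells, YoungDiagram.mem_cells]
    exact ⟨Nat.find_spec hex, Nat.find_min hex (by omega)⟩)
  rw [this]
  exact ⟨fun h => Nat.find_min' hex h, fun h => hg h (Nat.find_spec hex)⟩

/-! ### The Klein tableau of an embedding -/

section Klein

variable {R : Type u} [CommRing R] {B : Type u} [AddCommGroup B] [Module R B]

/-- The part of `Π(A ⊆ B) = Π` concerning the subscripts `φ^ℓ`. -/
def HasSubscripts (p : R) (A : Submodule R B) (ℓ : ℕ) (φ : ℕ × ℕ → ℕ) : Prop :=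
  ∃ g : ℕ → YoungDiagram, (∀ r, HasType p (B ⧸ kleinSubmodule p A ℓ r) (g r)) ∧
    ∀ r, 1 ≤ r → ∀ b ∈ (g r).cells \ (g (r - 1)).cells, φ b = r

/-- The embedding of the submodule `A` in `B` has the Klein tableau `T`. -/
structure IsKleinTableauOf (p : R) (A : Submodule R B) (T : KleinTableau) : Prop where
  shape : ∀ ℓ, HasType p (B ⧸ p ^ ℓ • A) (T.shape ℓ)
  subscript : ∀ ℓ, 2 ≤ ℓ → HasSubscripts p A ℓ (T.subscript ℓ)

theorem hasKleinTableau_iff {p : R} {E : SeqCat p} {T : KleinTableau} :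
    HasKleinTableau p E T ↔ IsKleinTableauOf p (LinearMap.range E.obj.f.hom) T := by
  constructor
  · rintro ⟨h1, g, h2, h3⟩
    exact ⟨h1, fun ℓ hℓ => ⟨g ℓ, fun r => h2 ℓ r hℓ, fun r => h3 ℓ r hℓ⟩⟩
  · rintro ⟨h1, h2⟩
    choose! g h3 h4 using h2
    exact ⟨h1, g, fun ℓ r hℓ => h3 ℓ hℓ r, fun ℓ r hℓ => h4 ℓ hℓ r⟩

variable {p : R} (A : Submodule R B)

theorem pow_smul_le_pow_smul {i j : ℕ} (h : i ≤ j) : p ^ j • A ≤ p ^ i • A := by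
  obtain ⟨k, rfl⟩ := Nat.exists_eq_add_of_le h
  rw [pow_add, mul_smul]
  exact smul_mono_right _ (Submodule.smul_le_self_of_tower _ _)

theorem kleinSubmodule_eq_two {ℓ : ℕ} (hℓ : 2 ≤ ℓ) (r : ℕ) :
    kleinSubmodule p A ℓ r = kleinSubmodule p (p ^ (ℓ - 2) • A) 2 r := by
  simp only [kleinSubmodule, Nat.sub_self, pow_zero, one_smul]
  rw [smul_smul, ← pow_add, Nat.add_sub_cancel' hℓ]

theorem kleinSubmodule_zero {ℓ : ℕ} (hℓ : 2 ≤ ℓ) :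
    kleinSubmodule p A ℓ 0 = p ^ (ℓ - 1) • A := by
  rw [kleinSubmodule, pow_zero, one_smul, inf_top_eq, smul_smul, ← pow_succ',
    show ℓ - 2 + 1 = ℓ - 1 by omega]
  exact sup_eq_right.mpr (pow_smul_le_pow_smul A (by omega))

theorem kleinSubmodule_anti (ℓ : ℕ) : Antitone (kleinSubmodule p A ℓ) := fun _ _ h =>
  sup_le_sup_left (smul_mono_right _ (inf_le_inf_left _ (pow_smul_le_pow_smul _ h))) _

theorem le_kleinSubmodule (ℓ r : ℕ) : p ^ ℓ • A ≤ kleinSubmodule p A ℓ r := le_sup_left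

theorem kleinSubmodule_of_pow_smul_eq_zero {n : ℕ} (hn : ∀ x : B, p ^ n • x = 0) (ℓ : ℕ) :
    kleinSubmodule p A ℓ n = p ^ ℓ • A := by
  have : p ^ n • (⊤ : Submodule R B) = ⊥ := by
    rw [eq_bot_iff]
    intro x hx
    obtain ⟨y, rfl⟩ := mem_smul_top.mp hx
    simpa using hn y
  rw [kleinSubmodule, this, inf_bot_eq, Submodule.smul_bot', sup_bot_eq]

variable [IsDomain R] [IsPrincipalIdealRing R] [Finite (R ⧸ Ideal.span {p})] [Finite B]
  {A}

/-- The map `f` induces an epimorphism from the `i`-th layer of the radical filtration of `B / X` onto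
the `j`-th layer for `B / Y`. -/
theorem rowLen_le_of_map (hp : Prime p) (hB : ∃ n : ℕ, ∀ x : B, p ^ n • x = 0)
    {X Y : Submodule R B} {μ ν : YoungDiagram} (hμ : HasType p (B ⧸ X) μ)
    (hν : HasType p (B ⧸ Y) ν) (f : B →ₗ[R] B) {i j : ℕ}
    (h1 : (p ^ (i + 1) • ⊤ ⊔ X).map f ≤ p ^ (j + 1) • ⊤ ⊔ Y)
    (h2 : p ^ j • ⊤ ⊔ Y ≤ (p ^ i • ⊤ ⊔ X).map f ⊔ (p ^ (j + 1) • ⊤ ⊔ Y)) :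
    ν.rowLen j ≤ μ.rowLen i := by
  have h3 := (hasType_quotient_iff hp hB).mp hμ i
  have h4 := (hasType_quotient_iff hp hB).mp hν j
  have := len_subquotient_le f h1
    (sup_le_sup_right (pow_smul_le_pow_smul _ (Nat.le_succ _)) _) h2
  omega

theorem HasType.le_of_le (hp : Prime p) (hB : ∃ n : ℕ, ∀ x : B, p ^ n • x = 0)
    {X Y : Submodule R B} {μ ν : YoungDiagram} (hμ : HasType p (B ⧸ X) μ)
    (hν : HasType p (B ⧸ Y) ν) (h : X ≤ Y) : ν ≤ μ := by
  refine YoungDiagram.le_iff_rowLen.mpr fun i => ?_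
  refine rowLen_le_of_map hp hB hμ hν LinearMap.id ?_ ?_
  · rw [Submodule.map_id]
    exact sup_le_sup_left h _
  · rw [Submodule.map_id]
    exact sup_le (le_sup_of_le_left le_sup_left) (le_sup_of_le_right le_sup_right)

/-- If `p (X ∩ p^i B) ⊆ Y`, then multiplication by `p` induces an epimorphism from the `i`-th layer
of `B / X` onto the layer `i + 1` of `B / Y`. -/
theorem HasType.rowLen_succ_le (hp : Prime p) (hB : ∃ n : ℕ, ∀ x : B, p ^ n • x = 0)
    {X Y : Submodule R B} {μ ν : YoungDiagram} {i : ℕ} (hμ : HasType p (B ⧸ X) μ)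
    (hν : HasType p (B ⧸ Y) ν) (h : p • (X ⊓ p ^ i • ⊤) ≤ Y) :
    ν.rowLen (i + 1) ≤ μ.rowLen i := by
  have h3 := (hasType_quotient_iff hp hB).mp hμ i
  have h4 := (hasType_quotient_iff hp hB).mp hν (i + 1)
  -- `Y' / X'` is an image of `p^i B / (p^i B ∩ (p^(i+1) B + X))`
  have h5 := len_subquotient_le (DistribSMul.toLinearMap R B p)
    (X := p ^ i • ⊤ ⊓ (p ^ (i + 1) • ⊤ ⊔ X)) (Y := p ^ i • ⊤)
    (X' := p ^ (i + 1 + 1) • ⊤ ⊔ Y) (Y' := p ^ (i + 1) • ⊤ ⊔ Y) ?_ inf_le_left ?_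
  · have h6 := len_sup_add_inf (p ^ i • ⊤ : Submodule R B) (p ^ (i + 1) • ⊤ ⊔ X)
    rw [← sup_assoc, sup_eq_left.mpr (pow_smul_le_pow_smul (⊤ : Submodule R B) (Nat.le_succ i))]
      at h6
    omega
  · rintro _ ⟨x, ⟨hx, hx'⟩, rfl⟩
    obtain ⟨_, hy, z, hz, rfl⟩ := Submodule.mem_sup.mp hx'
    obtain ⟨y, rfl⟩ := mem_smul_top.mp hy
    have hz' : z ∈ p ^ i • (⊤ : Submodule R B) := by
      have := Submodule.sub_mem _ hx (pow_smul_le_pow_smul _ (Nat.le_succ i) hy)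
      rwa [add_sub_cancel_left] at this
    change p • (p ^ (i + 1) • y + z) ∈ _
    rw [smul_add, smul_smul, ← pow_succ']
    exact Submodule.add_mem_sup (mem_smul_top.mpr ⟨y, rfl⟩)
      (h (Submodule.smul_mem_pointwise_smul _ _ _ ⟨hz, hz'⟩))
  · refine sup_le (le_sup_of_le_left ?_) (le_sup_of_le_right le_sup_right)
    intro x hx
    obtain ⟨y, rfl⟩ := mem_smul_top.mp hx
    exact ⟨p ^ i • y, mem_smul_top.mpr ⟨y, rfl⟩, by
      change p • p ^ i • y = _
      rw [smul_smul, pow_succ']⟩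

theorem HasType.card_cells (hp : Prime p) (hB : ∃ n : ℕ, ∀ x : B, p ^ n • x = 0)
    {X : Submodule R B} {μ : YoungDiagram} (hμ : HasType p (B ⧸ X) μ) :
    μ.cells.card + len X = len (⊤ : Submodule R B) := by
  obtain ⟨n, hn⟩ := hB
  have h := (hasType_quotient_iff hp ⟨n, hn⟩).mp hμ
  have hbot : ∀ m, n ≤ m → p ^ m • (⊤ : Submodule R B) ⊔ X = X := fun m hm => by
    rw [sup_eq_right]
    intro x hx
    obtain ⟨y, rfl⟩ := mem_smul_top.mp hx
    obtain ⟨k, rfl⟩ := Nat.exists_eq_add_of_le hm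
    rw [add_comm, pow_add, mul_smul, hn, smul_zero]
    exact X.zero_mem
  have hsum : ∀ m, len (⊤ : Submodule R B) =
      len (p ^ m • (⊤ : Submodule R B) ⊔ X) + ∑ i ∈ Finset.range m, μ.rowLen i := fun m => by
    induction m with
    | zero => simp
    | succ m ih =>
      rw [Finset.sum_range_succ, ih, h m]
      ring
  rw [card_eq_sum_rowLen μ (n := n), hsum n, hbot n le_rfl, add_comm]
  have := h n
  rw [hbot n le_rfl, hbot (n + 1) (Nat.le_succ n)] at this
  omega

theorem card_sdiff_of_le (hp : Prime p) (hB : ∃ n : ℕ, ∀ x : B, p ^ n • x = 0)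
    {X Y : Submodule R B} {μ ν : YoungDiagram} (hμ : HasType p (B ⧸ X) μ)
    (hν : HasType p (B ⧸ Y) ν) (h : X ≤ Y) :
    (μ.cells \ ν.cells).card + len X = len Y := by
  have h1 := Finset.card_sdiff_add_card_eq_card
    (YoungDiagram.cells_subset_iff.mpr (hμ.le_of_le hp hB hν h))
  have h2 := hμ.card_cells hp hB
  have h3 := hν.card_cells hp hB
  omega

/-- The subscripts defined by an embedding satisfy the axioms of a subscript function. -/
theorem isSubscriptFunction_of_hasSubscripts (hp : Prime p)
    (hB : ∃ n : ℕ, ∀ x : B, p ^ n • x = 0) {γ : ℕ → YoungDiagram}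
    (hγ : ∀ ℓ, HasType p (B ⧸ p ^ ℓ • A) (γ ℓ)) {ℓ : ℕ} (hℓ : 2 ≤ ℓ) {φ : ℕ × ℕ → ℕ}
    (hφ : HasSubscripts p A ℓ φ) : IsSubscriptFunction γ ℓ φ := by
  obtain ⟨g, hg, hφ⟩ := hφ
  have hmono : Monotone g := fun r s hrs =>
    (hg s).le_of_le hp hB (hg r) (kleinSubmodule_anti A ℓ hrs)
  have h0 : g 0 = γ (ℓ - 1) := by
    have := hg 0
    rw [kleinSubmodule_zero A hℓ] at this
    exact this.unique hp (hγ _)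
  have hn : ∃ n, g n = γ ℓ := by
    obtain ⟨n, hn⟩ := hB
    have := hg n
    rw [kleinSubmodule_of_pow_smul_eq_zero A hn] at this
    exact ⟨n, this.unique hp (hγ _)⟩
  have hmem : ∀ b ∈ strip γ ℓ, ∀ r, b ∈ g r ↔ φ b ≤ r :=
    fun b hb r => mem_chain_iff hmono h0 hn hφ hb r
  have hle : ∀ r, g r ≤ γ ℓ := fun r => (hγ ℓ).le_of_le hp hB (hg r) (le_kleinSubmodule A ℓ r)
  have hrow : ∀ i, (g i).rowLen i = (γ ℓ).rowLen i := by
    intro i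
    have h1 := (hasType_quotient_iff hp hB).mp (hγ ℓ) i
    have h2 := (hasType_quotient_iff hp hB).mp (hg i) i
    have h3 : ∀ k, k ≤ i + 1 → p ^ k • ⊤ ⊔ kleinSubmodule p A ℓ i = p ^ k • ⊤ ⊔ p ^ ℓ • A := by
      intro k hk
      refine le_antisymm (sup_le le_sup_left (sup_le le_sup_right (le_sup_of_le_left ?_)))
        (sup_le_sup_left (le_kleinSubmodule A ℓ i) _)
      refine (smul_mono_right p inf_le_right).trans ?_
      rw [smul_smul, ← pow_succ']
      exact pow_smul_le_pow_smul _ hk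
    rw [h3 _ (Nat.le_succ i), h3 _ le_rfl] at h2
    omega
  refine ⟨?_, ?_, ?_, ?_⟩
  · rintro ⟨i, j⟩ hb ⟨i', j'⟩ hc rfl hj
    rw [← hmem _ hb]
    exact (g _).up_left_mem le_rfl hj ((hmem _ hc _).mpr le_rfl)
  · rintro ⟨i, j⟩ hb
    rw [Nat.lt_succ_iff, ← hmem _ hb, YoungDiagram.mem_iff_lt_rowLen]
    have hb' := (Finset.mem_sdiff.mp hb).1
    rw [YoungDiagram.mem_cells, YoungDiagram.mem_iff_lt_rowLen] at hb'
    exact hb'.trans_eq (hrow i).symm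
  · intro i j hb hc
    have hlt : ¬ φ (i + 1, j) ≤ i := by
      rw [← hmem _ hb, YoungDiagram.mem_iff_lt_rowLen]
      intro h
      have h1 : (g i).rowLen (i + 1) ≤ (γ (ℓ - 1 - 1)).rowLen i := by
        refine HasType.rowLen_succ_le hp hB (hγ _) (hg i) ?_
        rw [show ℓ - 1 - 1 = ℓ - 2 by omega]
        exact le_sup_right
      exact (Finset.mem_sdiff.mp hc).2 (YoungDiagram.mem_iff_lt_rowLen.mpr (h.trans_le h1))
    have hle' : φ (i + 1, j) ≤ i + 1 := by
      rw [← hmem _ hb, YoungDiagram.mem_iff_lt_rowLen]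
      have hb' := (Finset.mem_sdiff.mp hb).1
      rw [YoungDiagram.mem_cells, YoungDiagram.mem_iff_lt_rowLen] at hb'
      exact hb'.trans_eq (hrow (i + 1)).symm
    omega
  · intro r
    rcases Nat.eq_zero_or_pos r with rfl | hr
    · rw [show ((strip γ ℓ).filter fun b => φ b = 0) = ∅ from ?_]
      · simp
      rw [Finset.filter_eq_empty_iff]
      intro b hb h
      have := (hmem b hb 0).mpr h.le
      rw [h0] at this
      exact (Finset.mem_sdiff.mp hb).2 this
    · obtain ⟨i, rfl⟩ : ∃ i, r = i + 1 := ⟨r - 1, by omega⟩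
      have hcard : ((strip γ ℓ).filter fun b => φ b = i + 1) = (g (i + 1)).cells \ (g i).cells := by
        ext b
        rw [Finset.mem_filter, Finset.mem_sdiff, YoungDiagram.mem_cells, YoungDiagram.mem_cells]
        constructor
        · rintro ⟨hb, h⟩
          rw [hmem b hb, hmem b hb]
          omega
        · rintro ⟨h1, h2⟩
          have hb : b ∈ strip γ ℓ := by
            rw [strip, Finset.mem_sdiff, YoungDiagram.mem_cells, YoungDiagram.mem_cells, ← h0]
            exact ⟨hle _ h1, fun h => h2 (hmono (Nat.zero_le i) h)⟩
          rw [hmem b hb] at h1 h2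
          exact ⟨hb, by omega⟩
      rw [hcard]
      have e1 := card_sdiff_of_le hp hB (hg (i + 1)) (hg i) (kleinSubmodule_anti A ℓ (Nat.le_succ i))
      have hγle := (hγ (ℓ - 1)).le_of_le hp hB (hγ (ℓ - 1 - 1)) (pow_smul_le_pow_smul A (by omega))
      have e2 := card_filter_row_sdiff hγle i
      have e3 := (hasType_quotient_iff hp hB).mp (hγ (ℓ - 1)) i
      have e4 := (hasType_quotient_iff hp hB).mp (hγ (ℓ - 1 - 1)) i
      simp only [Nat.add_right_cancel_iff]
      change _ ≤ (((γ (ℓ - 1)).cells \ (γ (ℓ - 1 - 1)).cells).filter fun b => b.1 = i).card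
      rw [show ℓ - 1 - 1 = ℓ - 2 by omega] at *
      have hpA : p ^ (ℓ - 1) • A = p • p ^ (ℓ - 2) • A := by
        rw [smul_smul, ← pow_succ', show ℓ - 2 + 1 = ℓ - 1 by omega]
      have hpA2 : p ^ ℓ • A = p • p ^ (ℓ - 1) • A := by
        rw [smul_smul, ← pow_succ', show ℓ - 1 + 1 = ℓ by omega]
      -- multiplication by `p` maps `A_i / (A_i ∩ X)` onto `K_i / K_(i+1)`
      set Ai := p ^ (ℓ - 2) • A ⊓ p ^ i • (⊤ : Submodule R B) with hAi
      set X := p ^ (i + 1) • ⊤ ⊔ p ^ (ℓ - 1) • A with hX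
      have e5 := len_subquotient_le (DistribSMul.toLinearMap R B p)
        (X := Ai ⊓ X) (Y := Ai) (X' := kleinSubmodule p A ℓ (i + 1))
        (Y' := kleinSubmodule p A ℓ i) ?_ inf_le_left ?_
      · have e6 := len_sup_add_inf Ai X
        have e7 := len_sup_add_inf (p ^ i • ⊤ ⊔ p ^ (ℓ - 1) • A) (p ^ (i + 1) • ⊤ ⊔ p ^ (ℓ - 2) • A)
        have e8 : (p ^ i • ⊤ ⊔ p ^ (ℓ - 1) • A) ⊔ (p ^ (i + 1) • ⊤ ⊔ p ^ (ℓ - 2) • A) =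
            p ^ i • ⊤ ⊔ p ^ (ℓ - 2) • A := by
          rw [sup_sup_sup_comm,
            sup_eq_left.mpr (pow_smul_le_pow_smul (⊤ : Submodule R B) (Nat.le_succ i)),
            sup_eq_right.mpr (pow_smul_le_pow_smul A (by omega))]
        have e9 : len (Ai ⊔ X) ≤
            len ((p ^ i • ⊤ ⊔ p ^ (ℓ - 1) • A) ⊓ (p ^ (i + 1) • ⊤ ⊔ p ^ (ℓ - 2) • A)) := by
          refine len_mono (le_inf (sup_le ?_ ?_) (sup_le ?_ ?_))
          · exact le_sup_of_le_left inf_le_right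
          · exact sup_le_sup_right (pow_smul_le_pow_smul _ (Nat.le_succ i)) _
          · exact le_sup_of_le_right inf_le_left
          · exact sup_le_sup_left (pow_smul_le_pow_smul A (by omega)) _
        rw [e8] at e7
        omega
      · rintro _ ⟨a, ⟨ha, hx⟩, rfl⟩
        obtain ⟨b, hb, c, hc, rfl⟩ := Submodule.mem_sup.mp hx
        have hb' : b ∈ p ^ (ℓ - 2) • A := by
          have := Submodule.sub_mem _ ha.1 (pow_smul_le_pow_smul A (by omega : ℓ - 2 ≤ ℓ - 1) hc)
          rwa [add_sub_cancel_right] at this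
        rw [map_add]
        refine Submodule.add_mem _ (Submodule.mem_sup_right ?_) (Submodule.mem_sup_left ?_)
        · exact Submodule.smul_mem_pointwise_smul _ _ _ ⟨hb', hb⟩
        · rw [hpA2]
          exact Submodule.smul_mem_pointwise_smul _ _ _ hc
      · exact sup_le (le_sup_of_le_right (le_kleinSubmodule A ℓ _)) le_sup_left

/-- Each embedding has a Klein tableau. -/
theorem exists_isKleinTableauOf (hp : Prime p) (hB : ∃ n : ℕ, ∀ x : B, p ^ n • x = 0)
    (A : Submodule R B) : ∃ T : KleinTableau, IsKleinTableauOf p A T := by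
  classical
  choose γ hγ using fun ℓ => exists_hasType hp (exists_pow_smul_quotient hB (p ^ ℓ • A))
  choose g hg using fun ℓ r =>
    exists_hasType hp (exists_pow_smul_quotient hB (kleinSubmodule p A ℓ r))
  have hmono : ∀ ℓ, Monotone (g ℓ) := fun ℓ r s hrs =>
    (hg ℓ s).le_of_le hp hB (hg ℓ r) (kleinSubmodule_anti A ℓ hrs)
  let φ : ℕ → ℕ × ℕ → ℕ := fun ℓ b =>
    if 2 ≤ ℓ ∧ b ∈ strip γ ℓ then sInf {r | b ∈ g ℓ r} else 0
  have hφ : ∀ ℓ, 2 ≤ ℓ → HasSubscripts p A ℓ (φ ℓ) := by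
    intro ℓ hℓ
    refine ⟨g ℓ, hg ℓ, fun r hr b hb => ?_⟩
    rw [Finset.mem_sdiff, YoungDiagram.mem_cells, YoungDiagram.mem_cells] at hb
    have hb' : b ∈ strip γ ℓ := by
      rw [strip, Finset.mem_sdiff, YoungDiagram.mem_cells, YoungDiagram.mem_cells]
      refine ⟨(hγ ℓ).le_of_le hp hB (hg ℓ r) (le_kleinSubmodule A ℓ r) hb.1, fun h => hb.2 ?_⟩
      have h0 := hg ℓ 0
      rw [kleinSubmodule_zero A hℓ] at h0
      rw [(hγ _).unique hp h0] at h
      exact hmono ℓ (Nat.zero_le _) h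
    simp only [φ, hℓ, hb', and_self, if_true]
    refine le_antisymm (Nat.sInf_le hb.1) ?_
    by_contra! hlt
    exact hb.2 (hmono ℓ (by omega) (Nat.sInf_mem (s := {r | b ∈ g ℓ r}) ⟨r, hb.1⟩))
  have hsub : ∀ ℓ, 2 ≤ ℓ → IsSubscriptFunction γ ℓ (φ ℓ) := fun ℓ hℓ =>
    isSubscriptFunction_of_hasSubscripts hp hB hγ hℓ (hφ ℓ hℓ)
  have hhor : ∀ ℓ, 1 ≤ ℓ → ∀ j, (γ ℓ).colLen j ≤ (γ (ℓ - 1)).colLen j + 1 := by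
    intro ℓ hℓ
    refine colLen_le_of_rowLen fun i => ?_
    refine HasType.rowLen_succ_le hp hB (hγ _) (hγ ℓ) ?_
    refine (smul_mono_right p inf_le_left).trans ?_
    rw [smul_smul, ← pow_succ', Nat.sub_add_cancel hℓ]
  refine ⟨⟨γ, φ, ⟨?_, ?_, hhor, ?_⟩, hsub, ?_⟩, hγ, hφ⟩
  · intro i j hij
    exact (hγ j).le_of_le hp hB (hγ i) (pow_smul_le_pow_smul A hij)
  · obtain ⟨n, hn⟩ := hB
    have hbot : ∀ ℓ, n ≤ ℓ → p ^ ℓ • A = ⊥ := fun ℓ hℓ => by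
      rw [eq_bot_iff]
      refine (pow_smul_le_pow_smul A hℓ).trans ?_
      rintro _ ⟨x, _, rfl⟩
      exact hn x
    refine ⟨n, fun ℓ hℓ => ?_⟩
    have h1 := hγ ℓ
    rw [hbot ℓ hℓ, ← hbot n le_rfl] at h1
    exact h1.unique hp (hγ n)
  · intro ℓ hℓ k
    exact lattice_of_isSubscriptFunction (hsub ℓ hℓ) (hhor ℓ (by omega)) (hhor _ (by omega)) k
  · intro ℓ b hb
    simp only [φ, hb, if_false]

/-- The chain of types of `B / (p^ℓ A + p (p^(ℓ-2) A ∩ p^r B))` is determined by the tableau. -/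
theorem IsKleinTableauOf.hasType_klein (hp : Prime p) (hB : ∃ n : ℕ, ∀ x : B, p ^ n • x = 0)
    {T : KleinTableau} (h : IsKleinTableauOf p A T) {ℓ : ℕ} (hℓ : 2 ≤ ℓ) :
    ∃ g : ℕ → YoungDiagram, (∀ r, HasType p (B ⧸ kleinSubmodule p A ℓ r) (g r)) ∧
      ∀ r b, b ∈ g r ↔ b ∈ T.shape (ℓ - 1) ∨ (b ∈ strip T.shape ℓ ∧ T.subscript ℓ b ≤ r) := by
  obtain ⟨g, hg, hφ⟩ := h.subscript ℓ hℓ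
  refine ⟨g, hg, fun r b => ?_⟩
  have hmono : Monotone g := fun r s hrs =>
    (hg s).le_of_le hp hB (hg r) (kleinSubmodule_anti A ℓ hrs)
  have h0 : g 0 = T.shape (ℓ - 1) := by
    have := hg 0
    rw [kleinSubmodule_zero A hℓ] at this
    exact this.unique hp (h.shape _)
  have hn : ∃ n, g n = T.shape ℓ := by
    obtain ⟨n, hn⟩ := hB
    have := hg n
    rw [kleinSubmodule_of_pow_smul_eq_zero A hn] at this
    exact ⟨n, this.unique hp (h.shape _)⟩
  by_cases hb : b ∈ strip T.shape ℓ
  · rw [mem_chain_iff hmono h0 hn hφ hb r]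
    have := (Finset.mem_sdiff.mp hb).2
    rw [YoungDiagram.mem_cells] at this
    tauto
  · simp only [hb, false_and, or_false]
    rw [← h0]
    refine ⟨fun h1 => ?_, fun h1 => hmono (Nat.zero_le r) h1⟩
    by_contra h2
    refine hb ?_
    rw [strip, Finset.mem_sdiff, YoungDiagram.mem_cells, YoungDiagram.mem_cells, ← h0]
    exact ⟨(h.shape ℓ).le_of_le hp hB (hg r) (le_kleinSubmodule A ℓ r) h1, h2⟩

theorem IsKleinTableauOf.unique (hp : Prime p) (hB : ∃ n : ℕ, ∀ x : B, p ^ n • x = 0)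
    {T T' : KleinTableau} (h : IsKleinTableauOf p A T) (h' : IsKleinTableauOf p A T') :
    T = T' := by
  have hshape : T.shape = T'.shape := funext fun ℓ => (h.shape ℓ).unique hp (h'.shape ℓ)
  refine KleinTableau.ext hshape (funext fun ℓ => funext fun b => ?_)
  by_cases hb : 2 ≤ ℓ ∧ b ∈ strip T.shape ℓ
  · obtain ⟨g, hg, hgm⟩ := h.hasType_klein hp hB hb.1
    obtain ⟨g', hg', hgm'⟩ := h'.hasType_klein hp hB hb.1
    have hgg : g = g' := funext fun r => (hg r).unique hp (hg' r)
    subst hgg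
    have hnot : b ∉ T.shape (ℓ - 1) := (Finset.mem_sdiff.mp hb.2).2
    refine eq_of_forall_ge_iff fun r => ?_
    have h1 := hgm r b
    have h2 := hgm' r b
    rw [← hshape] at h2
    have := hb.2
    tauto
  · rw [T.subscript_off ℓ b hb, T'.subscript_off ℓ b (hshape ▸ hb)]

end Klein

/-! ### Relative bases of elementary subquotients -/

section RelBasis

variable {R : Type u} [CommRing R] {B : Type u} [AddCommGroup B] [Module R B] {p : R}

/-- The family `w` of elements annihilated by `p` represents a basis of `Y / X` over `R / (p)`. -/
structure IsRelBasis (p : R) (X Y : Submodule R B) {ι : Type} [Fintype ι] (w : ι → B) :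
    Prop where
  smul_eq_zero : ∀ i, p • w i = 0
  span : X ⊔ Submodule.span R (Set.range w) = Y
  indep : ∀ c : ι → R, ∑ i, c i • w i ∈ X → ∀ i, p ∣ c i

namespace IsRelBasis

variable {ι κ : Type} [Fintype ι] [Fintype κ] {X Y Z : Submodule R B} {w : ι → B} {v : κ → B}

theorem le (h : IsRelBasis p X Y w) : X ≤ Y := h.span ▸ le_sup_left

theorem mem (h : IsRelBasis p X Y w) (i : ι) : w i ∈ Y :=
  h.span ▸ Submodule.mem_sup_right (Submodule.subset_span ⟨i, rfl⟩)

theorem smul_of_dvd (h : IsRelBasis p X Y w) {i : ι} {c : R} (hc : p ∣ c) : c • w i = 0 := by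
  obtain ⟨d, rfl⟩ := hc
  rw [mul_comm, mul_smul, h.smul_eq_zero, smul_zero]

/-- A basis of `Y / (Z ∩ Y)` is a basis of `(Z + Y) / Z`. -/
theorem sup (h : IsRelBasis p (Z ⊓ Y) Y w) : IsRelBasis p Z (Z ⊔ Y) w where
  smul_eq_zero := h.smul_eq_zero
  span := by
    conv_rhs => rw [← h.span]
    rw [← sup_assoc, sup_eq_left.mpr (inf_le_left : Z ⊓ Y ≤ Z)]
  indep c hc := h.indep c ⟨hc, Y.sum_mem fun i _ => Y.smul_mem _ (h.mem i)⟩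

theorem sum (h : IsRelBasis p X Y w) (h' : IsRelBasis p Y Z v) :
    IsRelBasis p X Z (Sum.elim w v) where
  smul_eq_zero := by
    rintro (i | i)
    · exact h.smul_eq_zero i
    · exact h'.smul_eq_zero i
  span := by rw [Set.Sum.elim_range, Submodule.span_union, ← sup_assoc, h.span, h'.span]
  indep c hc := by
    simp only [Fintype.sum_sum_type, Sum.elim_inl, Sum.elim_inr] at hc
    have h1 : ∀ i, p ∣ c (Sum.inr i) := h'.indep (fun i => c (Sum.inr i)) (by
      have h2 : ∑ i, c (Sum.inl i) • w i ∈ Y := Y.sum_mem fun i _ => Y.smul_mem _ (h.mem i)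
      have := Y.sub_mem (h.le hc) h2
      rwa [add_sub_cancel_left] at this)
    have h2 : ∀ i, p ∣ c (Sum.inl i) := h.indep (fun i => c (Sum.inl i)) (by
      rwa [Finset.sum_eq_zero (fun i _ => h'.smul_of_dvd (h1 i)), add_zero] at hc)
    rintro (i | i)
    · exact h2 i
    · exact h1 i

theorem sigma {N : ℕ} {ι : Fin N → Type} [∀ a, Fintype (ι a)] {X : ℕ → Submodule R B}
    {w : ∀ a, ι a → B} (h : ∀ a : Fin N, IsRelBasis p (X (a + 1)) (X a) (w a)) :
    IsRelBasis p (X N) (X 0) (fun i : Σ a, ι a => w i.1 i.2) := by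
  have hanti : ∀ a b, a ≤ b → b ≤ N → X b ≤ X a := by
    intro a b hab hb
    induction b, hab using Nat.le_induction with
    | base => exact le_rfl
    | succ b _ ih => exact ((h ⟨b, hb⟩).le).trans (ih (by omega))
  refine ⟨fun i => (h i.1).smul_eq_zero i.2, ?_, ?_⟩
  · apply le_antisymm
    · refine sup_le (hanti _ _ (Nat.zero_le _) le_rfl) (Submodule.span_le.mpr ?_)
      rintro _ ⟨⟨a, i⟩, rfl⟩
      exact hanti 0 a (Nat.zero_le _) a.2.le ((h a).mem i)
    · have : ∀ k, k ≤ N → X 0 ≤ X k ⊔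
          Submodule.span R (Set.range fun i : Σ a, ι a => w i.1 i.2) := by
        intro k
        induction k with
        | zero => exact fun _ => le_sup_left
        | succ k ih =>
          intro hk
          refine (ih (by omega)).trans (sup_le ?_ le_sup_right)
          rw [← (h ⟨k, hk⟩).span]
          refine sup_le_sup_left (Submodule.span_mono ?_) _
          rintro _ ⟨i, rfl⟩
          exact ⟨⟨⟨k, hk⟩, i⟩, rfl⟩
      exact this N le_rfl
  · intro c hc
    rw [Fintype.sum_sigma] at hc
    have key : ∀ k, ∀ a : Fin N, (a : ℕ) < k → ∀ i, p ∣ c ⟨a, i⟩ := by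
      intro k
      induction k with
      | zero => intro a ha; omega
      | succ k ih =>
        intro a ha
        rcases Nat.lt_succ_iff_lt_or_eq.mp ha with ha | hak
        · exact ih a ha
        · refine (h a).indep (fun i => c ⟨a, i⟩) ?_
          have h1 := hanti (a + 1) N a.2 le_rfl hc
          rw [← Finset.add_sum_erase _ _ (Finset.mem_univ a)] at h1
          refine (Submodule.add_mem_iff_left _ ?_).mp h1
          refine Submodule.sum_mem _ fun b hb => Submodule.sum_mem _ fun i _ => ?_
          have hba : (b : ℕ) ≠ a := fun hba => Finset.ne_of_mem_erase hb (Fin.ext hba)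
          rcases lt_or_gt_of_ne hba with hlt | hgt
          · simp only [(h b).smul_of_dvd (ih b (by omega) i)]
            exact Submodule.zero_mem _
          · exact Submodule.smul_mem _ _ (hanti (a + 1) b hgt b.2.le ((h b).mem i))
    exact fun i => key N i.1 i.1.2 i.2

theorem comp_injective (h : IsRelBasis p X Y w) {f : κ → ι} (hf : Function.Injective f)
    (c : κ → R) (hc : ∑ i, c i • w (f i) ∈ X) (i : κ) : p ∣ c i := by
  classical
  have h1 := h.indep (Function.extend f c 0) (by
    have : ∑ i, Function.extend f c 0 i • w i = ∑ i, c i • w (f i) := by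
      rw [← Finset.sum_subset (Finset.subset_univ (Finset.univ.image f)),
        Finset.sum_image (fun _ _ _ _ h => hf h)]
      · exact Finset.sum_congr rfl fun i _ => by rw [hf.extend_apply]
      · intro j _ hj
        rw [Function.extend_apply', Pi.zero_apply, zero_smul]
        rintro ⟨i, rfl⟩
        exact hj (Finset.mem_image_of_mem _ (Finset.mem_univ i))
    rwa [this]) (f i)
  rwa [hf.extend_apply] at h1

end IsRelBasis

variable [IsDomain R] [IsPrincipalIdealRing R] [Finite B]

theorem IsRelBasis.len_eq (hp : Prime p) {ι : Type} [Fintype ι] {X Y : Submodule R B} {w : ι → B}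
    (h : IsRelBasis p X Y w) : len Y = len X + Fintype.card ι := by
  classical
  rw [← h.span, ← Finset.card_univ, ← Set.image_univ, ← Finset.coe_univ]
  generalize (Finset.univ : Finset ι) = s
  induction s using Finset.induction_on with
  | empty => simp
  | insert i s hi ih =>
    rw [Finset.coe_insert, Set.image_insert_eq, Submodule.span_insert, sup_comm (R ∙ w i),
      ← sup_assoc, len_sup_span_singleton hp, ih, Finset.card_insert_of_notMem hi, add_assoc]
    · intro hmem
      obtain ⟨x, hx, y, hy, hxy⟩ := Submodule.mem_sup.mp hmem
      obtain ⟨c, hc⟩ : ∃ c : ι → R, ∑ j ∈ s, c j • w j = y := by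
        obtain ⟨c, hc⟩ := (Submodule.mem_span_image_finset_iff_exists_fun R).mp hy
        refine ⟨fun j => if hj : j ∈ s then c ⟨j, hj⟩ else 0, ?_⟩
        rw [← hc, ← Finset.sum_coe_sort s]
        exact Finset.sum_congr rfl fun j _ => by simp
      have := h.indep (fun j => if j = i then 1 else if j ∈ s then -c j else 0) (by
        rw [← Finset.add_sum_erase _ _ (Finset.mem_univ i)]
        simp only [if_true, one_smul]
        have h1 : ∑ j ∈ Finset.univ.erase i,
            (if j = i then (1 : R) else if j ∈ s then -c j else 0) • w j = -y := by
          rw [← hc, ← Finset.sum_neg_distrib, ← Finset.sum_subset (s₁ := s)]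
          · refine Finset.sum_congr rfl fun j hj => ?_
            rw [if_neg (show j ≠ i from fun h => hi (h ▸ hj)), if_pos hj, neg_smul]
          · intro j hj
            exact Finset.mem_erase.mpr ⟨fun h => hi (h ▸ hj), Finset.mem_univ j⟩
          · intro j hj hjs
            rw [if_neg (Finset.ne_of_mem_erase hj), if_neg hjs, zero_smul]
        rw [h1, ← hxy, add_neg_cancel_right]
        exact hx) i
      rw [if_pos rfl] at this
      exact hp.not_isUnit (isUnit_of_dvd_one this)
    · rw [h.smul_eq_zero]
      exact Submodule.zero_mem _

theorem exists_isRelBasis (hp : Prime p) {X Y : Submodule R B} (h : X ≤ Y)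
    (hY : ∀ y ∈ Y, p • y = 0) {n : ℕ} (hn : len Y = len X + n) :
    ∃ w : Fin n → B, IsRelBasis p X Y w := by
  induction n generalizing X with
  | zero =>
    have : X = Y := eq_of_le_of_len_le h (by omega)
    subst this
    exact ⟨Fin.elim0, fun i => i.elim0, by simp, fun _ _ i => i.elim0⟩
  | succ n ih =>
    have hne : X ≠ Y := by
      rintro rfl
      omega
    obtain ⟨y, hy, hyX⟩ := SetLike.exists_of_lt (lt_of_le_of_ne h hne)
    have hpy : p • y ∈ X := by
      rw [hY y hy]
      exact X.zero_mem
    obtain ⟨w, hw⟩ := ih (X := X ⊔ R ∙ y)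
      (sup_le h ((Submodule.span_singleton_le_iff_mem _ _).mpr hy))
      (by rw [len_sup_span_singleton hp hyX hpy]; omega)
    refine ⟨Fin.cons y w, ?_, ?_, ?_⟩
    · intro i
      refine Fin.cases ?_ ?_ i
      · exact hY y hy
      · exact hw.smul_eq_zero
    · rw [Fin.range_cons, Submodule.span_insert, ← sup_assoc, hw.span]
    · intro c hc
      rw [Fin.sum_univ_succ] at hc
      simp only [Fin.cons_zero, Fin.cons_succ] at hc
      have h1 := hw.indep (fun i => c i.succ) (by
        have h2 : c 0 • y ∈ X ⊔ R ∙ y :=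
          Submodule.mem_sup_right (Submodule.smul_mem _ _ (Submodule.mem_span_singleton_self y))
        have := Submodule.sub_mem _ (le_sup_left (a := X) hc) h2
        rwa [add_sub_cancel_left] at this)
      rw [Finset.sum_eq_zero (fun i _ => hw.smul_of_dvd (h1 i)), add_zero] at hc
      exact Fin.cases (dvd_of_smul_mem hp hpy hyX hc) h1

end RelBasis

/-! ### Bases of `p`-modules -/

section Socle

variable {R : Type u} [CommRing R] {B : Type u} [AddCommGroup B] [Module R B] {p : R}

/-- The socle filtration: the elements of `p^a B` annihilated by `p`. -/
def soc (p : R) (B : Type u) [AddCommGroup B] [Module R B] (a : ℕ) : Submodule R B :=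
  p ^ a • (⊤ : Submodule R B) ⊓ LinearMap.ker (DistribSMul.toLinearMap R B p)

theorem mem_soc {a : ℕ} {x : B} : x ∈ soc p B a ↔ (∃ y : B, p ^ a • y = x) ∧ p • x = 0 := by
  rw [soc, Submodule.mem_inf, mem_smul_top, LinearMap.mem_ker]
  rfl

theorem soc_anti : Antitone (soc p B) := fun _ _ h =>
  inf_le_inf_right _ (pow_smul_le_pow_smul _ h)

end Socle

section Bases

variable {R : Type u} [CommRing R] {B : Type u} [AddCommGroup B] [Module R B] {p : R}

/-- `B` is the direct sum of the cyclic submodules generated by the elements `β ⟨a, i⟩`, which have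
order `p^(a+1)`: the elements `p^a β ⟨a, i⟩` form a basis of the socle adapted to its filtration by
the submodules `soc p B a`. -/
structure IsAdaptedBasis (p : R) {N : ℕ} {F : Fin N → Type} [∀ a, Fintype (F a)]
    (β : (Σ a, F a) → B) : Prop where
  pow_smul_eq_zero : ∀ x : B, p ^ N • x = 0
  isRelBasis : ∀ a : Fin N, IsRelBasis p (soc p B (a + 1)) (soc p B a)
    (fun i => p ^ (a : ℕ) • β ⟨a, i⟩)

namespace IsAdaptedBasis

variable {N : ℕ} {F : Fin N → Type} [∀ a, Fintype (F a)] {β : (Σ a, F a) → B}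

theorem soc_eq_bot (h : IsAdaptedBasis p β) : soc p B N = ⊥ := by
  rw [eq_bot_iff]
  rintro x hx
  obtain ⟨⟨y, rfl⟩, -⟩ := mem_soc.mp hx
  exact h.pow_smul_eq_zero y

theorem pow_succ_smul (h : IsAdaptedBasis p β) (i : Σ a, F a) : p ^ (i.1 + 1 : ℕ) • β i = 0 := by
  have := (h.isRelBasis i.1).smul_eq_zero i.2
  rwa [smul_smul, ← pow_succ'] at this

theorem surjective (h : IsAdaptedBasis p β) :
    Function.Surjective (Fintype.linearCombination R β) := by
  set C := LinearMap.range (Fintype.linearCombination R β) with hC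
  have hβ : ∀ i, β i ∈ C := fun i => by
    classical
    exact ⟨Pi.single i 1, by rw [Fintype.linearCombination_apply_single, one_smul]⟩
  have hsoc : ∀ k a, a + k = N → soc p B a ≤ p ^ a • C := by
    intro k
    induction k with
    | zero =>
      intro a ha
      rw [show a = N from ha, h.soc_eq_bot]
      exact bot_le
    | succ k ih =>
      intro a ha
      rw [← (h.isRelBasis ⟨a, by omega⟩).span]
      refine sup_le ((ih (a + 1) (by omega)).trans (pow_smul_le_pow_smul _ (Nat.le_succ a))) ?_
      rw [Submodule.span_le]
      rintro _ ⟨i, rfl⟩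
      exact Submodule.smul_mem_pointwise_smul _ _ _ (hβ _)
  have key : ∀ k, ∀ b : B, p ^ k • b = 0 → b ∈ C := by
    intro k
    induction k with
    | zero =>
      intro b hb
      rw [pow_zero, one_smul] at hb
      exact hb ▸ C.zero_mem
    | succ k ih =>
      intro b hb
      have h1 : p ^ k • b ∈ soc p B k := mem_soc.mpr ⟨⟨b, rfl⟩, by rw [smul_smul, ← pow_succ', hb]⟩
      have h2 : p ^ k • b ∈ p ^ k • C := by
        rcases le_total k N with hk | hk
        · exact hsoc (N - k) k (by omega) h1
        · have h3 := soc_anti hk h1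
          rw [h.soc_eq_bot] at h3
          rw [(Submodule.mem_bot R).mp h3]
          exact Submodule.zero_mem _
      obtain ⟨c, hc, hcb⟩ := h2
      have h3 := ih (b - c) (by rw [smul_sub, ← hcb]; exact sub_self _)
      have := C.add_mem h3 hc
      rwa [sub_add_cancel] at this
  intro b
  exact key N b (h.pow_smul_eq_zero b)

theorem linearCombination_eq_zero_iff (h : IsAdaptedBasis p β)
    (c : (Σ a, F a) → R) : Fintype.linearCombination R β c = 0 ↔ ∀ i, p ^ (i.1 + 1 : ℕ) ∣ c i := by
  have hzero : ∀ i, ∀ d : R, p ^ (i.1 + 1 : ℕ) ∣ d → d • β i = 0 := by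
    rintro i _ ⟨d, rfl⟩
    rw [mul_comm, mul_smul, h.pow_succ_smul, smul_zero]
  rw [Fintype.linearCombination_apply]
  constructor
  · intro hc
    have hind := (IsRelBasis.sigma h.isRelBasis).indep
    rw [h.soc_eq_bot] at hind
    have key : ∀ k, k ≤ N → ∀ i : Σ a, F a, p ^ (i.1 + 1 + k - N : ℕ) ∣ c i := by
      intro k
      induction k with
      | zero =>
        intro _ i
        rw [show (i.1 : ℕ) + 1 + 0 - N = 0 by have := i.1.2; omega, pow_zero]
        exact one_dvd _
      | succ k ih =>
        intro hk
        choose d hd using ih (by omega)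
        -- multiply the relation by `p^m`, which kills the summands of small order
        set m := N - (k + 1) with hm
        have h1 := hind (fun i => if m ≤ (i.1 : ℕ) then d i else 0) (by
          have h0 : p ^ m • ∑ i, c i • β i = 0 := by rw [hc, smul_zero]
          rw [Submodule.mem_bot, ← h0, Finset.smul_sum]
          refine Finset.sum_congr rfl fun i _ => ?_
          split_ifs with hi
          · rw [smul_smul, smul_smul]
            conv_rhs => rw [hd i, ← mul_assoc, ← pow_add]
            rw [mul_comm, show m + ((i.1 : ℕ) + 1 + k - N) = i.1 by omega]
          · rw [zero_smul, smul_smul, hzero]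
            exact (pow_dvd_pow _ (by omega)).trans (dvd_mul_right _ _))
        intro i
        by_cases hi : m ≤ (i.1 : ℕ)
        · have h2 := h1 i
          rw [if_pos hi] at h2
          rw [hd i, show (i.1 : ℕ) + 1 + (k + 1) - N = (i.1 + 1 + k - N) + 1 by omega, pow_succ]
          exact mul_dvd_mul_left _ h2
        · rw [show (i.1 : ℕ) + 1 + (k + 1) - N = 0 by omega, pow_zero]
          exact one_dvd _
    intro i
    have := key N le_rfl i
    rwa [Nat.add_sub_cancel] at this
  · intro hc
    exact Finset.sum_eq_zero fun i _ => hzero i _ (hc i)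

theorem exists_equiv {B' : Type u} [AddCommGroup B'] [Module R B']
    {β' : (Σ a, F a) → B'} (h : IsAdaptedBasis p β) (h' : IsAdaptedBasis p β') :
    ∃ e : B ≃ₗ[R] B', ∀ i, e (β i) = β' i := by
  classical
  have hker : LinearMap.ker (Fintype.linearCombination R β) =
      LinearMap.ker (Fintype.linearCombination R β') := by
    ext c
    rw [LinearMap.mem_ker, LinearMap.mem_ker, h.linearCombination_eq_zero_iff,
      h'.linearCombination_eq_zero_iff]
  refine ⟨((LinearMap.quotKerEquivOfSurjective _ h.surjective).symm.trans
    (Submodule.quotEquivOfEq _ _ hker)).trans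
      (LinearMap.quotKerEquivOfSurjective _ h'.surjective), fun i => ?_⟩
  have h1 : ∀ {C : Type u} [AddCommGroup C] [Module R C] (β : (Σ a, F a) → C),
      Fintype.linearCombination R β (Pi.single i 1) = β i := fun β => by
    rw [Fintype.linearCombination_apply_single, one_smul]
  have h2 : (LinearMap.quotKerEquivOfSurjective _ h.surjective).symm (β i) =
      Submodule.Quotient.mk (Pi.single i 1) := by
    rw [LinearEquiv.symm_apply_eq]
    exact (h1 β).symm
  rw [LinearEquiv.trans_apply, LinearEquiv.trans_apply, h2, Submodule.quotEquivOfEq_mk]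
  exact h1 β'

end IsAdaptedBasis

end Bases

/-! ### The structure of embeddings of `p^2`-bounded submodules -/

section NormalForm

variable {R : Type u} [CommRing R] {B : Type u} [AddCommGroup B] [Module R B] {p : R}

/-- The submodule `p (A ∩ p^r B)`; for varying `r` these form a filtration of `pA`. -/
def smulInf (p : R) (A : Submodule R B) (r : ℕ) : Submodule R B :=
  p • (A ⊓ p ^ r • (⊤ : Submodule R B))

theorem mem_smulInf {A : Submodule R B} {r : ℕ} {x : B} :
    x ∈ smulInf p A r ↔ ∃ y ∈ A, (∃ z : B, p ^ r • z = y) ∧ p • y = x := by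
  rw [smulInf, Submodule.mem_smul_pointwise_iff_exists]
  simp only [Submodule.mem_inf, mem_smul_top, and_assoc]

theorem smulInf_anti (A : Submodule R B) : Antitone (smulInf p A) := fun _ _ h =>
  smul_mono_right _ (inf_le_inf_left _ (pow_smul_le_pow_smul _ h))

theorem smulInf_le (A : Submodule R B) (r : ℕ) : smulInf p A r ≤ A :=
  (smul_mono_right _ inf_le_left).trans (Submodule.smul_le_self_of_tower _ _)

theorem smulInf_le_pow (A : Submodule R B) (r : ℕ) :
    smulInf p A r ≤ p ^ (r + 1) • (⊤ : Submodule R B) := by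
  rw [pow_succ', mul_smul]
  exact smul_mono_right _ inf_le_right

theorem smul_eq_zero_of_mem_smulInf {A : Submodule R B} (hA : ∀ x ∈ A, p • p • x = 0) {r : ℕ}
    {x : B} (hx : x ∈ smulInf p A r) : p • x = 0 := by
  obtain ⟨y, hy, -, rfl⟩ := mem_smulInf.mp hx
  exact hA y hy

theorem len_soc [Finite B] (a : ℕ) : len (soc p B a) + len (p ^ (a + 1) • (⊤ : Submodule R B)) =
    len (p ^ a • (⊤ : Submodule R B)) := by
  have h := len_map_add (DistribSMul.toLinearMap R B p) (p ^ a • (⊤ : Submodule R B))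
  have h2 : (p ^ a • (⊤ : Submodule R B)).map (DistribSMul.toLinearMap R B p) =
      p ^ (a + 1) • ⊤ := by
    rw [pow_succ', mul_smul]
    rfl
  rw [h2] at h
  rw [soc]
  omega

theorem len_inf_soc [Finite B] (A : Submodule R B) (a : ℕ) :
    len (A ⊓ soc p B a) + len (smulInf p A a) = len (A ⊓ p ^ a • (⊤ : Submodule R B)) := by
  have h := len_map_add (DistribSMul.toLinearMap R B p) (A ⊓ p ^ a • (⊤ : Submodule R B))
  have h2 : (A ⊓ p ^ a • (⊤ : Submodule R B)).map (DistribSMul.toLinearMap R B p) =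
      smulInf p A a := rfl
  rw [h2, inf_assoc] at h
  rw [soc]
  omega

/-- Index set for the cyclic summands of order `p^(a+1)`, where `n a' b` counts the basis elements
of `pA` of height `a'` which are `p`-multiples of elements of `A` of height `b`, `j a` counts the
summands of `A` of length one and height `a`, and `k a` the summands of `B` not involving `A`. -/
abbrev FormIndex (N : ℕ) (n : ℕ → ℕ → ℕ) (j k : ℕ → ℕ) (a : Fin N) : Type :=
  (((Σ b : Fin N, Fin (n a b)) ⊕ Fin (j a)) ⊕
    (Σ a' : {a' : Fin N // (a : ℕ) + 1 < a'}, Fin (n a' a))) ⊕ Fin (k a)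

/-- A decomposition of `A ⊆ B`, where `p^2 A = 0`, into pickets and bipickets: `B` has the basis
formed by the elements `u`, `t`, `v`, `z`, and `A` is generated by the elements
`p^(a-1) u + p^b v` and `p^a t`. -/
structure NormalForm (p : R) (A : Submodule R B) (N : ℕ) (n : ℕ → ℕ → ℕ) (j k : ℕ → ℕ) where
  /-- the generators of the larger summands of the bipickets, and of the pickets with `pA ≠ 0` -/
  u : ∀ a b : ℕ, Fin (n a b) → B
  /-- the generators of the smaller summands of the bipickets; zero for pickets -/
  v : ∀ a b : ℕ, Fin (n a b) → B
  /-- the generators of the pickets with `A ≠ 0` and `pA = 0` -/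
  t : ∀ a : ℕ, Fin (j a) → B
  /-- the generators of the pickets with `A = 0` -/
  z : ∀ a : ℕ, Fin (k a) → B
  v_eq_zero : ∀ a b i, ¬ b + 1 < a → v a b i = 0
  basis : IsAdaptedBasis p (fun i : Σ a : Fin N, FormIndex N n j k a =>
    Sum.elim (Sum.elim (Sum.elim (fun l => u i.1 l.1 l.2) (t i.1)) (fun l => v l.1 i.1 l.2))
      (z i.1) i.2)
  span : A = Submodule.span R (Set.range fun l : Σ a : Fin N, Σ b : Fin N, Fin (n a b) =>
      p ^ ((l.1 : ℕ) - 1) • u l.1 l.2.1 l.2.2 + p ^ (l.2.1 : ℕ) • v l.1 l.2.1 l.2.2) ⊔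
    Submodule.span R (Set.range fun l : Σ a : Fin N, Fin (j a) => p ^ (l.1 : ℕ) • t l.1 l.2)

theorem NormalForm.exists_equiv {B' : Type u} [AddCommGroup B'] [Module R B']
    {A : Submodule R B} {A' : Submodule R B'} {N : ℕ} {n : ℕ → ℕ → ℕ} {j k : ℕ → ℕ}
    (h : NormalForm p A N n j k) (h' : NormalForm p A' N n j k) :
    ∃ e : B ≃ₗ[R] B', A.map (e : B →ₗ[R] B') = A' := by
  obtain ⟨e, he⟩ := h.basis.exists_equiv h'.basis
  have hu : ∀ (a b : Fin N) i, e (h.u a b i) = h'.u a b i := fun a b i =>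
    he ⟨a, Sum.inl (Sum.inl (Sum.inl ⟨b, i⟩))⟩
  have ht : ∀ (a : Fin N) i, e (h.t a i) = h'.t a i := fun a i =>
    he ⟨a, Sum.inl (Sum.inl (Sum.inr i))⟩
  have hv : ∀ (a b : Fin N) i, e (h.v a b i) = h'.v a b i := fun a b i => by
    by_cases hab : (b : ℕ) + 1 < a
    · exact he ⟨b, Sum.inl (Sum.inr ⟨⟨a, hab⟩, i⟩)⟩
    · rw [h.v_eq_zero _ _ _ hab, h'.v_eq_zero _ _ _ hab, map_zero]
  refine ⟨e, ?_⟩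
  rw [h.span, h'.span, Submodule.map_sup, Submodule.map_span, Submodule.map_span, ← Set.range_comp,
    ← Set.range_comp]
  congr 3
  · ext l
    simp [hu, hv]
  · ext l
    simp [ht]

variable [IsDomain R] [IsPrincipalIdealRing R] [Finite B]

/-- An embedding of a `p^2`-bounded submodule is a direct sum of pickets and bipickets.  The
summands come from a basis of `pA` adapted to the two filtrations by `p^a B` and by `smulInf p A`. -/
theorem exists_normalForm (hp : Prime p) {A : Submodule R B} (hA : ∀ x ∈ A, p • p • x = 0) {N : ℕ}
    (hN : ∀ x : B, p ^ N • x = 0) :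
    ∃ (n : ℕ → ℕ → ℕ) (j k : ℕ → ℕ),
      (∀ a b, n a b + len (smulInf p A (b + 1) ⊓ p ^ a • ⊤) +
        len (smulInf p A b ⊓ p ^ (a + 1) • ⊤) =
        len (smulInf p A b ⊓ p ^ a • ⊤) + len (smulInf p A (b + 1) ⊓ p ^ (a + 1) • ⊤)) ∧
      (∀ a, j a + len (A ⊓ soc p B (a + 1)) + len (smulInf p A 0 ⊓ p ^ a • ⊤) =
        len (A ⊓ soc p B a) + len (smulInf p A 0 ⊓ p ^ (a + 1) • ⊤)) ∧
      (∀ a, k a + Fintype.card (Σ a' : {a' : Fin N // a + 1 < (a' : ℕ)}, Fin (n a' a)) +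
        len (soc p B (a + 1)) + len (A ⊓ soc p B a) =
        len (soc p B a) + len (A ⊓ soc p B (a + 1))) ∧
      Nonempty (NormalForm p A N n j k) := by
  have hPN : p ^ N • (⊤ : Submodule R B) = ⊥ := by
    rw [eq_bot_iff]
    intro x hx
    obtain ⟨y, rfl⟩ := mem_smul_top.mp hx
    exact hN y
  have hsocN : soc p B N = ⊥ := by rw [soc, hPN, bot_inf_eq]
  set W := smulInf p A with hWdef
  have hWtor : ∀ b, ∀ x ∈ W b, p • x = 0 := fun b x hx => smul_eq_zero_of_mem_smulInf hA hx
  have hWanti : Antitone W := smulInf_anti A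
  have hWN : W N = ⊥ := by rw [hWdef, smulInf, hPN, inf_bot_eq, Submodule.smul_bot']
  have hPle : ∀ a, p ^ (a + 1) • (⊤ : Submodule R B) ≤ p ^ a • ⊤ := fun a =>
    pow_smul_le_pow_smul _ (Nat.le_succ a)
  have hWsoc : ∀ b a, W b ⊓ p ^ a • ⊤ ≤ soc p B a := fun b a x hx =>
    ⟨hx.2, hWtor b x hx.1⟩
  -- bases of the bigraded pieces of `pA`
  have hw : ∀ a b, ∃ m, m + len (W (b + 1) ⊓ p ^ a • ⊤) + len (W b ⊓ p ^ (a + 1) • ⊤) =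
      len (W b ⊓ p ^ a • ⊤) + len (W (b + 1) ⊓ p ^ (a + 1) • ⊤) ∧
      ∃ w : Fin m → B, IsRelBasis p (W (b + 1) ⊓ p ^ a • ⊤ ⊔ W b ⊓ p ^ (a + 1) • ⊤)
        (W b ⊓ p ^ a • ⊤) w := by
    intro a b
    have hle : W (b + 1) ⊓ p ^ a • ⊤ ⊔ W b ⊓ p ^ (a + 1) • ⊤ ≤ W b ⊓ p ^ a • ⊤ :=
      sup_le (inf_le_inf_right _ (hWanti (Nat.le_succ b))) (inf_le_inf_left _ (hPle a))
    obtain ⟨m, hm⟩ := Nat.exists_eq_add_of_le (len_mono hle)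
    refine ⟨m, ?_, exists_isRelBasis hp hle (fun x hx => hWtor b x hx.1) hm⟩
    have h1 := len_sup_add_inf (W (b + 1) ⊓ p ^ a • ⊤) (W b ⊓ p ^ (a + 1) • ⊤)
    have h2 : W (b + 1) ⊓ p ^ a • ⊤ ⊓ (W b ⊓ p ^ (a + 1) • ⊤) = W (b + 1) ⊓ p ^ (a + 1) • ⊤ := by
      rw [inf_inf_inf_comm, inf_eq_left.mpr (hWanti (Nat.le_succ b)), inf_eq_right.mpr (hPle a)]
    rw [h2] at h1
    omega
  choose n hn w hw using hw
  have hw1 : ∀ a b, IsRelBasis p (soc p B (a + 1) ⊔ W (b + 1) ⊓ p ^ a • ⊤)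
      (soc p B (a + 1) ⊔ W b ⊓ p ^ a • ⊤) (w a b) := by
    intro a b
    have h1 : (soc p B (a + 1) ⊔ W (b + 1) ⊓ p ^ a • ⊤) ⊓ (W b ⊓ p ^ a • ⊤) =
        W (b + 1) ⊓ p ^ a • ⊤ ⊔ W b ⊓ p ^ (a + 1) • ⊤ := by
      rw [sup_comm, sup_inf_assoc_of_le _ (inf_le_inf_right _ (hWanti (Nat.le_succ b)))]
      congr 1
      ext x
      constructor
      · rintro ⟨h1, h2⟩
        exact ⟨h2.1, h1.1⟩
      · rintro ⟨h1, h2⟩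
        exact ⟨⟨h2, hWtor b x h1⟩, h1, hPle a h2⟩
    have h2 := hw a b
    rw [← h1] at h2
    have h3 := h2.sup
    rwa [sup_assoc, sup_eq_right.mpr (inf_le_inf_right _ (hWanti (Nat.le_succ b)))] at h3
  have hw2 : ∀ a b, IsRelBasis p (W (b + 1) ⊔ W b ⊓ p ^ (a + 1) • ⊤)
      (W (b + 1) ⊔ W b ⊓ p ^ a • ⊤) (w a b) := by
    intro a b
    have h1 : (W (b + 1) ⊔ W b ⊓ p ^ (a + 1) • ⊤) ⊓ (W b ⊓ p ^ a • ⊤) =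
        W (b + 1) ⊓ p ^ a • ⊤ ⊔ W b ⊓ p ^ (a + 1) • ⊤ := by
      rw [sup_comm, sup_inf_assoc_of_le _ (inf_le_inf_left _ (hPle a)), ← inf_assoc,
        inf_eq_left.mpr (hWanti (Nat.le_succ b)), sup_comm]
    have h2 := hw a b
    rw [← h1] at h2
    have h3 := h2.sup
    rwa [sup_assoc, sup_eq_right.mpr (inf_le_inf_left _ (hPle a))] at h3
  have hwa : ∀ a, IsRelBasis p (soc p B (a + 1)) (soc p B (a + 1) ⊔ W 0 ⊓ p ^ a • ⊤)
      (fun l : Σ b : Fin N, Fin (n a b) => w a l.1 l.2) := by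
    intro a
    have := IsRelBasis.sigma (N := N) (X := fun b => soc p B (a + 1) ⊔ W b ⊓ p ^ a • ⊤)
      (fun b => hw1 a b)
    simpa only [hWN, bot_inf_eq, sup_bot_eq] using this
  have hwb : ∀ b, IsRelBasis p (W (b + 1)) (W b)
      (fun l : Σ a : Fin N, Fin (n a b) => w l.1 b l.2) := by
    intro b
    have := IsRelBasis.sigma (N := N) (X := fun a => W (b + 1) ⊔ W b ⊓ p ^ a • ⊤)
      (fun a => hw2 a b)
    simpa only [hPN, inf_bot_eq, sup_bot_eq, pow_zero, one_smul, inf_top_eq,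
      sup_eq_right.mpr (hWanti (Nat.le_succ b))] using this
  have hnlt : ∀ a b, Fin (n a b) → b < a := by
    intro a b i
    by_contra! hab
    have h1 : ∀ c, b ≤ c → W c ⊓ p ^ a • ⊤ = W c ∧ W c ⊓ p ^ (a + 1) • ⊤ = W c := fun c hc =>
      ⟨inf_eq_left.mpr ((smulInf_le_pow A c).trans (pow_smul_le_pow_smul _ (by omega))),
        inf_eq_left.mpr ((smulInf_le_pow A c).trans (pow_smul_le_pow_smul _ (by omega)))⟩
    have h2 := hn a b
    rw [(h1 b le_rfl).1, (h1 b le_rfl).2, (h1 (b + 1) (by omega)).1, (h1 (b + 1) (by omega)).2] at h2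
    have := i.2
    omega
  -- generators of the summands involving `pA`
  have hx : ∀ a b (i : Fin (n a b)), ∃ x u v : B, x ∈ A ∧ (∃ y, p ^ b • y = x) ∧ p • x = w a b i ∧
      p ^ a • u = w a b i ∧ x = p ^ (a - 1) • u + p ^ b • v ∧ p • p ^ b • v = 0 ∧
      (¬ b + 1 < a → v = 0) := by
    intro a b i
    have hba := hnlt a b i
    have hmem := (hw a b).mem i
    obtain ⟨x, hxA, ⟨y, hy⟩, hpx⟩ := mem_smulInf.mp hmem.1
    by_cases hab : b + 1 < a
    · obtain ⟨u, hu⟩ := mem_smul_top.mp hmem.2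
      refine ⟨x, u, y - p ^ (a - 1 - b) • u, hxA, ⟨y, hy⟩, hpx, hu, ?_, ?_, fun h => absurd hab h⟩
      · rw [smul_sub, smul_smul, ← pow_add, show b + (a - 1 - b) = a - 1 by omega, hy]
        abel
      · rw [smul_sub, smul_smul (p ^ b) (p ^ _), ← pow_add, show b + (a - 1 - b) = a - 1 by omega,
          hy, smul_sub, hpx, smul_smul, ← pow_succ', show a - 1 + 1 = a by omega, hu, sub_self]
    · obtain rfl : a = b + 1 := by omega
      refine ⟨x, y, 0, hxA, ⟨y, hy⟩, hpx, ?_, ?_, ?_, fun _ => rfl⟩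
      · rw [pow_succ', mul_smul, hy, hpx]
      · rw [smul_zero, add_zero, Nat.add_sub_cancel, hy]
      · rw [smul_zero, smul_zero]
  choose x u v hxA hxb hxw huw hxuv hpv hv0 using hx
  -- the pickets with `A ≠ 0` and `pA = 0`
  have hWS : ∀ a, W 0 ⊓ p ^ a • ⊤ ≤ A ⊓ soc p B a := fun a =>
    le_inf (inf_le_left.trans (smulInf_le A 0)) (hWsoc 0 a)
  have hy : ∀ a, ∃ m, m + len (A ⊓ soc p B (a + 1)) + len (W 0 ⊓ p ^ a • ⊤) =
      len (A ⊓ soc p B a) + len (W 0 ⊓ p ^ (a + 1) • ⊤) ∧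
      ∃ y : Fin m → B, IsRelBasis p (A ⊓ soc p B (a + 1) ⊔ W 0 ⊓ p ^ a • ⊤)
        (A ⊓ soc p B a) y := by
    intro a
    have hle : A ⊓ soc p B (a + 1) ⊔ W 0 ⊓ p ^ a • ⊤ ≤ A ⊓ soc p B a :=
      sup_le (inf_le_inf_left _ (soc_anti (Nat.le_succ a))) (hWS a)
    obtain ⟨m, hm⟩ := Nat.exists_eq_add_of_le (len_mono hle)
    refine ⟨m, ?_, exists_isRelBasis hp hle (fun x hx => hx.2.2) hm⟩
    have h1 := len_sup_add_inf (A ⊓ soc p B (a + 1)) (W 0 ⊓ p ^ a • ⊤)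
    have h2 : A ⊓ soc p B (a + 1) ⊓ (W 0 ⊓ p ^ a • ⊤) = W 0 ⊓ p ^ (a + 1) • ⊤ := by
      apply le_antisymm
      · exact fun x hx => ⟨hx.2.1, hx.1.2.1⟩
      · exact fun x hx => ⟨hWS (a + 1) hx, hx.1, hPle a hx.2⟩
    rw [h2] at h1
    omega
  choose j hj y hy using hy
  have hya : ∀ a, IsRelBasis p (soc p B (a + 1) ⊔ W 0 ⊓ p ^ a • ⊤)
      (soc p B (a + 1) ⊔ A ⊓ soc p B a) (y a) := by
    intro a
    have h1 : (soc p B (a + 1) ⊔ W 0 ⊓ p ^ a • ⊤) ⊓ (A ⊓ soc p B a) =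
        A ⊓ soc p B (a + 1) ⊔ W 0 ⊓ p ^ a • ⊤ := by
      rw [sup_comm, sup_inf_assoc_of_le _ (hWS a), sup_comm]
      congr 1
      rw [inf_left_comm, inf_eq_left.mpr (soc_anti (Nat.le_succ a))]
    have h2 := hy a
    rw [← h1] at h2
    have h3 := h2.sup
    rwa [sup_assoc, sup_eq_right.mpr (hWS a)] at h3
  have ht : ∀ a (i : Fin (j a)), ∃ t : B, p ^ a • t = y a i := fun a i =>
    mem_smul_top.mp ((hy a).mem i).2.1
  choose t ht using ht
  -- the elements `p^b v` are independent modulo `A`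
  have hs : ∀ b, IsRelBasis p (soc p B (b + 1) ⊔ A ⊓ soc p B b)
      ((soc p B (b + 1) ⊔ A ⊓ soc p B b) ⊔ Submodule.span R (Set.range
        fun l : Σ a : {a : Fin N // b + 1 < (a : ℕ)}, Fin (n a b) => p ^ b • v l.1 b l.2))
      (fun l : Σ a : {a : Fin N // b + 1 < (a : ℕ)}, Fin (n a b) => p ^ b • v l.1 b l.2) := by
    intro b
    refine ⟨fun l => hpv _ _ _, rfl, fun c hc => ?_⟩
    obtain ⟨d, hd, s, hs, hds⟩ := Submodule.mem_sup.mp hc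
    refine (hwb b).comp_injective
      (f := fun l : Σ a : {a : Fin N // b + 1 < (a : ℕ)}, Fin (n a b) =>
        (⟨l.1.1, l.2⟩ : Σ a : Fin N, Fin (n a b))) ?_ c ?_
    · rintro ⟨⟨a, ha⟩, i⟩ ⟨⟨a', ha'⟩, i'⟩ h
      obtain ⟨rfl, h⟩ := Sigma.mk.inj h
      obtain rfl := eq_of_heq h
      rfl
    · have hsum : ∑ l, c l • x l.1.1 b l.2 - s ∈ A ⊓ p ^ (b + 1) • ⊤ := by
        refine ⟨A.sub_mem (A.sum_mem fun l _ => A.smul_mem _ (hxA _ _ _)) hs.1, ?_⟩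
        have : ∑ l, c l • x l.1.1 b l.2 - s =
            ∑ l, c l • p ^ ((l.1.1 : ℕ) - 1) • u l.1.1 b l.2 + d := by
          rw [sub_eq_iff_eq_add, add_assoc, hds, ← Finset.sum_add_distrib]
          exact Finset.sum_congr rfl fun l _ => by rw [hxuv, smul_add]
        rw [this]
        refine Submodule.add_mem _ (Submodule.sum_mem _ fun l _ => Submodule.smul_mem _ _ ?_) hd.1
        exact pow_smul_le_pow_smul _ (by have := l.1.2; omega) (mem_smul_top.mpr ⟨_, rfl⟩)
      have h1 := Submodule.smul_mem_pointwise_smul _ p _ hsum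
      have h2 : p • s = 0 := hs.2.2
      rw [smul_sub, h2, sub_zero, Finset.smul_sum] at h1
      have h3 : ∑ l, c l • w l.1.1 b l.2 = ∑ l, p • c l • x l.1.1 b l.2 :=
        Finset.sum_congr rfl fun l _ => by rw [smul_comm, hxw]
      rw [h3]
      exact h1
  have hsle : ∀ b, (soc p B (b + 1) ⊔ A ⊓ soc p B b) ⊔ Submodule.span R (Set.range
      fun l : Σ a : {a : Fin N // b + 1 < (a : ℕ)}, Fin (n a b) => p ^ b • v l.1 b l.2) ≤
      soc p B b := by
    intro b
    refine sup_le (sup_le (soc_anti (Nat.le_succ b)) inf_le_right) (Submodule.span_le.mpr ?_)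
    rintro _ ⟨l, rfl⟩
    exact mem_soc.mpr ⟨⟨_, rfl⟩, hpv _ _ _⟩
  have hz : ∀ a, ∃ m, m + Fintype.card (Σ a' : {a' : Fin N // a + 1 < (a' : ℕ)}, Fin (n a' a)) +
        len (soc p B (a + 1)) + len (A ⊓ soc p B a) =
        len (soc p B a) + len (A ⊓ soc p B (a + 1)) ∧
      ∃ z : Fin m → B, IsRelBasis p ((soc p B (a + 1) ⊔ A ⊓ soc p B a) ⊔
        Submodule.span R (Set.range fun l : Σ a' : {a' : Fin N // a + 1 < (a' : ℕ)},
          Fin (n a' a) => p ^ a • v l.1 a l.2)) (soc p B a) z := by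
    intro a
    obtain ⟨m, hm⟩ := Nat.exists_eq_add_of_le (len_mono (hsle a))
    refine ⟨m, ?_, exists_isRelBasis hp (hsle a) (fun x hx => hx.2) hm⟩
    have h1 := len_sup_add_inf (soc p B (a + 1)) (A ⊓ soc p B a)
    have h2 : soc p B (a + 1) ⊓ (A ⊓ soc p B a) = A ⊓ soc p B (a + 1) := by
      rw [inf_left_comm, inf_eq_left.mpr (soc_anti (Nat.le_succ a))]
    rw [h2] at h1
    have h3 := (hs a).len_eq hp
    omega
  choose k hk z hz using hz
  have hzt : ∀ a (i : Fin (k a)), ∃ t : B, p ^ a • t = z a i := fun a i =>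
    mem_smul_top.mp ((hz a).mem i).1
  choose q hq using hzt
  refine ⟨n, j, k, hn, hj, hk, ⟨⟨u, v, t, q, fun a b i h => hv0 a b i h, ⟨hN, fun a => ?_⟩, ?_⟩⟩⟩
  · have h1 := (((hwa a).sum (hya a)).sum (hs a)).sum (hz a)
    convert h1 using 1
    ext i
    rcases i with ((i | i) | i) | i
    · exact huw _ _ _
    · exact ht _ _
    · rfl
    · exact hq _ _
  · set X := Submodule.span R (Set.range fun l : Σ a : Fin N, Σ b : Fin N, Fin (n a b) =>
      p ^ ((l.1 : ℕ) - 1) • u l.1 l.2.1 l.2.2 + p ^ (l.2.1 : ℕ) • v l.1 l.2.1 l.2.2) ⊔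
      Submodule.span R (Set.range fun l : Σ a : Fin N, Fin (j a) => p ^ (l.1 : ℕ) • t l.1 l.2)
      with hX
    have hxX : ∀ (a b : Fin N) i, x a b i ∈ X := fun a b i => by
      rw [hxuv]
      exact Submodule.mem_sup_left (Submodule.subset_span ⟨⟨a, b, i⟩, rfl⟩)
    have hyX : ∀ (a : Fin N) i, y a i ∈ X := fun a i => by
      rw [← ht]
      exact Submodule.mem_sup_right (Submodule.subset_span ⟨⟨a, i⟩, rfl⟩)
    have hW0 := (IsRelBasis.sigma (N := N) (X := W) (fun b => hwb b)).span
    rw [hWN, bot_sup_eq] at hW0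
    have hW0X : W 0 ≤ X := by
      rw [← hW0, Submodule.span_le]
      rintro _ ⟨⟨b, a, i⟩, rfl⟩
      simp only [← hxw]
      exact X.smul_mem _ (hxX a b i)
    have hSX : ∀ m a, a + m = N → A ⊓ soc p B a ≤ X := by
      intro m
      induction m with
      | zero =>
        intro a ha
        rw [show a = N from ha, hsocN, inf_bot_eq]
        exact bot_le
      | succ m ih =>
        intro a ha
        rw [← (hy a).span]
        refine sup_le (sup_le (ih (a + 1) (by omega)) (inf_le_left.trans hW0X)) ?_
        rw [Submodule.span_le]
        rintro _ ⟨i, rfl⟩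
        exact hyX ⟨a, by omega⟩ i
    apply le_antisymm
    · intro a ha
      have h1 : p • a ∈ W 0 :=
        mem_smulInf.mpr ⟨a, ha, ⟨a, by rw [pow_zero, one_smul]⟩, rfl⟩
      rw [← hW0] at h1
      obtain ⟨c, hc⟩ := (Submodule.mem_span_range_iff_exists_fun R).mp h1
      have h2 : a - ∑ l : Σ b : Fin N, Σ a : Fin N, Fin (n a b), c l • x l.2.1 l.1 l.2.2 ∈ X := by
        refine hSX N 0 (by omega) ⟨A.sub_mem ha (A.sum_mem fun l _ => A.smul_mem _ (hxA _ _ _)),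
          mem_soc.mpr ⟨⟨_, by rw [pow_zero, one_smul]⟩, ?_⟩⟩
        rw [smul_sub, ← hc, Finset.smul_sum, sub_eq_zero]
        exact Finset.sum_congr rfl fun l _ => by rw [smul_comm, hxw]
      have h3 := X.add_mem h2 (X.sum_mem (t := Finset.univ) fun l _ => X.smul_mem (c l) (hxX l.2.1 l.1 l.2.2))
      rwa [sub_add_cancel] at h3
    · refine sup_le (Submodule.span_le.mpr ?_) (Submodule.span_le.mpr ?_)
      · rintro _ ⟨⟨a, b, i⟩, rfl⟩
        simp only [← hxuv]
        exact hxA _ _ _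
      · rintro _ ⟨⟨a, i⟩, rfl⟩
        simp only [ht]
        exact ((hy a).mem i).1

/-- Embeddings of `p^2`-bounded submodules are classified by numerical invariants. -/
theorem exists_equiv_of_len_eq (hp : Prime p) {B' : Type u} [AddCommGroup B'] [Module R B']
    [Finite B'] {A : Submodule R B} {A' : Submodule R B'} (hA : ∀ x ∈ A, p • p • x = 0)
    (hA' : ∀ x ∈ A', p • p • x = 0) (hB : ∃ n : ℕ, ∀ x : B, p ^ n • x = 0)
    (hB' : ∃ n : ℕ, ∀ x : B', p ^ n • x = 0)
    (h1 : ∀ a, len (p ^ a • (⊤ : Submodule R B)) = len (p ^ a • (⊤ : Submodule R B')))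
    (h2 : ∀ a, len (A ⊓ p ^ a • ⊤) = len (A' ⊓ p ^ a • ⊤))
    (h3 : ∀ b a, len (smulInf p A b ⊓ p ^ a • ⊤) = len (smulInf p A' b ⊓ p ^ a • ⊤)) :
    ∃ e : B ≃ₗ[R] B', A.map (e : B →ₗ[R] B') = A' := by
  obtain ⟨N, hN⟩ : ∃ N : ℕ, (∀ x : B, p ^ N • x = 0) ∧ ∀ x : B', p ^ N • x = 0 := by
    obtain ⟨m, hm⟩ := hB
    obtain ⟨m', hm'⟩ := hB'
    refine ⟨m + m', fun x => ?_, fun x => ?_⟩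
    · rw [add_comm, pow_add, mul_smul, hm, smul_zero]
    · rw [pow_add, mul_smul, hm', smul_zero]
  have h4 : ∀ a, len (soc p B a) = len (soc p B' a) := fun a => by
    have e1 := len_soc (p := p) (B := B) a
    have e2 := len_soc (p := p) (B := B') a
    have e3 := h1 a
    have e4 := h1 (a + 1)
    omega
  have h5 : ∀ b, len (smulInf p A b) = len (smulInf p A' b) := fun b => by
    simpa using h3 b 0
  have h6 : ∀ a, len (A ⊓ soc p B a) = len (A' ⊓ soc p B' a) := fun a => by
    have e1 := len_inf_soc (p := p) A a
    have e2 := len_inf_soc (p := p) A' a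
    have e3 := h2 a
    have e4 := h5 a
    omega
  obtain ⟨n, j, k, hn, hj, hk, ⟨F⟩⟩ := exists_normalForm hp hA hN.1
  obtain ⟨n', j', k', hn', hj', hk', ⟨F'⟩⟩ := exists_normalForm hp hA' hN.2
  obtain rfl : n = n' := funext fun a => funext fun b => by
    have e1 := hn a b
    have e2 := hn' a b
    simp only [h3] at e1
    omega
  obtain rfl : j = j' := funext fun a => by
    have e1 := hj a
    have e2 := hj' a
    simp only [h3, h6] at e1
    omega
  obtain rfl : k = k' := funext fun a => by
    have e1 := hk a
    have e2 := hk' a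
    simp only [h4, h6] at e1
    omega
  exact F.exists_equiv F'

end NormalForm

/-! ### Klein tableaux with entries at most two -/

section EntriesAtMostTwo

variable {R : Type u} [CommRing R] {B : Type u} [AddCommGroup B] [Module R B] {p : R}
  {A : Submodule R B}

theorem smul_eq_bot_iff {a : R} {X : Submodule R B} : a • X = ⊥ ↔ ∀ x ∈ X, a • x = 0 := by
  rw [eq_bot_iff]
  constructor
  · intro h x hx
    exact (Submodule.mem_bot R).mp (h (Submodule.smul_mem_pointwise_smul x a X hx))
  · rintro h _ ⟨x, hx, rfl⟩
    exact h x hx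

theorem pow_smul_eq_bot_of_le {m n : ℕ} (h : p ^ m • A = ⊥) (hmn : m ≤ n) : p ^ n • A = ⊥ :=
  eq_bot_iff.mpr (h ▸ pow_smul_le_pow_smul A hmn)

theorem kleinSubmodule_two (hA : p ^ 2 • A = ⊥) (r : ℕ) :
    kleinSubmodule p A 2 r = smulInf p A r := by
  rw [kleinSubmodule, hA, bot_sup_eq, Nat.sub_self, pow_zero, one_smul, smulInf]

theorem len_inf_pow_smul_top [Finite B] (X : Submodule R B) (a : R) :
    len (X ⊓ a • ⊤) + len (a • (⊤ : Submodule R (B ⧸ X))) = len (a • (⊤ : Submodule R B)) := by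
  have h := len_map_add X.mkQ (a • ⊤)
  rw [map_smul_submodule, Submodule.map_top, Submodule.range_mkQ, Submodule.ker_mkQ, inf_comm] at h
  omega

/-- If `p^(ℓ-1) A = 0`, then the `ℓ`-th stripe is empty and there is no condition on the
subscripts. -/
theorem hasSubscripts_of_eq_bot {ℓ : ℕ} {μ : YoungDiagram} (hμ : HasType p (B ⧸ p ^ ℓ • A) μ)
    (hℓ : 2 ≤ ℓ) (h : p ^ (ℓ - 1) • A = ⊥) (φ : ℕ × ℕ → ℕ) : HasSubscripts p A ℓ φ := by
  refine ⟨fun _ => μ, fun r => ?_, fun r _ b hb => ?_⟩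
  · have h1 : kleinSubmodule p A ℓ r = p ^ ℓ • A := by
      refine le_antisymm ((kleinSubmodule_anti A ℓ (Nat.zero_le r)).trans ?_)
        (le_kleinSubmodule A ℓ r)
      rw [kleinSubmodule_zero A hℓ, h]
      exact bot_le
    rwa [h1]
  · simp at hb

variable [IsDomain R] [IsPrincipalIdealRing R] [Finite (R ⧸ Ideal.span {p})] [Finite B]

/-- The part `[γ^k, …, γ^(k+u); φ^(k+2), …, φ^(k+u)]` of the tableau `T` is the Klein tableau of the
embedding of `A` in `B`; in particular `p^u A = 0`. -/
structure HasSegment (p : R) (A : Submodule R B) (T : KleinTableau) (k u : ℕ) : Prop where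
  smul_eq_bot : p ^ u • A = ⊥
  shape : ∀ i, i ≤ u → HasType p (B ⧸ p ^ i • A) (T.shape (k + i))
  subscript : ∀ i, 2 ≤ i → i ≤ u → HasSubscripts p A i (T.subscript (k + i))

/-- If the entries of `T` are at most `u`, then only the first `u` layers matter. -/
theorem isKleinTableauOf_iff_hasSegment (hp : Prime p) (hB : ∃ n : ℕ, ∀ x : B, p ^ n • x = 0)
    {T : KleinTableau} {u : ℕ} (hT : T.EntriesAtMost u) :
    IsKleinTableauOf p A T ↔ HasSegment p A T 0 u := by
  constructor
  · intro h
    refine ⟨?_, fun i _ => by simpa using h.shape i, fun i hi _ => by simpa using h.subscript i hi⟩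
    obtain ⟨n, hn⟩ := hB
    have h1 := (h.shape u).card_cells hp ⟨n, hn⟩
    have h2 := (h.shape (n + u)).card_cells hp ⟨n, hn⟩
    have h3 : p ^ (n + u) • A = ⊥ :=
      pow_smul_eq_bot_of_le (smul_eq_bot_iff.mpr fun x _ => hn x) (Nat.le_add_right n u)
    rw [h3, len_bot, hT (n + u) (Nat.le_add_left u n)] at h2
    exact (eq_of_le_of_len_le bot_le (by rw [len_bot]; omega)).symm
  · rintro ⟨h, hs, hφ⟩
    simp only [Nat.zero_add] at hs hφ
    have hsh : ∀ ℓ, HasType p (B ⧸ p ^ ℓ • A) (T.shape ℓ) := fun ℓ => by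
      rcases le_total ℓ u with hℓ | hℓ
      · exact hs ℓ hℓ
      · rw [hT ℓ hℓ, pow_smul_eq_bot_of_le h hℓ, ← h]
        exact hs u le_rfl
    refine ⟨hsh, fun ℓ hℓ => ?_⟩
    rcases le_or_gt ℓ u with hℓ' | hℓ'
    · exact hφ ℓ hℓ hℓ'
    · exact hasSubscripts_of_eq_bot (hsh ℓ) hℓ (pow_smul_eq_bot_of_le h (by omega)) _

theorem isKleinTableauOf_iff (hp : Prime p) (hB : ∃ n : ℕ, ∀ x : B, p ^ n • x = 0)
    {T : KleinTableau} (hT : T.EntriesAtMost 2) :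
    IsKleinTableauOf p A T ↔ p ^ 2 • A = ⊥ ∧ HasType p (B ⧸ A) (T.shape 0) ∧
      HasType p (B ⧸ p • A) (T.shape 1) ∧ HasType p (B ⧸ p ^ 2 • A) (T.shape 2) ∧
      HasSubscripts p A 2 (T.subscript 2) := by
  rw [isKleinTableauOf_iff_hasSegment hp hB hT]
  constructor
  · rintro ⟨h, hs, hφ⟩
    refine ⟨h, ?_, ?_, hs 2 le_rfl, hφ 2 le_rfl le_rfl⟩
    · have := hs 0 (Nat.zero_le 2)
      rwa [pow_zero, one_smul] at this
    · have := hs 1 (Nat.le_succ 1)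
      rwa [pow_one] at this
  · rintro ⟨h, h0, h1, h2, hφ⟩
    refine ⟨h, fun i hi => ?_, fun i hi hi' => ?_⟩
    · interval_cases i
      · rwa [pow_zero, one_smul]
      · rwa [pow_one]
      · exact h2
    · obtain rfl : i = 2 := le_antisymm hi' hi
      exact hφ

theorem isKleinTableauOf_restrict_iff (hp : Prime p) (hB : ∃ n : ℕ, ∀ x : B, p ^ n • x = 0)
    {T : KleinTableau} {k u : ℕ} :
    IsKleinTableauOf p A (T.restrict u (k + u)) ↔ HasSegment p A T k u := by
  have hshape : ∀ i, i ≤ u → (T.restrict u (k + u)).shape i = T.shape (k + i) := fun i hi => by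
    change T.shape _ = _
    rw [Nat.add_sub_cancel, min_eq_left (by omega)]
  have hsub : ∀ i, 2 ≤ i → i ≤ u →
      (T.restrict u (k + u)).subscript i = T.subscript (k + i) := fun i hi hi' => by
    funext b
    change (if _ then _ else _) = _
    rw [Nat.add_sub_cancel, if_pos (by omega)]
  rw [isKleinTableauOf_iff_hasSegment hp hB (u := u)]
  · constructor
    · rintro ⟨h, hs, hφ⟩
      refine ⟨h, fun i hi => ?_, fun i hi hi' => ?_⟩
      · have := hs i hi
        rwa [Nat.zero_add, hshape i hi] at this
      · have := hφ i hi hi'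
        rwa [Nat.zero_add, hsub i hi hi'] at this
    · rintro ⟨h, hs, hφ⟩
      refine ⟨h, fun i hi => ?_, fun i hi hi' => ?_⟩
      · rw [Nat.zero_add, hshape i hi]
        exact hs i hi
      · rw [Nat.zero_add, hsub i hi hi']
        exact hφ i hi hi'
  · intro ℓ hℓ
    change T.shape _ = T.shape _
    rw [min_eq_right (by omega), min_eq_right (by omega)]

theorem KleinTableau.entriesAtMost_restrict (T : KleinTableau) {n u : ℕ} (h : u ≤ n) (ℓ : ℕ) :
    (T.restrict u ℓ).EntriesAtMost n := by
  intro i hi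
  change T.shape _ = T.shape _
  congr 1
  omega

/-- Two embeddings with the same Klein tableau, with entries at most two, are isomorphic. -/
theorem IsKleinTableauOf.exists_equiv (hp : Prime p) {B' : Type u} [AddCommGroup B'] [Module R B']
    [Finite B'] {A' : Submodule R B'} (hB : ∃ n : ℕ, ∀ x : B, p ^ n • x = 0)
    (hB' : ∃ n : ℕ, ∀ x : B', p ^ n • x = 0) {T : KleinTableau} (hT : T.EntriesAtMost 2)
    (h : IsKleinTableauOf p A T) (h' : IsKleinTableauOf p A' T) :
    ∃ e : B ≃ₗ[R] B', A.map (e : B →ₗ[R] B') = A' := by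
  obtain ⟨hA, h0, -, h2, -⟩ := (isKleinTableauOf_iff hp hB hT).mp h
  obtain ⟨hA', h0', -, h2', -⟩ := (isKleinTableauOf_iff hp hB' hT).mp h'
  have hlen : ∀ {X : Submodule R B} {X' : Submodule R B'} {μ : YoungDiagram},
      HasType p (B ⧸ X) μ → HasType p (B' ⧸ X') μ → ∀ a : ℕ,
        len (p ^ a • (⊤ : Submodule R (B ⧸ X))) = len (p ^ a • (⊤ : Submodule R (B' ⧸ X'))) := by
    intro X X' μ hμ hμ' a
    exact len_smul_top_congr (hμ.some.trans hμ'.some.symm) _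
  have hB1 : ∀ a : ℕ, len (p ^ a • (⊤ : Submodule R B)) = len (p ^ a • (⊤ : Submodule R B')) := by
    intro a
    have e1 := len_inf_pow_smul_top (p ^ 2 • A) (p ^ a)
    have e2 := len_inf_pow_smul_top (p ^ 2 • A') (p ^ a)
    have e3 := hlen h2 h2' a
    rw [hA, bot_inf_eq, len_bot, ← hA] at e1
    rw [hA', bot_inf_eq, len_bot, ← hA'] at e2
    omega
  have hinf : ∀ {X : Submodule R B} {X' : Submodule R B'} {μ : YoungDiagram},
      HasType p (B ⧸ X) μ → HasType p (B' ⧸ X') μ → ∀ a : ℕ,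
        len (X ⊓ p ^ a • ⊤) = len (X' ⊓ p ^ a • ⊤) := by
    intro X X' μ hμ hμ' a
    have e1 := len_inf_pow_smul_top X (p ^ a)
    have e2 := len_inf_pow_smul_top X' (p ^ a)
    have e3 := hlen hμ hμ' a
    have e4 := hB1 a
    omega
  obtain ⟨g, hg, hgm⟩ := h.hasType_klein hp hB le_rfl
  obtain ⟨g', hg', hgm'⟩ := h'.hasType_klein hp hB' le_rfl
  have hgg : ∀ r, g r = g' r := fun r => by
    ext b
    rw [YoungDiagram.mem_cells, YoungDiagram.mem_cells, hgm, hgm']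
  refine exists_equiv_of_len_eq hp ?_ ?_ hB hB' hB1 (hinf h0 h0') fun b a => ?_
  · intro x hx
    have := smul_eq_bot_iff.mp hA x hx
    rwa [pow_two, mul_smul] at this
  · intro x hx
    have := smul_eq_bot_iff.mp hA' x hx
    rwa [pow_two, mul_smul] at this
  · rw [← kleinSubmodule_two hA, ← kleinSubmodule_two hA']
    exact hinf (hg b) (hgg b ▸ hg' b) a

end EntriesAtMostTwo

/-! ### Direct sums of pickets and bipickets -/

section Pieces

variable {R : Type u} [CommRing R] {p : R}

theorem pi_inf {ι : Type} {Q : ι → Type u} [∀ i, AddCommGroup (Q i)] [∀ i, Module R (Q i)]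
    (X Y : ∀ i, Submodule R (Q i)) :
    Submodule.pi Set.univ X ⊓ Submodule.pi Set.univ Y =
      Submodule.pi Set.univ fun i => X i ⊓ Y i := by
  ext x
  simp only [Submodule.mem_inf, Submodule.mem_pi, Set.mem_univ, true_imp_iff, forall_and]

theorem smulInf_pi {ι : Type} {Q : ι → Type u} [∀ i, AddCommGroup (Q i)] [∀ i, Module R (Q i)]
    (X : ∀ i, Submodule R (Q i)) (r : ℕ) :
    smulInf p (Submodule.pi Set.univ X) r = Submodule.pi Set.univ fun i => smulInf p (X i) r := by
  rw [smulInf, smul_top_pi, pi_inf, smul_submodule_pi]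
  rfl

/-- The element `(p^(h 0), p^(h 1))` of `R/(p^(e 0)) ⊕ R/(p^(e 1))`. -/
def pieceGen (p : R) (e h : Fin 2 → ℕ) : ∀ t, R ⧸ Ideal.span {p ^ e t} :=
  fun t => Ideal.Quotient.mk _ (p ^ h t)

theorem smul_pieceGen (e h : Fin 2 → ℕ) :
    p • pieceGen p e h = pieceGen p e (fun t => h t + 1) := by
  ext t
  simp only [pieceGen, Pi.smul_apply]
  rw [← Ideal.Quotient.mk_eq_mk, ← Ideal.Quotient.mk_eq_mk, ← Submodule.Quotient.mk_smul,
    smul_eq_mul, pow_succ']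

variable [IsDomain R]

theorem pieceGen_eq_zero_iff (hp : Prime p) (e h : Fin 2 → ℕ) :
    pieceGen p e h = 0 ↔ ∀ t, e t ≤ h t := by
  rw [funext_iff]
  refine forall_congr' fun t => ?_
  simp only [pieceGen, Pi.zero_apply]
  rw [Ideal.Quotient.eq_zero_iff_dvd, pow_dvd_pow_iff hp.ne_zero hp.not_isUnit]

theorem pieceGen_mem_iff (hp : Prime p) (e h : Fin 2 → ℕ) (c : ℕ) :
    pieceGen p e h ∈ p ^ c • (⊤ : Submodule R (∀ t, R ⧸ Ideal.span {p ^ e t})) ↔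
      ∀ t, c ≤ h t ∨ e t ≤ h t := by
  rw [smul_top_pi, Submodule.mem_pi]
  simp only [Set.mem_univ, true_imp_iff]
  refine forall_congr' fun t => ?_
  rw [mem_smul_top]
  simp only [pieceGen]
  constructor
  · rintro ⟨y, hy⟩
    obtain ⟨y, rfl⟩ := Ideal.Quotient.mk_surjective y
    rw [← Ideal.Quotient.mk_eq_mk, ← Ideal.Quotient.mk_eq_mk, ← Submodule.Quotient.mk_smul,
      Submodule.Quotient.eq, Ideal.mem_span_singleton, smul_eq_mul] at hy
    by_contra! hcon
    have h1 : p ^ (h t + 1) ∣ p ^ c * y := (pow_dvd_pow p hcon.1).trans (dvd_mul_right _ _)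
    have h2 : p ^ (h t + 1) ∣ p ^ h t := (dvd_sub_right h1).mp ((pow_dvd_pow p hcon.2).trans hy)
    have := (pow_dvd_pow_iff hp.ne_zero hp.not_isUnit).mp h2
    omega
  · rintro (hc | hc)
    · refine ⟨Ideal.Quotient.mk _ (p ^ (h t - c)), ?_⟩
      rw [← Ideal.Quotient.mk_eq_mk, ← Ideal.Quotient.mk_eq_mk, ← Submodule.Quotient.mk_smul,
        smul_eq_mul, ← pow_add, Nat.add_sub_cancel' hc]
    · refine ⟨0, ?_⟩
      rw [smul_zero, eq_comm, Ideal.Quotient.eq_zero_iff_dvd]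
      exact pow_dvd_pow p hc

theorem span_inf_of_notMem [IsPrincipalIdealRing R] (hp : Prime p) {M : Type u} [AddCommGroup M]
    [Module R M] {x : M} {P : Submodule R M} (hx : x ∉ P) (hpx : p • p • x = 0) :
    (R ∙ x) ⊓ P = (R ∙ (p • x)) ⊓ P := by
  apply le_antisymm
  · rintro y ⟨hy, hyP⟩
    refine ⟨?_, hyP⟩
    obtain ⟨c, rfl⟩ := Submodule.mem_span_singleton.mp hy
    -- if `p` does not divide `c` then `x` is a multiple of `c x`
    have hdvd : p ∣ c := by
      by_contra hc
      have hc2 : IsCoprime (p ^ 2) c :=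
        (hp.irreducible.coprime_iff_not_dvd.mpr hc).pow_left
      obtain ⟨a, b, hab⟩ := hc2
      apply hx
      rw [← one_smul R x, ← hab, add_smul, mul_smul, mul_smul, pow_two, mul_smul, hpx, smul_zero,
        zero_add]
      exact P.smul_mem _ hyP
    obtain ⟨d, rfl⟩ := hdvd
    rw [mul_comm, mul_smul]
    exact Submodule.mem_span_singleton.mpr ⟨d, rfl⟩
  · refine inf_le_inf_right _ ?_
    rw [Submodule.span_singleton_le_iff_mem]
    exact Submodule.smul_mem _ _ (Submodule.mem_span_singleton_self x)

open Classical in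
theorem len_span_inf [IsPrincipalIdealRing R] (hp : Prime p) {M : Type u} [AddCommGroup M]
    [Module R M] [Finite M] {x : M} {P : Submodule R M} (hpx : p • p • x = 0) :
    len ((R ∙ x) ⊓ P) = (if x ∈ P ∧ x ≠ 0 then 1 else 0) +
      (if p • x ∈ P ∧ p • x ≠ 0 then 1 else 0) := by
  -- the case of an element annihilated by `p`
  have key : ∀ {y : M}, p • y = 0 →
      len ((R ∙ y) ⊓ P) = if y ∈ P ∧ y ≠ 0 then 1 else 0 := by
    intro y hy
    by_cases hyP : y ∈ P
    · rw [inf_eq_left.mpr ((Submodule.span_singleton_le_iff_mem _ _).mpr hyP)]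
      by_cases hy0 : y = 0
      · simp [hy0, len_bot]
      · rw [len_span_singleton hp hy0 hy, if_pos ⟨hyP, hy0⟩]
    · rw [span_inf_of_notMem hp hyP (by rw [hy, smul_zero]), hy, if_neg (fun h => hyP h.1)]
      simp [len_bot]
  by_cases hxP : x ∈ P
  · have hpxP : p • x ∈ P := P.smul_mem _ hxP
    rw [inf_eq_left.mpr ((Submodule.span_singleton_le_iff_mem _ _).mpr hxP)]
    by_cases hpx0 : p • x = 0
    · have := key hpx0
      rw [inf_eq_left.mpr ((Submodule.span_singleton_le_iff_mem _ _).mpr hxP)] at this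
      simp [this, hpx0]
    · have hx0 : x ≠ 0 := by
        rintro rfl
        exact hpx0 (smul_zero p)
      rw [if_pos ⟨hxP, hx0⟩, if_pos ⟨hpxP, hpx0⟩]
      have h1 : (R ∙ x) = (R ∙ (p • x)) ⊔ (R ∙ x) := by
        rw [eq_comm, sup_eq_right, Submodule.span_singleton_le_iff_mem]
        exact Submodule.smul_mem _ _ (Submodule.mem_span_singleton_self x)
      rw [h1, len_sup_span_singleton hp, len_span_singleton hp hpx0 hpx]
      · intro hmem
        obtain ⟨c, hc⟩ := Submodule.mem_span_singleton.mp hmem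
        apply hpx0
        rw [← hc, smul_comm, hpx, smul_zero]
      · exact Submodule.mem_span_singleton_self _
  · rw [span_inf_of_notMem hp hxP hpx, key hpx]
    simp [hxP]

open Classical in
theorem smulInf_span [IsPrincipalIdealRing R] (hp : Prime p) {M : Type u} [AddCommGroup M]
    [Module R M] {x : M} (hpx : p • p • x = 0) (r : ℕ) :
    smulInf p (R ∙ x) r = if x ∈ p ^ r • (⊤ : Submodule R M) then R ∙ (p • x) else ⊥ := by
  have hsmul : ∀ y : M, p • (R ∙ y) = R ∙ (p • y) := fun y => by
    change (R ∙ y).map (DistribSMul.toLinearMap R M p) = _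
    rw [Submodule.map_span, Set.image_singleton]
    rfl
  split_ifs with h
  · rw [smulInf, inf_eq_left.mpr ((Submodule.span_singleton_le_iff_mem _ _).mpr h), hsmul]
  · rw [smulInf, span_inf_of_notMem hp h hpx, eq_bot_iff]
    refine (smul_mono_right p inf_le_left).trans ?_
    rw [hsmul, hpx]
    simp

variable [IsPrincipalIdealRing R] [Finite (R ⧸ Ideal.span {p})]

open Classical in
/-- The direct sum of `n a b` bipickets (pickets if `b + 1 = a`), and of pickets with multiplicities
`j a` and `k a`, together with its numerical invariants. -/
theorem exists_embedding (hp : Prime p) (N : ℕ) (n : ℕ → ℕ → ℕ) (j k : ℕ → ℕ)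
    (hn : ∀ a b, n a b ≠ 0 → b < a) :
    ∃ (B : Type u) (_ : AddCommGroup B) (_ : Module R B) (_ : Finite B) (A : Submodule R B),
      (∃ m : ℕ, ∀ x : B, p ^ m • x = 0) ∧ p ^ 2 • A = ⊥ ∧
      (∀ c, len (p ^ c • (⊤ : Submodule R B)) = len (p ^ (c + 1) • (⊤ : Submodule R B)) +
        (∑ a ∈ Finset.range N, ∑ b ∈ Finset.range N,
          n a b * ((if c ≤ a then 1 else 0) + if b + 1 < a ∧ c ≤ b then 1 else 0) +
        (∑ a ∈ Finset.range N, j a * (if c ≤ a then 1 else 0) +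
        ∑ a ∈ Finset.range N, k a * (if c ≤ a then 1 else 0)))) ∧
      (∀ c, len (A ⊓ p ^ c • (⊤ : Submodule R B)) =
        ∑ a ∈ Finset.range N, ∑ b ∈ Finset.range N,
          n a b * ((if c ≤ b then 1 else 0) + if c ≤ a then 1 else 0) +
        ∑ a ∈ Finset.range N, j a * (if c ≤ a then 1 else 0)) ∧
      (∀ r c, len (smulInf p A r ⊓ p ^ c • (⊤ : Submodule R B)) =
        ∑ a ∈ Finset.range N, ∑ b ∈ Finset.range N,
          n a b * (if r ≤ b ∧ c ≤ a then 1 else 0)) := by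
  let ι : Type := (Σ a : Fin N, Σ b : Fin N, Fin (n a b)) ⊕
    ((Σ a : Fin N, Fin (j a)) ⊕ (Σ a : Fin N, Fin (k a)))
  let e : ι → Fin 2 → ℕ := Sum.elim
    (fun l => ![l.1 + 1, if (l.2.1 : ℕ) + 1 < l.1 then l.2.1 + 1 else 0])
    (Sum.elim (fun l => ![l.1 + 1, 0]) (fun l => ![l.1 + 1, 0]))
  let h : ι → Fin 2 → ℕ := Sum.elim (fun l => ![l.1 - 1, l.2.1])
    (Sum.elim (fun l => ![l.1, 0]) (fun l => ![l.1 + 1, 0]))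
  have hlt : ∀ l : Σ a : Fin N, Σ b : Fin N, Fin (n a b), (l.2.1 : ℕ) < l.1 := fun l =>
    hn _ _ (by have := l.2.2.2; omega)
  have hfin := fun m => finite_quotient_pow (p := p) m
  have hsum : ∀ (F : ι → ℕ) (f : ℕ → ℕ → ℕ) (g₁ g₂ : ℕ → ℕ),
      (∀ l, F (Sum.inl l) = f l.1 l.2.1) → (∀ l, F (Sum.inr (Sum.inl l)) = g₁ l.1) →
      (∀ l, F (Sum.inr (Sum.inr l)) = g₂ l.1) →
      ∑ i, F i = ∑ a ∈ Finset.range N, ∑ b ∈ Finset.range N, n a b * f a b +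
        (∑ a ∈ Finset.range N, j a * g₁ a + ∑ a ∈ Finset.range N, k a * g₂ a) := by
    intro F f g₁ g₂ h1 h2 h3
    rw [Fintype.sum_sum_type, Fintype.sum_sum_type]
    simp only [h1, h2, h3, Fintype.sum_sigma, Finset.sum_const, Finset.card_univ, Fintype.card_fin,
      smul_eq_mul]
    rw [← Fin.sum_univ_eq_sum_range (fun a => ∑ b ∈ Finset.range N, n a b * f a b),
      ← Fin.sum_univ_eq_sum_range (fun a => j a * g₁ a),
      ← Fin.sum_univ_eq_sum_range (fun a => k a * g₂ a)]
    congr 1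
    exact Finset.sum_congr rfl fun a _ => Fin.sum_univ_eq_sum_range (fun b => n a b * f a b) N
  have hpp : ∀ i, p • p • pieceGen p (e i) (h i) = 0 := by
    intro i
    rw [smul_pieceGen, smul_pieceGen, pieceGen_eq_zero_iff hp, Fin.forall_fin_two]
    rcases i with l | l | l
    · have := hlt l
      simp only [e, h, Sum.elim_inl, Matrix.cons_val_zero, Matrix.cons_val_one]
      split_ifs <;> omega
    · simp [e, h]
    · simp [e, h]
  refine ⟨∀ i, ∀ t, R ⧸ Ideal.span {p ^ e i t}, inferInstance, inferInstance, inferInstance,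
    Submodule.pi Set.univ fun i => R ∙ pieceGen p (e i) (h i), ⟨N, ?_⟩, ?_, ?_, ?_, ?_⟩
  · intro x
    ext i t
    obtain ⟨y, hy⟩ := Ideal.Quotient.mk_surjective (x i t)
    rw [Pi.smul_apply, Pi.smul_apply, ← hy, ← Ideal.Quotient.mk_eq_mk,
      ← Submodule.Quotient.mk_smul, Pi.zero_apply, Pi.zero_apply, Submodule.Quotient.mk_eq_zero,
      smul_eq_mul]
    refine Ideal.mul_mem_right _ _ (Ideal.mem_span_singleton.mpr (pow_dvd_pow _ ?_))
    revert t
    rw [Fin.forall_fin_two]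
    rcases i with l | l | l
    · have := hlt l
      have := l.1.2
      simp only [e, Sum.elim_inl, Matrix.cons_val_zero, Matrix.cons_val_one]
      split_ifs <;> omega
    · have := l.1.2
      simp only [e, Sum.elim_inl, Sum.elim_inr, Matrix.cons_val_zero, Matrix.cons_val_one]
      omega
    · have := l.1.2
      simp only [e, Sum.elim_inr, Matrix.cons_val_zero, Matrix.cons_val_one]
      omega
  · rw [smul_eq_bot_iff]
    intro x hx
    funext i
    obtain ⟨c, hc⟩ := Submodule.mem_span_singleton.mp (hx i trivial)
    rw [Pi.smul_apply, ← hc, pow_two, mul_smul, smul_comm p c, smul_comm p c, hpp, smul_zero,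
      Pi.zero_apply]
  · intro c
    rw [smul_top_pi, smul_top_pi, len_pi, len_pi]
    rw [Finset.sum_congr rfl fun i _ => len_pow_smul_top_pi hp (e i) c, Finset.sum_add_distrib]
    congr 1
    refine hsum _ (fun a b => (if c ≤ a then 1 else 0) + if b + 1 < a ∧ c ≤ b then 1 else 0)
      (fun a => if c ≤ a then 1 else 0) (fun a => if c ≤ a then 1 else 0) ?_ ?_ ?_
    · intro l
      rw [Finset.card_filter, Fin.sum_univ_two]
      by_cases hb : (l.2.1 : ℕ) + 1 < l.1 <;> simp [e, hb]
    · intro l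
      rw [Finset.card_filter, Fin.sum_univ_two]
      simp [e]
    · intro l
      rw [Finset.card_filter, Fin.sum_univ_two]
      simp [e]
  · intro c
    rw [smul_top_pi, pi_inf, len_pi]
    simp_rw [len_span_inf hp (hpp _), smul_pieceGen, Ne, pieceGen_eq_zero_iff hp,
      pieceGen_mem_iff hp, Fin.forall_fin_two]
    refine (hsum _ (fun a b => (if c ≤ b then 1 else 0) + if c ≤ a then 1 else 0)
      (fun a => if c ≤ a then 1 else 0) (fun a => 0) ?_ ?_ ?_).trans ?_
    · intro l
      have := hlt l
      simp only [e, h, Sum.elim_inl, Matrix.cons_val_zero, Matrix.cons_val_one]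
      split_ifs <;> omega
    · intro l
      simp [e, h]
    · intro l
      simp [e, h]
    · simp
  · intro r c
    rw [smulInf_pi, smul_top_pi, pi_inf, len_pi]
    refine (hsum _ (fun a b => if r ≤ b ∧ c ≤ a then 1 else 0) (fun a => 0) (fun a => 0)
      ?_ ?_ ?_).trans ?_
    · intro l
      have := hlt l
      rw [smulInf_span hp (hpp _)]
      have hmem : pieceGen p (e (Sum.inl l)) (h (Sum.inl l)) ∈ p ^ r • (⊤ : Submodule R _) ↔
          r ≤ l.2.1 := by
        rw [pieceGen_mem_iff hp, Fin.forall_fin_two]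
        simp only [e, h, Sum.elim_inl, Matrix.cons_val_zero, Matrix.cons_val_one]
        split_ifs <;> omega
      have hmem' : (p • pieceGen p (e (Sum.inl l)) (h (Sum.inl l)) ∈ p ^ c • (⊤ : Submodule R _) ∧
          p • pieceGen p (e (Sum.inl l)) (h (Sum.inl l)) ≠ 0) ↔ c ≤ l.1 := by
        rw [smul_pieceGen, Ne, pieceGen_eq_zero_iff hp, pieceGen_mem_iff hp, Fin.forall_fin_two,
          Fin.forall_fin_two]
        simp only [e, h, Sum.elim_inl, Matrix.cons_val_zero, Matrix.cons_val_one]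
        split_ifs <;> omega
      simp_rw [hmem]
      by_cases hr : r ≤ l.2.1
      · rw [if_pos hr, len_span_inf hp (by rw [hpp, smul_zero]), hpp]
        simp_rw [hmem']
        simp [hr]
      · rw [if_neg hr, bot_inf_eq, len_bot, if_neg (fun h => hr h.1)]
    · intro l
      have h1 : smulInf p (R ∙ pieceGen p (e (Sum.inr (Sum.inl l))) (h (Sum.inr (Sum.inl l)))) r =
          ⊥ := by
        have h2 : p • pieceGen p (e (Sum.inr (Sum.inl l))) (h (Sum.inr (Sum.inl l))) = 0 := by
          rw [smul_pieceGen, pieceGen_eq_zero_iff hp, Fin.forall_fin_two]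
          simp [e, h]
        rw [smulInf_span hp (hpp _), h2]
        simp
      rw [h1, bot_inf_eq, len_bot]
    · intro l
      have h1 : smulInf p (R ∙ pieceGen p (e (Sum.inr (Sum.inr l))) (h (Sum.inr (Sum.inr l)))) r =
          ⊥ := by
        have h2 : p • pieceGen p (e (Sum.inr (Sum.inr l))) (h (Sum.inr (Sum.inr l))) = 0 := by
          rw [smul_pieceGen, pieceGen_eq_zero_iff hp, Fin.forall_fin_two]
          simp [e, h]
        rw [smulInf_span hp (hpp _), h2]
        simp
      rw [h1, bot_inf_eq, len_bot]
    · simp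

end Pieces

/-! ### Existence of an embedding with given Klein tableau -/

section Combinatorics

theorem ite_le_eq_add (c a : ℕ) :
    (if c ≤ a then 1 else 0) = (if c + 1 ≤ a then 1 else 0) + if a = c then 1 else 0 := by
  split_ifs <;> omega

theorem IsSubscriptFunction.one_le {γ : ℕ → YoungDiagram} {ℓ : ℕ} {φ : ℕ × ℕ → ℕ}
    (hφ : IsSubscriptFunction γ ℓ φ) {b : ℕ × ℕ} (hb : b ∈ strip γ ℓ) : 1 ≤ φ b := by
  by_contra! h
  have h1 := hφ.card_le 0
  have h2 : b ∈ (strip γ ℓ).filter fun b => φ b = 0 := Finset.mem_filter.mpr ⟨hb, by omega⟩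
  have h3 := (Finset.card_pos.mpr ⟨b, h2⟩).trans_le h1
  simp at h3

/-- Along the row `c` the boxes with a subscript above `r` form the end of the row. -/
theorem IsSubscriptFunction.lt_rowLen_sub_iff {γ : ℕ → YoungDiagram} {ℓ : ℕ} {φ : ℕ × ℕ → ℕ}
    (hφ : IsSubscriptFunction γ ℓ φ) {c d K : ℕ} (r : ℕ) (hd : (c, d) ∈ γ ℓ)
    (hK : K + ((strip γ ℓ).filter fun b => b.1 = c ∧ r < φ b).card = (γ ℓ).rowLen c) :
    d < K ↔ ¬ ((c, d) ∈ strip γ ℓ ∧ r < φ (c, d)) := by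
  have hd' := YoungDiagram.mem_iff_lt_rowLen.mp hd
  have hinj : Set.InjOn (fun y => (c, y)) (Set.univ : Set ℕ) := fun x _ y _ h => (Prod.mk.inj h).2
  have hup : ∀ {x y : ℕ}, (c, x) ∈ strip γ ℓ → r < φ (c, x) → x ≤ y → y < (γ ℓ).rowLen c →
      (c, y) ∈ strip γ ℓ ∧ r < φ (c, y) := by
    intro x y hx hr hxy hy
    have hyS : (c, y) ∈ strip γ ℓ := by
      rw [strip, Finset.mem_sdiff, YoungDiagram.mem_cells, YoungDiagram.mem_cells] at hx ⊢
      exact ⟨YoungDiagram.mem_iff_lt_rowLen.mpr hy,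
        fun h => hx.2 ((γ (ℓ - 1)).up_left_mem le_rfl hxy h)⟩
    exact ⟨hyS, hr.trans_le (hφ.row_mono _ hx _ hyS rfl hxy)⟩
  constructor
  · rintro h ⟨h1, h2⟩
    have h3 : (Finset.Ico d ((γ ℓ).rowLen c)).card ≤
        ((strip γ ℓ).filter fun b => b.1 = c ∧ r < φ b).card := by
      refine Finset.card_le_card_of_injOn (fun y => (c, y)) ?_ (hinj.mono (Set.subset_univ _))
      intro y hy
      rw [Finset.coe_Ico, Set.mem_Ico] at hy
      obtain ⟨h4, h5⟩ := hup h1 h2 hy.1 hy.2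
      exact Finset.mem_coe.mpr (Finset.mem_filter.mpr ⟨h4, rfl, h5⟩)
    rw [Nat.card_Ico] at h3
    omega
  · intro h
    by_contra! hlt
    have h3 : ((strip γ ℓ).filter fun b => b.1 = c ∧ r < φ b).card ≤
        (Finset.Ioo d ((γ ℓ).rowLen c)).card := by
      refine Finset.card_le_card_of_injOn Prod.snd ?_ ?_
      · rintro ⟨c', y⟩ hy
        obtain ⟨hyS, rfl, hr⟩ := Finset.mem_filter.mp (Finset.mem_coe.mp hy)
        simp only at hr h hd'
        rw [Finset.coe_Ioo, Set.mem_Ioo]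
        refine ⟨?_, YoungDiagram.mem_iff_lt_rowLen.mp (Finset.mem_sdiff.mp hyS).1⟩
        by_contra! hyd
        exact h (hup hyS hr hyd hd')
      · rintro x hx y hy hxy
        have hx' := (Finset.mem_filter.mp (Finset.mem_coe.mp hx)).2.1
        have hy' := (Finset.mem_filter.mp (Finset.mem_coe.mp hy)).2.1
        exact Prod.ext (hx'.trans hy'.symm) hxy
    rw [Nat.card_Ioo] at h3
    omega

/-- A box `(c + 1, y)` of `γ^2` which does not lie below a box of `γ^0` lies below a box of
`γ^1 \ γ^0`, so it has the subscript `c + 1`. -/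
theorem rowLen_succ_le_add_card {γ : ℕ → YoungDiagram} (hγ : IsLRSequence γ) {φ : ℕ × ℕ → ℕ}
    (hφ : IsSubscriptFunction γ 2 φ) (c : ℕ) :
    (γ 2).rowLen (c + 1) ≤ (γ 0).rowLen c +
      ((strip γ 2).filter fun b => b.1 = c + 1 ∧ φ b = c + 1).card := by
  have h3 : (Finset.Ico ((γ 0).rowLen c) ((γ 2).rowLen (c + 1))).card ≤
      ((strip γ 2).filter fun b => b.1 = c + 1 ∧ φ b = c + 1).card := by
    refine Finset.card_le_card_of_injOn (fun y => (c + 1, y)) ?_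
      (fun x _ y _ h => (Prod.mk.inj h).2)
    intro y hy
    rw [Finset.coe_Ico, Set.mem_Ico] at hy
    have h2 : (c + 1, y) ∈ γ 2 := YoungDiagram.mem_iff_lt_rowLen.mpr hy.2
    have h1 : (c, y) ∈ γ 1 := mem_of_mem_of_colLen (hγ.horizontal 2 (by norm_num) y) h2
    have h0 : (c, y) ∉ γ 0 := fun h => by
      have := YoungDiagram.mem_iff_lt_rowLen.mp h
      omega
    have hb : (c + 1, y) ∈ strip γ 2 := Finset.mem_sdiff.mpr
      ⟨h2, fun h => h0 (mem_of_mem_of_colLen (hγ.horizontal 1 le_rfl y) h)⟩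
    exact Finset.mem_coe.mpr (Finset.mem_filter.mpr ⟨hb, rfl,
      hφ.below c y hb (Finset.mem_sdiff.mpr ⟨h1, h0⟩)⟩)
  rw [Nat.card_Ico] at h3
  omega

end Combinatorics

section Existence

variable {R : Type u} [CommRing R] [IsDomain R] [IsPrincipalIdealRing R] {p : R}
  [Finite (R ⧸ Ideal.span {p})]

/-- A form of `hasType_quotient_iff` in terms of the submodules `X ∩ p^c B`. -/
theorem hasType_quotient_of_len_inf (hp : Prime p) {B : Type u} [AddCommGroup B] [Module R B]
    [Finite B] (hB : ∃ n : ℕ, ∀ x : B, p ^ n • x = 0) {X : Submodule R B} {μ ν : YoungDiagram}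
    (hν : ∀ c, len (p ^ c • (⊤ : Submodule R B)) =
      len (p ^ (c + 1) • (⊤ : Submodule R B)) + ν.rowLen c) {f : ℕ → ℕ}
    (hX : ∀ c, len (X ⊓ p ^ c • (⊤ : Submodule R B)) =
      len (X ⊓ p ^ (c + 1) • (⊤ : Submodule R B)) + f c)
    (hμ : ∀ c, μ.rowLen c + f c = ν.rowLen c) : HasType p (B ⧸ X) μ := by
  rw [hasType_iff hp (exists_pow_smul_quotient hB X)]
  intro c
  have h1 := len_inf_pow_smul_top X (p ^ c)
  have h2 := len_inf_pow_smul_top X (p ^ (c + 1))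
  have h3 := hν c
  have h4 := hX c
  have h5 := hμ c
  omega

/-- Each Klein tableau with entries at most two is realized by a direct sum of pickets and
bipickets: each box of `γ^2 \ γ^1` gives a summand, depending on its row and its subscript; each
further box of `γ^1 \ γ^0` gives a picket with `A` of length one, and the remaining columns give
pickets with `A = 0`. -/
theorem exists_isKleinTableauOf_of_entriesAtMost (hp : Prime p) {T : KleinTableau}
    (hT : T.EntriesAtMost 2) :
    ∃ (B : Type u) (_ : AddCommGroup B) (_ : Module R B) (_ : Finite B) (A : Submodule R B),
      (∃ m : ℕ, ∀ x : B, p ^ m • x = 0) ∧ IsKleinTableauOf p A T := by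
  classical
  set γ := T.shape with hγdef
  set φ := T.subscript 2 with hφdef
  have hφ : IsSubscriptFunction γ 2 φ := T.isSubscript 2 le_rfl
  set N := (γ 2).colLen 0 with hNdef
  have hrow0 : ∀ c, N ≤ c → (γ 2).rowLen c = 0 := by
    intro c hc
    by_contra h
    have h1 : (c, 0) ∈ γ 2 := YoungDiagram.mem_iff_lt_rowLen.mpr (Nat.pos_of_ne_zero h)
    have := YoungDiagram.mem_iff_lt_colLen.mp h1
    omega
  have hmono := T.isLR.monotone
  have h01 : γ 0 ≤ γ 1 := hmono (Nat.zero_le 1)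
  have h12 : γ 1 ≤ γ 2 := hmono (Nat.le_succ 1)
  set one : ℕ → ℕ := fun c => ((strip γ 1).filter fun b => b.1 = c).card with hone
  set two : ℕ → ℕ := fun c => ((strip γ 2).filter fun b => b.1 = c).card with htwo
  have hone' : ∀ c, one c + (γ 0).rowLen c = (γ 1).rowLen c := fun c => card_filter_row_sdiff h01 c
  have htwo' : ∀ c, two c + (γ 1).rowLen c = (γ 2).rowLen c := fun c => card_filter_row_sdiff h12 c
  set n : ℕ → ℕ → ℕ := fun a b => ((strip γ 2).filter fun x => x.1 = a ∧ φ x = b + 1).card with hn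
  have hnlt : ∀ a b, n a b ≠ 0 → b < a := by
    intro a b h
    obtain ⟨x, hx⟩ := Finset.card_pos.mp (Nat.pos_of_ne_zero h)
    obtain ⟨hxS, rfl, hx2⟩ := Finset.mem_filter.mp hx
    have := hφ.lt_row x hxS
    omega
  have hrowlt : ∀ x ∈ strip γ 2, x.1 < N := by
    rintro ⟨c, d⟩ hx
    have h1 : (c, d) ∈ γ 2 := (Finset.mem_sdiff.mp hx).1
    have h2 := YoungDiagram.mem_iff_lt_rowLen.mp h1
    by_contra! h3
    have := hrow0 c h3
    omega
  -- summing the bipickets by rows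
  have hsumr : ∀ r c, ∑ b ∈ Finset.range N, n c b * (if r ≤ b then 1 else 0) =
      ((strip γ 2).filter fun x => x.1 = c ∧ r < φ x).card := by
    intro r c
    rw [Finset.card_eq_sum_card_fiberwise (f := fun x => φ x - 1) (t := Finset.range N)]
    · refine Finset.sum_congr rfl fun b _ => ?_
      split_ifs with hrb
      · rw [mul_one, Finset.filter_filter]
        refine congrArg Finset.card (Finset.ext fun x => ?_)
        simp only [Finset.mem_filter]
        constructor
        · rintro ⟨h1, h2, h3⟩
          exact ⟨h1, ⟨h2, by omega⟩, by omega⟩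
        · rintro ⟨h1, ⟨h2, h3⟩, h4⟩
          exact ⟨h1, h2, by omega⟩
      · rw [mul_zero, eq_comm, Finset.card_eq_zero, Finset.filter_eq_empty_iff]
        intro x hx
        have := (Finset.mem_filter.mp hx).2.2
        omega
    · intro x hx
      obtain ⟨h1, h2, h3⟩ := Finset.mem_filter.mp (Finset.mem_coe.mp hx)
      have := hrowlt x h1
      have := hφ.lt_row x h1
      rw [Finset.coe_range, Set.mem_Iio]
      change φ x - 1 < N
      omega
  have hsum2 : ∀ c, ∑ b ∈ Finset.range N, n c b = two c := by
    intro c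
    have h := hsumr 0 c
    simp only [Nat.zero_le, if_true, mul_one] at h
    rw [h]
    congr 1
    refine Finset.filter_congr fun x hx => ?_
    have := hφ.one_le hx
    constructor
    · exact fun h => h.1
    · exact fun h => ⟨h, by omega⟩
  have hsum1 : ∀ c, ∑ a ∈ Finset.range N, n a c ≤ one c := by
    intro c
    refine le_trans (le_of_eq ?_) ((hφ.card_le (c + 1)).trans_eq ?_)
    · rw [Finset.card_eq_sum_card_fiberwise (f := Prod.fst) (t := Finset.range N)]
      · refine Finset.sum_congr rfl fun a _ => ?_
        rw [Finset.filter_filter]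
        exact congrArg Finset.card (Finset.filter_congr fun x _ => and_comm)
      · intro x hx
        rw [Finset.coe_range, Set.mem_Iio]
        exact hrowlt x (Finset.mem_filter.mp (Finset.mem_coe.mp hx)).1
    · simp only [hone, Nat.add_right_cancel_iff]
  -- each box of `γ^2 \ γ^1` with subscript `c + 1` uses up a box of `γ^1 \ γ^0` in row `c + 1`
  set j : ℕ → ℕ := fun c => one c - ∑ a ∈ Finset.range N, n a c with hj
  have hj' : ∀ c, j c + ∑ a ∈ Finset.range N, n a c = one c := fun c =>
    Nat.sub_add_cancel (hsum1 c)
  have hkle : ∀ c, (γ 2).rowLen (c + 1) ≤ (γ 0).rowLen c + n (c + 1) c :=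
    rowLen_succ_le_add_card T.isLR hφ
  set k : ℕ → ℕ := fun c => (γ 0).rowLen c + n (c + 1) c - (γ 2).rowLen (c + 1) with hk
  have hk' : ∀ c, k c + (γ 2).rowLen (c + 1) = (γ 0).rowLen c + n (c + 1) c := fun c =>
    Nat.sub_add_cancel (hkle c)
  have hbig : ∀ a, N ≤ a → ∀ b, n a b = 0 := by
    intro a ha b
    rw [hn]
    simp only [Finset.card_eq_zero, Finset.filter_eq_empty_iff]
    rintro x hx ⟨rfl, -⟩
    have := hrowlt x hx
    omega
  have hbig' : ∀ b, N ≤ b → ∀ a, n a b = 0 := by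
    intro b hb a
    by_contra h
    have := hnlt a b h
    exact h (hbig a (by omega) b)
  -- the boxes in row `c + 2` with subscript `c + 1` give pickets, without a summand of order
  -- `p^(c+1)`
  have hcol : ∀ c, ∑ a ∈ Finset.range N, n a c =
      ∑ a ∈ Finset.range N, n a c * (if c + 1 < a then 1 else 0) + n (c + 1) c := by
    intro c
    have h1 : ∀ a, n a c = n a c * (if c + 1 < a then 1 else 0) +
        if a = c + 1 then n a c else 0 := by
      intro a
      by_cases h0 : n a c = 0
      · simp [h0]
      · have := hnlt a c h0
        split_ifs <;> omega
    rw [Finset.sum_congr rfl fun a _ => h1 a, Finset.sum_add_distrib, Finset.sum_ite_eq']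
    congr 1
    rw [ite_eq_left_iff, Finset.mem_range, not_lt]
    exact fun h => (hbig _ h c).symm
  have hjbig : ∀ c, N ≤ c → j c = 0 := by
    intro c hc
    have h1 := hj' c
    have h2 := hone' c
    have h3 := htwo' c
    have h4 := hrow0 c hc
    omega
  have hkbig : ∀ c, N ≤ c → k c = 0 := by
    intro c hc
    have h1 := hk' c
    have h2 := hone' c
    have h3 := htwo' c
    have h4 := hrow0 c hc
    have h5 := hbig (c + 1) (by omega) c
    omega
  have hrange : ∀ (f : ℕ → ℕ) (c : ℕ), (N ≤ c → f c = 0) →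
      ∑ a ∈ Finset.range N, f a * (if a = c then 1 else 0) = f c := by
    intro f c hf
    simp only [mul_ite, mul_one, mul_zero, Finset.sum_ite_eq', Finset.mem_range]
    rw [ite_eq_left_iff, not_lt]
    exact fun h => (hf h).symm
  have hrange2 : ∀ (f : ℕ → ℕ → ℕ) (c : ℕ), (N ≤ c → ∀ b, f c b = 0) →
      ∑ a ∈ Finset.range N, ∑ b ∈ Finset.range N, f a b * (if a = c then 1 else 0) =
        ∑ b ∈ Finset.range N, f c b := by
    intro f c hf
    simp_rw [← Finset.sum_mul]
    exact hrange (fun a => ∑ b ∈ Finset.range N, f a b) c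
      fun h => Finset.sum_eq_zero fun b _ => hf h b
  have hrange2' : ∀ (f : ℕ → ℕ → ℕ) (c : ℕ), (N ≤ c → ∀ a, f a c = 0) →
      ∑ a ∈ Finset.range N, ∑ b ∈ Finset.range N, f a b * (if b = c then 1 else 0) =
        ∑ a ∈ Finset.range N, f a c := by
    intro f c hf
    exact Finset.sum_congr rfl fun a _ => hrange (f a) c fun h => hf h a
  obtain ⟨B, _, _, _, A, hB, hA2, hlB, hlA, hlW⟩ := exists_embedding hp N n j k hnlt
  have hγ2 : ∀ c, len (p ^ c • (⊤ : Submodule R B)) =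
      len (p ^ (c + 1) • (⊤ : Submodule R B)) + (γ 2).rowLen c := by
    intro c
    rw [hlB c]
    congr 1
    -- compare the differences of successive terms
    obtain ⟨d, hd⟩ : ∃ d, N ≤ c + d := ⟨N, Nat.le_add_left N c⟩
    induction d generalizing c with
    | zero =>
      rw [hrow0 c hd]
      have h1 : ∀ a ∈ Finset.range N, (if c ≤ a then 1 else 0) = 0 := fun a ha => by
        have := Finset.mem_range.mp ha
        exact if_neg (by omega)
      rw [add_eq_zero, add_eq_zero]
      refine ⟨Finset.sum_eq_zero fun a ha => Finset.sum_eq_zero fun b hb => ?_,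
        Finset.sum_eq_zero fun a ha => by rw [h1 a ha, mul_zero],
        Finset.sum_eq_zero fun a ha => by rw [h1 a ha, mul_zero]⟩
      rw [h1 a ha, if_neg (fun h => by have := Finset.mem_range.mp hb; omega), add_zero, mul_zero]
    | succ d ih =>
      have h1 := ih (c + 1) (by omega)
      have hstep : ∀ a b : ℕ, (if b + 1 < a ∧ c ≤ b then 1 else 0) =
          (if b + 1 < a ∧ c + 1 ≤ b then 1 else 0) +
            (if b + 1 < a then 1 else 0) * (if b = c then 1 else 0) := by
        intro a b
        split_ifs <;> omega
      simp only [ite_le_eq_add c, hstep, mul_add, Finset.sum_add_distrib, ← mul_assoc] at h1 ⊢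
      rw [hrange2 n c (fun h => hbig c h), hrange j c (hjbig c), hrange k c (hkbig c),
        hrange2' (fun a b => n a b * if b + 1 < a then 1 else 0) c
          (fun h a => by rw [hbig' c h, zero_mul]), hsum2]
      have h2 := hcol c
      have h3 := hj' c
      have h4 := hk' c
      have h5 := hone' c
      have h6 := htwo' c
      omega
  have hAc : ∀ c, len (A ⊓ p ^ c • (⊤ : Submodule R B)) =
      len (A ⊓ p ^ (c + 1) • (⊤ : Submodule R B)) + (one c + two c) := by
    intro c
    rw [hlA c, hlA (c + 1)]
    simp only [ite_le_eq_add c, mul_add, Finset.sum_add_distrib]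
    rw [hrange2 n c (fun h => hbig c h), hrange j c (hjbig c),
      hrange2' n c (fun h a => hbig' c h a), hsum2]
    have h3 := hj' c
    omega
  have hWc : ∀ r c, len (smulInf p A r ⊓ p ^ c • (⊤ : Submodule R B)) =
      len (smulInf p A r ⊓ p ^ (c + 1) • (⊤ : Submodule R B)) +
        ((strip γ 2).filter fun x => x.1 = c ∧ r < φ x).card := by
    intro r c
    rw [hlW r c, hlW r (c + 1)]
    have hstep : ∀ a b : ℕ, (if r ≤ b ∧ c ≤ a then 1 else 0) =
        (if r ≤ b ∧ c + 1 ≤ a then 1 else 0) +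
          (if r ≤ b then 1 else 0) * (if a = c then 1 else 0) := by
      intro a b
      split_ifs <;> omega
    simp only [hstep, mul_add, Finset.sum_add_distrib, ← mul_assoc]
    rw [hrange2 (fun a b => n a b * if r ≤ b then 1 else 0) c
      (fun h b => by rw [hbig c h, zero_mul]), hsumr]
  refine ⟨B, inferInstance, inferInstance, inferInstance, A, hB, ?_⟩
  rw [isKleinTableauOf_iff hp hB hT, ← hγdef, ← hφdef]
  have hW0 : smulInf p A 0 = p • A := by rw [smulInf, pow_zero, one_smul, inf_top_eq]
  refine ⟨hA2, ?_, ?_, ?_, ?_⟩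
  · refine hasType_quotient_of_len_inf hp hB hγ2 hAc fun c => ?_
    have h5 := hone' c
    have h6 := htwo' c
    omega
  · rw [← hW0]
    refine hasType_quotient_of_len_inf hp hB hγ2 (hWc 0) fun c => ?_
    have h6 := htwo' c
    have h7 := hsumr 0 c
    simp only [Nat.zero_le, if_true, mul_one] at h7
    rw [← h7, hsum2]
    omega
  · rw [hA2]
    refine hasType_quotient_of_len_inf hp hB hγ2 (f := fun _ => 0) (fun c => ?_) fun c => rfl
    simp [len_bot]
  · choose g hg using fun r =>
      exists_hasType hp (exists_pow_smul_quotient hB (kleinSubmodule p A 2 r))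
    have hgr : ∀ r c, (g r).rowLen c +
        ((strip γ 2).filter fun x => x.1 = c ∧ r < φ x).card = (γ 2).rowLen c := by
      intro r c
      have h0 := hg r
      rw [kleinSubmodule_two hA2] at h0
      have h1 := (hasType_iff hp (exists_pow_smul_quotient hB _)).mp h0 c
      have h2 := len_inf_pow_smul_top (smulInf p A r) (p ^ c)
      have h3 := len_inf_pow_smul_top (smulInf p A r) (p ^ (c + 1))
      have h4 := hγ2 c
      have h5 := hWc r c
      omega
    refine ⟨g, hg, ?_⟩
    rintro r hr ⟨c, d⟩ hb
    rw [Finset.mem_sdiff, YoungDiagram.mem_cells, YoungDiagram.mem_cells,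
      YoungDiagram.mem_iff_lt_rowLen, YoungDiagram.mem_iff_lt_rowLen] at hb
    have hmem : (c, d) ∈ γ 2 := by
      rw [YoungDiagram.mem_iff_lt_rowLen]
      have := hgr r c
      omega
    rw [hφ.lt_rowLen_sub_iff r hmem (hgr r c), hφ.lt_rowLen_sub_iff (r - 1) hmem (hgr (r - 1) c),
      not_not] at hb
    have h1 : ¬ r < φ (c, d) := fun h => hb.1 ⟨hb.2.1, h⟩
    have h2 := hb.2.2
    omega

end Existence

/-! ### The category of short exact sequences -/

section SequenceCategory

variable {R : Type u} [CommRing R] {p : R}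

/-- The image of `A` in `B` for a sequence `0 → A → B → C → 0`. -/
def seqRange (E : SeqCat p) : Submodule R E.obj.X₂ := LinearMap.range E.obj.f.hom

theorem seqRange_eq_ker (E : SeqCat p) : seqRange E = LinearMap.ker E.obj.g.hom :=
  E.property.1.exact.moduleCat_range_eq_ker

/-- A morphism of sequences is determined by its middle component. -/
theorem seqHom_ext {E E' : SeqCat p} {f g : E ⟶ E'} (h : f.hom.τ₂ = g.hom.τ₂) : f = g := by
  have := E'.property.1.mono_f
  have := E.property.1.epi_g
  refine ObjectProperty.hom_ext _ (ShortComplex.hom_ext _ _ ?_ h ?_)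
  · rw [← cancel_mono E'.obj.f, f.hom.comm₁₂, g.hom.comm₁₂, h]
  · rw [← cancel_epi E.obj.g, ← f.hom.comm₂₃, ← g.hom.comm₂₃, h]

/-- A linear map between the middle terms which respects the submodules extends to a morphism. -/
theorem exists_seqHom {E E' : SeqCat p} (φ : E.obj.X₂ →ₗ[R] E'.obj.X₂)
    (h : (seqRange E).map φ ≤ seqRange E') : ∃ f : E ⟶ E', f.hom.τ₂ = ModuleCat.ofHom φ := by
  have hE := E.property.1
  have hE' := E'.property.1
  have := hE'.mono_f
  have := hE.epi_g
  have hzero : E.obj.f ≫ ModuleCat.ofHom φ ≫ E'.obj.g = 0 := by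
    ext x
    have h1 : φ (E.obj.f.hom x) ∈ seqRange E' := h ⟨_, ⟨x, rfl⟩, rfl⟩
    rw [seqRange_eq_ker] at h1
    exact h1
  obtain ⟨τ₁, h₁⟩ := Limits.KernelFork.IsLimit.lift' hE'.fIsKernel (E.obj.f ≫ ModuleCat.ofHom φ)
    (by rw [Category.assoc, hzero])
  obtain ⟨τ₃, h₃⟩ := Limits.CokernelCofork.IsColimit.desc' hE.gIsCokernel
    (ModuleCat.ofHom φ ≫ E'.obj.g) hzero
  exact ⟨ObjectProperty.homMk ⟨τ₁, ModuleCat.ofHom φ, τ₃, h₁, h₃.symm⟩, rfl⟩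

theorem map_seqRange_le {E E' : SeqCat p} (f : E ⟶ E') :
    (seqRange E).map f.hom.τ₂.hom ≤ seqRange E' := by
  rintro _ ⟨_, ⟨x, rfl⟩, rfl⟩
  refine ⟨f.hom.τ₁.hom x, ?_⟩
  have := congrArg (fun g => g.hom x) f.hom.comm₁₂
  exact this

theorem nonempty_seqIso {E E' : SeqCat p} (e : E.obj.X₂ ≃ₗ[R] E'.obj.X₂)
    (h : (seqRange E).map (e : E.obj.X₂ →ₗ[R] E'.obj.X₂) = seqRange E') : Nonempty (E ≅ E') := by
  obtain ⟨f, hf⟩ := exists_seqHom (e : E.obj.X₂ →ₗ[R] E'.obj.X₂) h.le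
  obtain ⟨g, hg⟩ := exists_seqHom (e.symm : E'.obj.X₂ →ₗ[R] E.obj.X₂) (by
    rw [← h, ← Submodule.map_comp]
    simp)
  refine ⟨⟨f, g, seqHom_ext ?_, seqHom_ext ?_⟩⟩
  · change f.hom.τ₂ ≫ g.hom.τ₂ = 𝟙 _
    rw [hf, hg]
    ext x
    simp
  · change g.hom.τ₂ ≫ f.hom.τ₂ = 𝟙 _
    rw [hf, hg]
    ext x
    simp

/-- The automorphism group of a sequence is the stabilizer of the submodule `A` in the automorphism
group of `B`. -/
theorem card_aut_eq (E : SeqCat p) : Nat.card (Aut E) =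
    Nat.card {e : E.obj.X₂ ≃ₗ[R] E.obj.X₂ //
      (seqRange E).map (e : E.obj.X₂ →ₗ[R] E.obj.X₂) = seqRange E} := by
  have hinv : ∀ f g : E ⟶ E, f ≫ g = 𝟙 E → ∀ x, g.hom.τ₂.hom (f.hom.τ₂.hom x) = x :=
    fun f g h x => by
      have := congrArg (fun k : E ⟶ E => k.hom.τ₂.hom x) h
      exact this
  let F : Aut E → (E.obj.X₂ ≃ₗ[R] E.obj.X₂) := fun f =>
    LinearEquiv.ofLinearMap f.hom.hom.τ₂.hom f.inv.hom.τ₂.hom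
      (LinearMap.ext (hinv _ _ f.inv_hom_id)) (LinearMap.ext (hinv _ _ f.hom_inv_id))
  have hF : ∀ f, (seqRange E).map (F f : E.obj.X₂ →ₗ[R] E.obj.X₂) = seqRange E := by
    intro f
    refine le_antisymm (map_seqRange_le f.hom) fun x hx => ?_
    exact ⟨f.inv.hom.τ₂.hom x, map_seqRange_le f.inv ⟨x, hx, rfl⟩, hinv _ _ f.inv_hom_id x⟩
  refine Nat.card_congr (Equiv.ofBijective (fun f => ⟨F f, hF f⟩) ⟨?_, ?_⟩)
  · intro f g hfg
    refine Aut.ext (seqHom_ext ?_)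
    ext x
    exact congrArg (fun e => e.1 x) hfg
  · rintro ⟨e, he⟩
    obtain ⟨f, hf⟩ := exists_seqHom (e : E.obj.X₂ →ₗ[R] E.obj.X₂) he.le
    obtain ⟨g, hg⟩ := exists_seqHom (E := E) (E' := E) (e.symm : E.obj.X₂ →ₗ[R] E.obj.X₂) (by
      conv_lhs => rw [← he]
      rw [← Submodule.map_comp]
      simp)
    refine ⟨⟨f, g, seqHom_ext ?_, seqHom_ext ?_⟩, Subtype.ext (LinearEquiv.ext fun x => ?_)⟩
    · change f.hom.τ₂ ≫ g.hom.τ₂ = 𝟙 _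
      rw [hf, hg]
      ext x
      simp
    · change g.hom.τ₂ ≫ f.hom.τ₂ = 𝟙 _
      rw [hf, hg]
      ext x
      simp
    · change f.hom.τ₂.hom x = _
      rw [hf]
      rfl

theorem isPModule_of_finite {M : Type u} [AddCommGroup M] [Module R M] [Finite M]
    (hM : ∃ n : ℕ, ∀ x : M, p ^ n • x = 0) : IsPModule p M :=
  ⟨isFiniteLength_iff_isNoetherian_isArtinian.mpr ⟨inferInstance, inferInstance⟩, hM⟩

/-- An embedding of a submodule `A` in a finite `p`-module `B` as an object of `𝒮`. -/
theorem exists_seqCat {B : Type u} [AddCommGroup B] [Module R B] [Finite B]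
    (hB : ∃ n : ℕ, ∀ x : B, p ^ n • x = 0) (A : Submodule R B) {T : KleinTableau}
    (hT : IsKleinTableauOf p A T) : ∃ E : SeqCat p, HasKleinTableau p E T := by
  have hA : ∃ n : ℕ, ∀ x : A, p ^ n • x = 0 := by
    obtain ⟨n, hn⟩ := hB
    exact ⟨n, fun x => Subtype.ext (hn x)⟩
  have hex : Function.Exact A.subtype A.mkQ := by
    rw [LinearMap.exact_iff, Submodule.ker_mkQ, Submodule.range_subtype]
  refine ⟨⟨ShortComplex.mk (ModuleCat.ofHom A.subtype) (ModuleCat.ofHom A.mkQ)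
    (ModuleCat.hom_ext hex.linearMap_comp_eq_zero), ?_, isPModule_of_finite hA,
    isPModule_of_finite hB, isPModule_of_finite (exists_pow_smul_quotient hB A)⟩, ?_⟩
  · exact ModuleCat.shortComplex_shortExact _ hex A.subtype_injective A.mkQ_surjective
  · rw [hasKleinTableau_iff]
    change IsKleinTableauOf p (LinearMap.range A.subtype) T
    rwa [Submodule.range_subtype]

variable [IsDomain R] [IsPrincipalIdealRing R] [Finite (R ⧸ Ideal.span {p})]

theorem IsPModule.finite (hp : Prime p) {M : Type u} [AddCommGroup M] [Module R M]
    (hM : IsPModule p M) : Finite M := by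
  obtain ⟨h, n, hn⟩ := hM
  have := (isFiniteLength_iff_isNoetherian_isArtinian.mp h).1
  obtain ⟨d, k, ⟨e⟩⟩ := Module.torsion_by_prime_power_decomposition (R := R) (M := M) hp.irreducible
    (fun {x} => ⟨⟨p ^ n, n, rfl⟩, hn x⟩)
  have := fun n => finite_quotient_pow (p := p) n
  exact Finite.of_equiv _ (e.trans (DirectSum.linearEquivFunOnFintype R (Fin d) _)).symm.toEquiv

end SequenceCategory

/-! ### Segments of Klein tableaux under isomorphisms and quotients -/

section Segments

variable {R : Type u} [CommRing R] {B : Type u} [AddCommGroup B] [Module R B] {p : R}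
  {A : Submodule R B}

theorem kleinSubmodule_map_equiv {B' : Type u} [AddCommGroup B'] [Module R B'] (e : B ≃ₗ[R] B')
    (ℓ r : ℕ) : (kleinSubmodule p A ℓ r).map (e : B →ₗ[R] B') =
      kleinSubmodule p (A.map (e : B →ₗ[R] B')) ℓ r := by
  rw [kleinSubmodule, Submodule.map_sup, map_smul_submodule, map_smul_submodule,
    Submodule.map_inf _ e.injective, map_smul_submodule, map_smul_submodule, Submodule.map_top,
    LinearEquiv.range]
  rfl

theorem IsKleinTableauOf.map {B' : Type u} [AddCommGroup B'] [Module R B'] {T : KleinTableau}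
    (h : IsKleinTableauOf p A T) (e : B ≃ₗ[R] B') :
    IsKleinTableauOf p (A.map (e : B →ₗ[R] B')) T := by
  refine ⟨fun ℓ => ?_, fun ℓ hℓ => ?_⟩
  · exact (h.shape ℓ).congr (Submodule.Quotient.equiv _ _ e (map_smul_submodule _ _ _))
  · obtain ⟨g, hg, hφ⟩ := h.subscript ℓ hℓ
    exact ⟨g, fun r => (hg r).congr
      (Submodule.Quotient.equiv _ _ e (kleinSubmodule_map_equiv e ℓ r)), hφ⟩

theorem HasSegment.pow_smul {T : KleinTableau} {k j u : ℕ} (h : HasSegment p A T k (j + u)) :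
    HasSegment p (p ^ j • A) T (k + j) u := by
  refine ⟨?_, fun i hi => ?_, fun i hi hi' => ?_⟩
  · rw [smul_smul, ← pow_add, add_comm, h.smul_eq_bot]
  · rw [smul_smul, ← pow_add, add_comm i j, add_assoc]
    exact h.shape (j + i) (by omega)
  · obtain ⟨g, hg, hφ⟩ := h.subscript (j + i) (by omega) (by omega)
    refine ⟨g, fun r => ?_, by rwa [add_assoc]⟩
    have := hg r
    rwa [kleinSubmodule_eq_two A (by omega), show j + i - 2 = i - 2 + j by omega, pow_add,
      mul_smul, ← kleinSubmodule_eq_two _ hi] at this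

variable {D U : Submodule R B}

theorem hasType_map_mkQ_iff (h : D ≤ U) {μ : YoungDiagram} :
    HasType p ((B ⧸ D) ⧸ U.map D.mkQ) μ ↔ HasType p (B ⧸ U) μ :=
  ⟨fun h' => h'.congr (Submodule.quotientQuotientEquivQuotient D U h),
    fun h' => h'.congr (Submodule.quotientQuotientEquivQuotient D U h).symm⟩

theorem kleinSubmodule_map_mkQ {ℓ : ℕ} (h : D ≤ p ^ (ℓ - 2) • U) (r : ℕ) :
    kleinSubmodule p (U.map D.mkQ) ℓ r = (kleinSubmodule p U ℓ r).map D.mkQ := by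
  rw [kleinSubmodule, kleinSubmodule, Submodule.map_sup, map_smul_submodule, map_smul_submodule]
  congr 2
  apply le_antisymm
  · rintro _ ⟨hx, hy⟩
    rw [SetLike.mem_coe, ← map_smul_submodule] at hx
    obtain ⟨x, hx, rfl⟩ := hx
    obtain ⟨z, hz⟩ := mem_smul_top.mp hy
    obtain ⟨z, rfl⟩ := D.mkQ_surjective z
    rw [← map_smul] at hz
    -- `x` and `p^r z` differ by an element of `D`, which lies in `p^(ℓ-2) U`
    have h1 : p ^ r • z - x ∈ D := by
      rw [← Submodule.Quotient.mk_eq_zero, Submodule.Quotient.mk_sub, sub_eq_zero]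
      exact hz
    refine ⟨p ^ r • z, ⟨?_, mem_smul_top.mpr ⟨z, rfl⟩⟩, hz⟩
    have := Submodule.add_mem _ (h h1) hx
    rwa [sub_add_cancel] at this
  · refine (Submodule.map_inf_le _).trans ?_
    rw [map_smul_submodule, map_smul_submodule, Submodule.map_top]
    exact inf_le_inf_left _ (smul_mono_right _ le_top)

theorem hasSubscripts_map_mkQ_iff {ℓ : ℕ} (h : D ≤ p ^ ℓ • U) {φ : ℕ × ℕ → ℕ} :
    HasSubscripts p (U.map D.mkQ) ℓ φ ↔ HasSubscripts p U ℓ φ := by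
  refine exists_congr fun g => and_congr_left fun _ => forall_congr' fun r => ?_
  rw [kleinSubmodule_map_mkQ (h.trans (pow_smul_le_pow_smul U (Nat.sub_le ℓ 2))),
    hasType_map_mkQ_iff (h.trans (le_kleinSubmodule U ℓ r))]

/-- Passing to the quotient by `p^u U` cuts off the last layer of the tableau. -/
theorem hasSegment_map_mkQ_iff {T : KleinTableau} {k u : ℕ} (h : p ^ u • U = D) :
    HasSegment p (U.map D.mkQ) T k u ↔ (∀ i, i ≤ u → HasType p (B ⧸ p ^ i • U) (T.shape (k + i))) ∧
      ∀ i, 2 ≤ i → i ≤ u → HasSubscripts p U i (T.subscript (k + i)) := by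
  have hle : ∀ {i}, i ≤ u → D ≤ p ^ i • U := fun hi => h ▸ pow_smul_le_pow_smul U hi
  constructor
  · rintro ⟨-, hs, hφ⟩
    refine ⟨fun i hi => ?_, fun i hi hi' => (hasSubscripts_map_mkQ_iff (hle hi')).mp (hφ i hi hi')⟩
    have := hs i hi
    rwa [← map_smul_submodule, hasType_map_mkQ_iff (hle hi)] at this
  · rintro ⟨hs, hφ⟩
    refine ⟨?_, fun i hi => ?_,
      fun i hi hi' => (hasSubscripts_map_mkQ_iff (hle hi')).mpr (hφ i hi hi')⟩
    · rw [← map_smul_submodule, h, ← le_bot_iff, Submodule.map_le_iff_le_comap]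
      exact (Submodule.ker_mkQ D).ge
    · rw [← map_smul_submodule, hasType_map_mkQ_iff (hle hi)]
      exact hs i hi

/-- Nakayama's lemma for modules annihilated by a power of `p`. -/
theorem eq_of_sup_smul_eq {X Y : Submodule R B} (hB : ∃ n : ℕ, ∀ x : B, p ^ n • x = 0)
    (h : X ⊔ p • Y = Y) : X = Y := by
  obtain ⟨n, hn⟩ := hB
  have key : ∀ m, Y ≤ X ⊔ p ^ m • Y := by
    intro m
    induction m with
    | zero => rw [pow_zero, one_smul]; exact le_sup_right
    | succ m ih =>
      refine ih.trans (sup_le le_sup_left ?_)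
      conv_lhs => rw [← h]
      rw [Submodule.smul_sup', smul_smul, ← pow_succ]
      exact sup_le_sup_right (Submodule.smul_le_self_of_tower _ _) _
  refine le_antisymm (h ▸ le_sup_left) ((key n).trans (sup_le le_rfl ?_))
  rw [smul_eq_bot_iff.mpr fun x _ => hn x]
  exact bot_le

/-- The submodules `U` with `p^m U = A` for which the tableau is `[γ^0, …, γ^(m+2)]` correspond to
the submodules of `B / p A` with the tableau `[γ^0, …, γ^(m+1)]`. -/
theorem card_hasSegment_quotient (hB : ∃ n : ℕ, ∀ x : B, p ^ n • x = 0) {T : KleinTableau}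
    {m : ℕ} (hA : HasSegment p A T m 2) :
    Nat.card {U : Submodule R B // HasSegment p U T 0 (m + 2) ∧ p ^ m • U = A} =
      Nat.card {U : Submodule R (B ⧸ p • A) // HasSegment p U T 0 (m + 1) ∧
        p ^ m • U = A.map (p • A).mkQ} := by
  set D := p • A with hD
  have hpow : ∀ {U : Submodule R B}, p ^ m • U = A → p ^ (m + 1) • U = D := fun {U} hU => by
    rw [pow_succ', mul_smul, hU]
  have hDle : ∀ {U : Submodule R B}, p ^ m • U = A → D ≤ U := fun {U} hU =>
    (hpow hU).ge.trans (Submodule.smul_le_self_of_tower _ _)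
  refine Nat.card_congr (Equiv.ofBijective
    (fun U => ⟨U.1.map D.mkQ, (hasSegment_map_mkQ_iff (hpow U.2.2)).mpr
      ⟨fun i hi => U.2.1.shape i (by omega), fun i hi hi' => U.2.1.subscript i hi (by omega)⟩, ?_⟩)
    ⟨?_, ?_⟩)
  · rw [← map_smul_submodule, U.2.2]
  · rintro ⟨U, hU⟩ ⟨U', hU'⟩ h
    have h1 : U.map D.mkQ = U'.map D.mkQ := congrArg Subtype.val h
    have h2 := congrArg (Submodule.comap D.mkQ) h1
    rw [Submodule.comap_map_mkQ, Submodule.comap_map_mkQ, sup_eq_right.mpr (hDle hU.2),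
      sup_eq_right.mpr (hDle hU'.2)] at h2
    exact Subtype.ext h2
  · rintro ⟨V, hV, hVA⟩
    have hmap : (V.comap D.mkQ).map D.mkQ = V :=
      Submodule.map_comap_eq_of_surjective D.mkQ_surjective V
    set U := V.comap D.mkQ with hU
    have hUA : p ^ m • U = A := by
      refine eq_of_sup_smul_eq hB ?_
      have h1 := congrArg (Submodule.comap D.mkQ) hVA
      rw [← hmap, ← map_smul_submodule, Submodule.comap_map_mkQ, Submodule.comap_map_mkQ,
        sup_comm, hD, sup_eq_right.mpr (Submodule.smul_le_self_of_tower p A)] at h1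
      exact h1
    have hseg : HasSegment p (U.map D.mkQ) T 0 (m + 1) := by rwa [hmap]
    obtain ⟨hs, hφ⟩ := (hasSegment_map_mkQ_iff (hpow hUA)).mp hseg
    have hshift : ∀ i, p ^ (m + i) • U = p ^ i • A := fun i => by
      rw [add_comm, pow_add, mul_smul, hUA]
    refine ⟨⟨U, ⟨?_, fun i hi => ?_, fun i hi hi' => ?_⟩, hUA⟩, Subtype.ext hmap⟩
    · rw [hshift, hA.smul_eq_bot]
    · rcases Nat.lt_or_ge (m + 1) i with h | h
      · obtain rfl : i = m + 2 := by omega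
        rw [hshift, Nat.zero_add]
        exact hA.shape 2 le_rfl
      · exact hs i h
    · rcases Nat.lt_or_ge (m + 1) i with h | h
      · obtain rfl : i = m + 2 := by omega
        obtain ⟨g, hg, hg'⟩ := hA.subscript 2 le_rfl le_rfl
        refine ⟨g, fun r => ?_, by rwa [Nat.zero_add]⟩
        rw [kleinSubmodule_eq_two U hi, Nat.add_sub_cancel, hUA]
        exact hg r
      · exact hφ i hi h

end Segments

/-! ### Counting by group actions -/

section Actions

/-- For an equivariant map `f`, the elements of the orbit of `a` over `f a` are counted by the
stabilizers. -/
theorem card_fiber_mul_card_stabilizer {G α β : Type*} [Group G] [MulAction G α] [MulAction G β]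
    (f : α → β) (hf : ∀ (g : G) a, f (g • a) = g • f a) (a : α) :
    Nat.card {x // x ∈ MulAction.orbit G a ∧ f x = f a} * Nat.card (MulAction.stabilizer G a) =
      Nat.card (MulAction.stabilizer G (f a)) := by
  rw [← Nat.card_congr (MulAction.orbitProdStabilizerEquivGroup (MulAction.stabilizer G (f a)) a),
    Nat.card_prod]
  congr 1
  · refine Nat.card_congr (Equiv.subtypeEquivRight fun x => ?_)
    constructor
    · rintro ⟨⟨g, rfl⟩, hg⟩
      exact ⟨⟨g, by rw [MulAction.mem_stabilizer_iff, ← hf]; exact hg⟩, rfl⟩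
    · rintro ⟨g, rfl⟩
      exact ⟨⟨g, rfl⟩, (hf g a).trans g.2⟩
  · refine Nat.card_congr ⟨fun g => ⟨⟨g.1, ?_⟩, g.2⟩, fun g => ⟨g.1.1, g.2⟩, fun _ => rfl,
      fun _ => rfl⟩
    rw [MulAction.mem_stabilizer_iff, ← hf, MulAction.mem_stabilizer_iff.mp g.2]

end Actions

/-! ### Counting submodules with a given Klein tableau -/

section Counting

variable {R : Type u} [CommRing R] {p : R}

theorem SeqCat.exists_pow_smul (E : SeqCat p) : ∃ n : ℕ, ∀ x : E.obj.X₂, p ^ n • x = 0 :=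
  E.property.2.2.1.2

variable [IsDomain R] [IsPrincipalIdealRing R] [Finite (R ⧸ Ideal.span {p})]

theorem SeqCat.finite (hp : Prime p) (E : SeqCat p) : Finite E.obj.X₂ :=
  E.property.2.2.1.finite hp

theorem card_aut_eq_card_stabilizer (hp : Prime p) {T : KleinTableau} (hT : T.EntriesAtMost 2)
    {E : SeqCat p} (hE : HasKleinTableau p E T) {C : Type u} [AddCommGroup C] [Module R C]
    [Finite C] (hC : ∃ n : ℕ, ∀ x : C, p ^ n • x = 0) {A : Submodule R C}
    (hA : IsKleinTableauOf p A T) :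
    Nat.card (Aut E) = Nat.card (MulAction.stabilizer (C ≃ₗ[R] C) A) := by
  have := SeqCat.finite hp E
  obtain ⟨e, he⟩ := IsKleinTableauOf.exists_equiv hp (SeqCat.exists_pow_smul E) hC hT
    (hasKleinTableau_iff.mp hE) hA
  change (seqRange E).map _ = A at he
  rw [card_aut_eq]
  refine Nat.card_congr (Equiv.subtypeEquiv ⟨fun g => (e.symm.trans g).trans e,
    fun g => (e.trans g).trans e.symm, fun g => by ext; simp, fun g => by ext; simp⟩ fun g => ?_)
  change _ ↔ A.map (((e.symm.trans g).trans e : C ≃ₗ[R] C) : C →ₗ[R] C) = A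
  rw [LinearEquiv.coe_trans, LinearEquiv.coe_trans, Submodule.map_comp, Submodule.map_comp]
  have h1 : A.map (e.symm : C →ₗ[R] E.obj.X₂) = seqRange E := by
    rw [← he, ← Submodule.map_comp]
    simp
  rw [h1]
  constructor
  · intro h
    rw [h, he]
  · intro h
    refine Submodule.map_injective_of_injective (f := (e : E.obj.X₂ →ₗ[R] C)) e.injective ?_
    rw [h, he]

theorem card_aut_pos (hp : Prime p) (E : SeqCat p) : 0 < Nat.card (Aut E) := by
  have := SeqCat.finite hp E
  have : Finite (E.obj.X₂ ≃ₗ[R] E.obj.X₂) := DFunLike.finite _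
  rw [card_aut_eq]
  have : Nonempty {e : E.obj.X₂ ≃ₗ[R] E.obj.X₂ //
      (seqRange E).map (e : E.obj.X₂ →ₗ[R] E.obj.X₂) = seqRange E} :=
    ⟨⟨LinearEquiv.refl R _, by simp⟩⟩
  exact Nat.card_pos

/-- The submodules `A` of `C` with tableau `[γ^k, γ^(k+1), γ^(k+2); φ^(k+2)]` and with given `p A`
form one orbit under the stabilizer of `p A`. -/
theorem card_smul_eq_mul_card_aut (hp : Prime p) {T : KleinTableau} {k : ℕ} {E₁ E₂ : SeqCat p}
    (hE₁ : HasKleinTableau p E₁ (T.restrict 1 (k + 2)))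
    (hE₂ : HasKleinTableau p E₂ (T.restrict 2 (k + 2))) {C : Type u} [AddCommGroup C] [Module R C]
    [Finite C] (hC : ∃ n : ℕ, ∀ x : C, p ^ n • x = 0) {D : Submodule R C}
    (hD : HasSegment p D T (k + 1) 1) :
    Nat.card {A : Submodule R C // HasSegment p A T k 2 ∧ p • A = D} * Nat.card (Aut E₂) =
      Nat.card (Aut E₁) := by
  have := SeqCat.finite hp E₂
  have hT₁ : (T.restrict 1 (k + 2)).EntriesAtMost 2 := T.entriesAtMost_restrict (by norm_num) _
  have hT₂ : (T.restrict 2 (k + 2)).EntriesAtMost 2 := T.entriesAtMost_restrict le_rfl _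
  have hD' : IsKleinTableauOf p D (T.restrict 1 (k + 2)) :=
    (isKleinTableauOf_restrict_iff hp hC (k := k + 1)).mpr hD
  have hE₂' := hasKleinTableau_iff.mp hE₂
  -- carry over the submodule of `E₂` to `C` such that multiplication by `p` yields `D`
  obtain ⟨e, he⟩ : ∃ e : E₂.obj.X₂ ≃ₗ[R] C,
      (p • seqRange E₂).map (e : E₂.obj.X₂ →ₗ[R] C) = D := by
    refine IsKleinTableauOf.exists_equiv hp (SeqCat.exists_pow_smul E₂) hC hT₁ ?_ hD'
    have h1 := (isKleinTableauOf_restrict_iff hp (SeqCat.exists_pow_smul E₂)).mp hE₂'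
    have h2 := HasSegment.pow_smul (j := 1) (u := 1) h1
    rw [pow_one] at h2
    exact (isKleinTableauOf_restrict_iff hp (SeqCat.exists_pow_smul E₂) (k := k + 1)).mpr h2
  obtain ⟨A, hA, rfl⟩ : ∃ A : Submodule R C, IsKleinTableauOf p A (T.restrict 2 (k + 2)) ∧
      p • A = D :=
    ⟨_, IsKleinTableauOf.map hE₂' e, by rw [← he, map_smul_submodule]; rfl⟩
  rw [card_aut_eq_card_stabilizer hp hT₁ hE₁ hC hD', card_aut_eq_card_stabilizer hp hT₂ hE₂ hC hA,
    ← card_fiber_mul_card_stabilizer (G := C ≃ₗ[R] C) (fun A : Submodule R C => p • A)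
      (fun g X => (map_smul_submodule (g : C →ₗ[R] C) p X).symm) A]
  congr 1
  refine Nat.card_congr (Equiv.subtypeEquivRight fun X => and_congr_left fun _ => ?_)
  rw [← isKleinTableauOf_restrict_iff hp hC]
  constructor
  · intro hX
    obtain ⟨g, hg⟩ := IsKleinTableauOf.exists_equiv hp hC hC hT₂ hA hX
    exact ⟨g, hg⟩
  · rintro ⟨g, rfl⟩
    exact hA.map g

theorem card_eq_mul_of_card_fiber {X Y : Type*} [Finite X] [Finite Y] (f : X → Y) (n : ℕ)
    (h : ∀ y, Nat.card {x // f x = y} = n) : Nat.card X = Nat.card Y * n := by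
  have := Fintype.ofFinite Y
  rw [← Nat.card_congr (Equiv.sigmaFiberEquiv f), Nat.card_sigma, Finset.sum_congr rfl fun y _ => h y,
    Finset.sum_const, smul_eq_mul, Finset.card_univ, Nat.card_eq_fintype_card]

/-- The number of submodules `U` with tableau `[γ^0, …, γ^(m+1); φ^2, …, φ^(m+1)]` and with given
`p^m U`. -/
theorem card_hasSegment (hp : Prime p) {E : KleinTableau → SeqCat p}
    (hE : ∀ T : KleinTableau, T.EntriesAtMost 2 → HasKleinTableau p (E T) T) (T : KleinTableau)
    (m : ℕ) : ∀ (C : Type u) [AddCommGroup C] [Module R C] [Finite C]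
      (_ : ∃ n : ℕ, ∀ x : C, p ^ n • x = 0) (D : Submodule R C) (_ : HasSegment p D T m 1),
      (Nat.card {U : Submodule R C // HasSegment p U T 0 (m + 1) ∧ p ^ m • U = D} : ℚ) =
        ∏ ℓ ∈ Finset.Icc 2 (m + 1), (Nat.card (Aut (E (T.restrict 1 ℓ))) : ℚ) /
          (Nat.card (Aut (E (T.restrict 2 ℓ))) : ℚ) := by
  induction m with
  | zero =>
    intro C _ _ _ hC D hD
    have : Unique {U : Submodule R C // HasSegment p U T 0 (0 + 1) ∧ p ^ 0 • U = D} :=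
      { default := ⟨D, hD, by rw [pow_zero, one_smul]⟩
        uniq := fun ⟨U, _, hU⟩ => Subtype.ext (by rwa [pow_zero, one_smul] at hU) }
    rw [Nat.card_unique]
    simp
  | succ m ih =>
    intro C _ _ _ hC D hD
    have hfiber := card_smul_eq_mul_card_aut hp
      (hE _ (T.entriesAtMost_restrict (by norm_num) (m + 2)))
      (hE _ (T.entriesAtMost_restrict le_rfl (m + 2))) hC hD
    set P : ℚ := ∏ ℓ ∈ Finset.Icc 2 (m + 1), (Nat.card (Aut (E (T.restrict 1 ℓ))) : ℚ) /
      (Nat.card (Aut (E (T.restrict 2 ℓ))) : ℚ) with hP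
    -- the map `U ↦ p^m U`
    let f : {U : Submodule R C // HasSegment p U T 0 (m + 1 + 1) ∧ p ^ (m + 1) • U = D} →
        {A : Submodule R C // HasSegment p A T m 2 ∧ p • A = D} := fun U =>
      ⟨p ^ m • U.1, by simpa using HasSegment.pow_smul (j := m) (u := 2) U.2.1, by
        rw [smul_smul, ← pow_succ', U.2.2]⟩
    have hf : ∀ A, (Nat.card {U // f U = A} : ℚ) = P := by
      rintro ⟨A, hA, rfl⟩
      have hquot : HasSegment p (A.map (p • A).mkQ) T m 1 :=
        (hasSegment_map_mkQ_iff (by rw [pow_one])).mpr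
          ⟨fun i hi => hA.shape i (by omega), fun i hi hi' => by omega⟩
      rw [← ih (C ⧸ p • A) (exists_pow_smul_quotient hC _) _ hquot,
        ← card_hasSegment_quotient hC hA, Nat.cast_inj]
      refine Nat.card_congr ⟨fun U => ⟨U.1.1, U.1.2.1, congrArg Subtype.val U.2⟩,
        fun U => ⟨⟨U.1, U.2.1, ?_⟩, Subtype.ext U.2.2⟩, fun _ => rfl, fun _ => rfl⟩
      rw [pow_succ', mul_smul, U.2.2]
    rw [Finset.prod_Icc_succ_top (by omega), ← hP]
    have hpos := card_aut_pos hp (E (T.restrict 2 (m + 2)))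
    have hpos' := card_aut_pos hp (E (T.restrict 1 (m + 2)))
    have hne : Nonempty {A : Submodule R C // HasSegment p A T m 2 ∧ p • A = D} := by
      rw [← hfiber] at hpos'
      exact (Nat.card_pos_iff.mp (Nat.pos_of_mul_pos_right hpos')).1
    rw [card_eq_mul_of_card_fiber f (Nat.card {U // f U = hne.some}) fun A => by
      rw [← Nat.cast_inj (R := ℚ), hf, hf], Nat.cast_mul, hf, mul_comm]
    congr 1
    rw [eq_div_iff (by exact_mod_cast hpos.ne'), ← Nat.cast_mul, hfiber]

end Counting

/-! ### Hall numbers -/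

section Hall

variable {R : Type u} [CommRing R] {p : R} {C : Type u} [AddCommGroup C] [Module R C] [Finite C]

theorem len_smul_top_submodule (U : Submodule R C) (a : R) :
    len (a • (⊤ : Submodule R U)) = len (a • U) := by
  rw [← len_map_of_injective U.subtype_injective, map_smul_submodule,
    Submodule.map_top, Submodule.range_subtype]

variable [IsDomain R] [IsPrincipalIdealRing R] [Finite (R ⧸ Ideal.span {p})]

/-- The type of the tableau of `U ⊆ C` consists of the types of `U`, `C` and `C / U`. -/
theorem IsKleinTableauOf.isOfType_iff (hp : Prime p) (hC : ∃ n : ℕ, ∀ x : C, p ^ n • x = 0)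
    {T : KleinTableau} {U : Submodule R C} (h : IsKleinTableauOf p U T) {α β γ : YoungDiagram}
    (hβ : HasType p C β) : T.IsOfType α β γ ↔ HasType p U α ∧ HasType p (C ⧸ U) γ := by
  have hU : ∃ n : ℕ, ∀ x : U, p ^ n • x = 0 := by
    obtain ⟨n, hn⟩ := hC
    exact ⟨n, fun x => Subtype.ext (hn x)⟩
  have h0 : HasType p (C ⧸ U) (T.shape 0) := by
    have := h.shape 0
    rwa [pow_zero, one_smul] at this
  have hstrip : ∀ i, (strip T.shape (i + 1)).card + len (p ^ (i + 1) • U) = len (p ^ i • U) :=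
    fun i => card_sdiff_of_le hp hC (h.shape (i + 1)) (h.shape i)
      (pow_smul_le_pow_smul U (Nat.le_succ i))
  have hα : HasType p U α ↔ ∀ ℓ, 1 ≤ ℓ → α.rowLen (ℓ - 1) = (strip T.shape ℓ).card := by
    rw [hasType_iff hp hU]
    simp_rw [len_smul_top_submodule]
    constructor
    · intro hi ℓ hℓ
      obtain ⟨i, rfl⟩ : ∃ i, ℓ = i + 1 := ⟨ℓ - 1, by omega⟩
      have h1 := hi i
      have h2 := hstrip i
      rw [Nat.add_sub_cancel]
      omega
    · intro hi i
      have h1 := hi (i + 1) (Nat.le_add_left 1 i)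
      have h2 := hstrip i
      rw [Nat.add_sub_cancel] at h1
      omega
  constructor
  · rintro ⟨h1, -, rfl⟩
    exact ⟨hα.mpr h1, h0⟩
  · rintro ⟨h1, h2⟩
    refine ⟨hα.mp h1, ?_, h0.unique hp h2⟩
    have h3 : p ^ α.colLen 0 • U = ⊥ := smul_eq_bot_iff.mpr fun x hx =>
      congrArg Subtype.val (h1.pow_smul_eq_zero ⟨x, hx⟩)
    have h4 := h.shape (α.colLen 0)
    rw [h3] at h4
    exact h4.unique hp (hβ.congr (Submodule.quotEquivOfEqBot ⊥ rfl).symm)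

theorem KleinTableau.IsOfType.entriesAtMost {T : KleinTableau} {α β γ : YoungDiagram}
    (h : T.IsOfType α β γ) : T.EntriesAtMost (α.colLen 0) := by
  intro ℓ hℓ
  induction ℓ, hℓ using Nat.le_induction with
  | base => rfl
  | succ ℓ hℓ ih =>
    rw [← ih]
    have h1 := h.card_strip (ℓ + 1) (Nat.le_add_left 1 ℓ)
    have h2 : α.rowLen ℓ = 0 := by
      by_contra h3
      have h4 : (ℓ, 0) ∈ α := YoungDiagram.mem_iff_lt_rowLen.mpr (Nat.pos_of_ne_zero h3)
      have := YoungDiagram.mem_iff_lt_colLen.mp h4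
      omega
    rw [Nat.add_sub_cancel, h2, eq_comm, Finset.card_eq_zero, strip, Finset.sdiff_eq_empty_iff_subset,
      Nat.add_sub_cancel] at h1
    exact le_antisymm (YoungDiagram.cells_subset_iff.mp h1) (T.isLR.monotone (Nat.le_succ ℓ))

/-- The number of submodules of `M(β)` with a given Klein tableau of type `(α, β, γ)`. -/
theorem card_isKleinTableauOf (hp : Prime p) {E : KleinTableau → SeqCat p}
    (hE : ∀ T : KleinTableau, T.EntriesAtMost 2 → HasKleinTableau p (E T) T) {T : KleinTableau}
    (hC : ∃ n : ℕ, ∀ x : C, p ^ n • x = 0) {α β γ : YoungDiagram} (hβ : HasType p C β)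
    (hT : T.IsOfType α β γ) :
    (Nat.card {U : Submodule R C // IsKleinTableauOf p U T} : ℚ) =
      ∏ ℓ ∈ Finset.Icc 2 (α.colLen 0 + 1), (Nat.card (Aut (E (T.restrict 1 ℓ))) : ℚ) /
        (Nat.card (Aut (E (T.restrict 2 ℓ))) : ℚ) := by
  have hconst := hT.entriesAtMost
  have hbot : HasType p (C ⧸ (⊥ : Submodule R C)) β :=
    hβ.congr (Submodule.quotEquivOfEqBot ⊥ rfl).symm
  have hsucc : T.EntriesAtMost (α.colLen 0 + 1) := fun ℓ hℓ => by
    rw [hconst ℓ (by omega), hconst (α.colLen 0 + 1) (Nat.le_succ _)]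
  rw [← card_hasSegment hp hE T (α.colLen 0) C hC ⊥, Nat.cast_inj]
  · refine Nat.card_congr (Equiv.subtypeEquivRight fun U => ?_)
    rw [← isKleinTableauOf_iff_hasSegment hp hC hsucc]
    exact ⟨fun h => ⟨h, ((isKleinTableauOf_iff_hasSegment hp hC hconst).mp h).smul_eq_bot⟩,
      fun h => h.1⟩
  · refine ⟨by rw [Submodule.smul_bot'], fun i hi => ?_, fun i hi hi' => by omega⟩
    rw [Submodule.smul_bot', hconst _ (Nat.le_add_right _ i), hT.last]
    exact hbot

end Hall

theorem theorem1 {R : Type u} [CommRing R] [IsDomain R] [IsPrincipalIdealRing R]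
    (p : R) (hp : Prime p) [Finite (R ⧸ Ideal.span {p})] :
    -- a Klein tableau `T` with entries at most 2 determines a sequence `E(T; p)`,
    -- uniquely up to isomorphism
    (∀ T : KleinTableau, T.EntriesAtMost 2 →
      ∃ E : SeqCat p, HasKleinTableau p E T ∧
        ∀ E' : SeqCat p, HasKleinTableau p E' T → Nonempty (E' ≅ E)) ∧
    -- and for every choice of these sequences the sum-product formula holds
    ∀ E : KleinTableau → SeqCat p,
      (∀ T : KleinTableau, T.EntriesAtMost 2 → HasKleinTableau p (E T) T) →
      ∀ α β γ : YoungDiagram,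
        ∃ hfin : {T : KleinTableau | T.IsOfType α β γ}.Finite,
          (hallNumber p α β γ : ℚ) =
            ∑ T ∈ hfin.toFinset, ∏ ℓ ∈ Finset.Icc 2 (α.colLen 0 + 1),
              (Nat.card (Aut (E (T.restrict 1 ℓ))) : ℚ) /
                (Nat.card (Aut (E (T.restrict 2 ℓ))) : ℚ) := by
  constructor
  · intro T hT
    obtain ⟨B, _, _, _, A, hB, hA⟩ := exists_isKleinTableauOf_of_entriesAtMost hp hT
    obtain ⟨E, hE⟩ := exists_seqCat hB A hA
    refine ⟨E, hE, fun E' hE' => ?_⟩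
    have := SeqCat.finite hp E
    have := SeqCat.finite hp E'
    obtain ⟨e, he⟩ := IsKleinTableauOf.exists_equiv hp (SeqCat.exists_pow_smul E')
      (SeqCat.exists_pow_smul E) hT (hasKleinTableau_iff.mp hE') (hasKleinTableau_iff.mp hE)
    exact nonempty_seqIso e he
  · intro E hE α β γ
    have := finite_stdModule (p := p) β
    have hβ : HasType p (StdModule p β) β := ⟨LinearEquiv.refl R _⟩
    have hC : ∃ n : ℕ, ∀ x : StdModule p β, p ^ n • x = 0 := ⟨_, hβ.pow_smul_eq_zero⟩
    have hcard := fun (T : KleinTableau) (hT : T.IsOfType α β γ) =>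
      card_isKleinTableauOf hp hE hC hβ hT
    -- each tableau of type `(α, β, γ)` is realized by a submodule of `M(β)`, as the product is
    -- not zero
    have hex : ∀ T : {T : KleinTableau // T.IsOfType α β γ},
        ∃ U : Submodule R (StdModule p β), IsKleinTableauOf p U T.1 := by
      rintro ⟨T, hT⟩
      have h1 : (Nat.card {U : Submodule R (StdModule p β) // IsKleinTableauOf p U T} : ℚ) ≠ 0 := by
        rw [hcard T hT, Finset.prod_ne_zero_iff]
        intro ℓ _
        exact div_ne_zero (by exact_mod_cast (card_aut_pos hp _).ne')
          (by exact_mod_cast (card_aut_pos hp _).ne')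
      obtain ⟨U⟩ := (Nat.card_pos_iff.mp (Nat.pos_of_ne_zero (by exact_mod_cast h1))).1
      exact ⟨U.1, U.2⟩
    choose U hU using hex
    have hinj : Function.Injective U := fun T T' h =>
      Subtype.ext ((hU T).unique hp hC (h ▸ hU T'))
    have hfinite : Finite {T : KleinTableau // T.IsOfType α β γ} := Finite.of_injective U hinj
    have hfin : {T : KleinTableau | T.IsOfType α β γ}.Finite := hfinite
    have := Fintype.ofFinite {T : KleinTableau // T.IsOfType α β γ}
    refine ⟨hfin, ?_⟩
    rw [Finset.sum_subtype hfin.toFinset (p := fun T => T.IsOfType α β γ) (fun T => by simp),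
      ← Finset.sum_congr rfl fun T _ => hcard T.1 T.2, ← Nat.cast_sum, ← Nat.card_sigma, hallNumber,
      Nat.cast_inj]
    refine (Nat.card_congr (Equiv.ofBijective
      (fun x : (T : {T : KleinTableau // T.IsOfType α β γ}) ×
        {U : Submodule R (StdModule p β) // IsKleinTableauOf p U T.1} =>
        (⟨x.2.1, (x.2.2.isOfType_iff hp hC hβ).mp x.1.2⟩ :
          {U : Submodule R (StdModule p β) // HasType p U α ∧ HasType p (StdModule p β ⧸ U) γ}))
      ⟨?_, ?_⟩)).symm
    · rintro ⟨⟨T, hT⟩, V, hV⟩ ⟨⟨T', hT'⟩, V', hV'⟩ h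
      obtain rfl : V = V' := congrArg Subtype.val h
      obtain rfl : T = T' := hV.unique hp hC hV'
      rfl
    · rintro ⟨V, hV⟩
      obtain ⟨T, hT⟩ := exists_isKleinTableauOf hp hC V
      exact ⟨⟨⟨T, (hT.isOfType_iff hp hC hβ).mpr hV⟩, V, hT⟩, rfl⟩
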